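/- **Conventions.** Composition is in diagrammatic order, and naturality of all structural families is understood. *Linearly distributive categories.* A linearly distributive category (LDC) is a category with two monoidal structures $(\otimes,\top)$ and $(\oplus,\bot)$ and natural linear distributivities $\delta^R\colon (A\oplus B)\otimes C\to A\oplus(B\otimes C)$ and $\delta^L\colon A\otimes(B\oplus C)\to (A\otimes B)\oplus C$ satisfying the standard (Cockett–Seely) coherence laws with the units and associators and with each other. It is symmetric (SLDC) if both monoidal structures are symmetric and $\delta^R$ is obtained from $\delta^L$ by conjugation with the braidings. A cartesian linearly distributive category (CLDC) is an SLDC $(\mathbb X,\times,\mathbf 1,+,\mathbf 0)$ whose tensor is the categorical product with terminal unit and whose par is the categorical coproduct with initial unit. Write $t_A\colon A\to\mathbf 1$, $b_A\colon\mathbf 0\to A$, $\pi_i$, $\iota_i$ for the canonical maps. *Linear functors.* A linear functor $F=(F_\otimes,F_\oplus)$ between LDCs consists of a $\otimes$-monoidal functor $(F_\otimes,m_\top,m_\otimes)$, a $\oplus$-comonoidal functor $(F_\oplus,n_\bot,n_\oplus)$ and natural linear strengths $$\nu^R_\otimes\colon F_\otimes(A\oplus B)\to F_\oplus A\oplus F_\otimes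 B,\qquad \nu^L_\otimes\colon F_\otimes(A\oplus B)\to F_\otimes A\oplus F_\oplus B,$$ $$\nu^R_\oplus\colon F_\otimes A\otimes F_\oplus B\to F_\oplus(A\otimes B),\qquad \nu^L_\oplus\colon F_\oplus A\otimes F_\otimes B\to F_\oplus(A\otimes B),$$ satisfying the standard coherence laws. Between SLDCs it is strong symmetric if $m_\top,m_\otimes,n_\bot,n_\oplus$ are isomorphisms, both functors preserve the braidings, and the left strengths are the braided versions of the right ones. A cartesian linear functor is a strong symmetric linear functor between CLDCs. A linear transformation $\alpha\colon F\Rightarrow G$ is a pair of a monoidal transformation $\alpha_\otimes\colon F_\otimes\Rightarrow G_\otimes$ and a comonoidal transformation $\alpha_\oplus\colon G_\oplus\Rightarrow F_\oplus$ compatible with all the linear strengths. *Medial structures.* A symmetric medial linearly distributive category (SMLDC) is an SLDC with maps $\Delta_\bot\colon\bot\to\bot\otimes\bot$, $\nabla_\top\colon\top\oplus\top\to\top$, $m\colon\bot\to\top$ and a natural family $\mu\colon(A\otimes B)\oplus(C\otimes D)\to(A\oplus C)\otimes(B\oplus D)$ such that the category is mix with nullary mix map $m$, $(\bot,\Delta_\bot,m)$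 is a cocommutative $\otimes$-comonoid, $(\top,\nabla_\top,m)$ is a commutative $\oplus$-monoid, the structure is symmetric duoidal (coherence of $\mu,\Delta_\bot,\nabla_\top$ with the associators, unitors and braidings), and $\mu$ is coherent with the linear distributivities: for all $A,B,C,D,Z$, $$(\mu_{A,B,C,D}\otimes 1_Z);\alpha_\otimes;(1\otimes\delta^R_{B,D,Z})=\delta^R_{A\otimes B,C\otimes D,Z};(1\oplus\alpha_\otimes);\mu_{A,B,C,D\otimes Z},$$ $$(\delta^R_{Z,A,B}\oplus 1);\alpha_\oplus;(1_Z\oplus\mu_{A,B,C,D})=\mu_{Z\oplus A,B,C,D};(\alpha_\oplus\otimes 1);\delta^R_{Z,A\oplus C,B\oplus D}$$ ($\alpha_\otimes,\alpha_\oplus$ being the associators), and the two mirror-image equations for $\delta^L$. A strong symmetric medial linear functor between SMLDCs is a strong symmetric linear functor $F$ with maps $m_\bot\colon\bot\to F_\otimes\bot$, $m_\oplus\colon F_\otimes A\oplus F_\otimes B\to F_\otimes(A\oplus B)$ making $F_\otimes$ symmetric monoidal for $(\oplus,\bot)$, and maps $n_\top\colon F_\oplus\top\to\top$, $n_\otimes\colon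 F_\oplus(A\otimes B)\to F_\oplus A\otimes F_\oplus B$ making $F_\oplus$ symmetric comonoidal for $(\otimes,\top)$, such that $F_\otimes$ (with $m_\bot,m_\oplus,m_\top^{-1},m_\otimes^{-1}$) and $F_\oplus$ (with $n_\bot^{-1},n_\oplus^{-1},n_\top,n_\otimes$) are bilax duoidal functors and $$F_\oplus(\Delta_\bot)=n_\bot;\Delta_\bot;(m_\bot\otimes n_\bot^{-1});\nu^R_\oplus,\qquad F_\otimes(\nabla_\top)=\nu^R_\otimes;(n_\top\oplus m_\top^{-1});\nabla_\top;m_\top,$$ $$F_\otimes(\mu);m_\otimes^{-1};(\nu^R_\otimes\otimes\nu^R_\otimes)=\nu^R_\otimes;(n_\otimes\oplus m_\otimes^{-1});\mu,\qquad (\nu^R_\oplus\oplus\nu^R_\oplus);n_\oplus^{-1};F_\oplus(\mu)=\mu;(m_\oplus\otimes n_\oplus^{-1});\nu^R_\oplus,$$ $$m_\oplus;F_\otimes(\alpha_\oplus);\nu^R_\otimes=(\nu^R_\otimes\oplus1);\alpha_\oplus;(1\oplus m_\oplus),\qquad \nu^R_\oplus;F_\oplus(\alpha_\otimes^{-1});n_\otimes=(1\otimes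 n_\otimes);\alpha_\otimes^{-1};(\nu^R_\oplus\otimes1).$$ A medial linear transformation is a linear transformation $(\alpha_\otimes,\alpha_\oplus)$ between such functors for which $\alpha_\otimes$ is also monoidal for $(m_\bot,m_\oplus)$ and $\alpha_\oplus$ is also comonoidal for $(n_\top,n_\otimes)$. Let $\mathbf{CLDC}$ be the (strict) 2-category of CLDCs, cartesian linear functors and linear transformations, and $\mathbf{SMLDC}$ the (strict) 2-category of SMLDCs, strong symmetric medial linear functors and medial linear transformations, both with the usual compositions. **Proposition.** 1. Every CLDC $(\mathbb X,\times,\mathbf 1,+,\mathbf 0)$ is an SMLDC with the canonical structure $\Delta_{\mathbf 0}=b_{\mathbf 0\times\mathbf 0}=\langle 1,1\rangle$, $\nabla_{\mathbf 1}=t_{\mathbf 1+\mathbf 1}=[1,1]$, $m=t_{\mathbf 0}=b_{\mathbf 1}$ and $\mu=\langle\pi_0+\pi_0,\pi_1+\pi_1\rangle=[\iota_0\times\iota_0,\iota_1\times\iota_1]$. 2. Every cartesian linear functor $F$ is a strong symmetric medial linear functor for these structures with $m_{\mathbf 0}=b_{F_\otimes\mathbf 0}$ and $m_+=[F_\otimes\iota_0,F_\otimes\iota_1]$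 on $F_\otimes$, and $n_{\mathbf 1}=t_{F_\oplus\mathbf 1}$ and $n_\times=\langle F_\oplus\pi_0,F_\oplus\pi_1\rangle$ on $F_\oplus$. 3. Every linear transformation between cartesian linear functors is a medial linear transformation for these structures. 4. The resulting inclusion $\mathbf{CLDC}\to\mathbf{SMLDC}$, which equips CLDCs and cartesian linear functors with the structures of 1 and 2 and changes nothing else, is a (strict) 2-functor. -/

import Mathlib

open CategoryTheory CategoryTheory.Limits

universe v₁ v₂ v₃ v u₁ u₂ u₃ u

namespace LinDist

/-! ## Categories with two monoidal structures -/

/-- A category with two monoidal structures, the tensor `(⊗, ⊤)` and the par `(⊕, ⊥)`. -/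
class TwoMonoidal (X : Type u) [Category.{v} X] where
  tensor : MonoidalCategory X
  par : MonoidalCategory X

notation:70 A:71 " ⊠ " B:71 =>
  @MonoidalCategoryStruct.tensorObj _ _ (MonoidalCategory.toMonoidalCategoryStruct (self := TwoMonoidal.tensor)) A B
notation:70 A:71 " ⊞ " B:71 =>
  @MonoidalCategoryStruct.tensorObj _ _ (MonoidalCategory.toMonoidalCategoryStruct (self := TwoMonoidal.par)) A B
notation "⊤ₗ" =>
  @MonoidalCategoryStruct.tensorUnit _ _ (MonoidalCategory.toMonoidalCategoryStruct (self := TwoMonoidal.tensor))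
notation "⊥ₗ" =>
  @MonoidalCategoryStruct.tensorUnit _ _ (MonoidalCategory.toMonoidalCategoryStruct (self := TwoMonoidal.par))
notation:81 f:82 " ⊠ₕ " g:82 =>
  @MonoidalCategoryStruct.tensorHom _ _ (MonoidalCategory.toMonoidalCategoryStruct (self := TwoMonoidal.tensor)) _ _ _ _ f g
notation:81 f:82 " ⊞ₕ " g:82 =>
  @MonoidalCategoryStruct.tensorHom _ _ (MonoidalCategory.toMonoidalCategoryStruct (self := TwoMonoidal.par)) _ _ _ _ f g
notation:81 A:82 " ◁⊠ " f:82 =>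
  @MonoidalCategoryStruct.whiskerLeft _ _ (MonoidalCategory.toMonoidalCategoryStruct (self := TwoMonoidal.tensor)) A _ _ f
notation:81 A:82 " ◁⊞ " f:82 =>
  @MonoidalCategoryStruct.whiskerLeft _ _ (MonoidalCategory.toMonoidalCategoryStruct (self := TwoMonoidal.par)) A _ _ f
notation:81 f:82 " ▷⊠ " A:82 =>
  @MonoidalCategoryStruct.whiskerRight _ _ (MonoidalCategory.toMonoidalCategoryStruct (self := TwoMonoidal.tensor)) _ _ f A
notation:81 f:82 " ▷⊞ " A:82 =>
  @MonoidalCategoryStruct.whiskerRight _ _ (MonoidalCategory.toMonoidalCategoryStruct (self := TwoMonoidal.par)) _ _ f A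
notation "α⊠" =>
  @MonoidalCategoryStruct.associator _ _ (MonoidalCategory.toMonoidalCategoryStruct (self := TwoMonoidal.tensor))
notation "α⊞" =>
  @MonoidalCategoryStruct.associator _ _ (MonoidalCategory.toMonoidalCategoryStruct (self := TwoMonoidal.par))
notation "λ⊠" =>
  @MonoidalCategoryStruct.leftUnitor _ _ (MonoidalCategory.toMonoidalCategoryStruct (self := TwoMonoidal.tensor))
notation "λ⊞" =>
  @MonoidalCategoryStruct.leftUnitor _ _ (MonoidalCategory.toMonoidalCategoryStruct (self := TwoMonoidal.par))
notation "ρ⊠" =>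
  @MonoidalCategoryStruct.rightUnitor _ _ (MonoidalCategory.toMonoidalCategoryStruct (self := TwoMonoidal.tensor))
notation "ρ⊞" =>
  @MonoidalCategoryStruct.rightUnitor _ _ (MonoidalCategory.toMonoidalCategoryStruct (self := TwoMonoidal.par))

/-! ## Linearly distributive categories -/

/-- A linearly distributive category. Mathlib's associators and unitors are isomorphisms
`(A ⊗ B) ⊗ C ≅ A ⊗ (B ⊗ C)`, `⊤ ⊗ A ≅ A` and `A ⊗ ⊤ ≅ A`, for both monoidal structures. -/
class LinDistCategory (X : Type u) [Category.{v} X] extends TwoMonoidal X where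
  δR (A B C : X) : (A ⊞ B) ⊠ C ⟶ A ⊞ (B ⊠ C)
  δL (A B C : X) : A ⊠ (B ⊞ C) ⟶ (A ⊠ B) ⊞ C
  δR_natural {A A' B B' C C' : X} (f : A ⟶ A') (g : B ⟶ B') (h : C ⟶ C') :
    ((f ⊞ₕ g) ⊠ₕ h) ≫ δR A' B' C' = δR A B C ≫ (f ⊞ₕ (g ⊠ₕ h))
  δL_natural {A A' B B' C C' : X} (f : A ⟶ A') (g : B ⟶ B') (h : C ⟶ C') :
    (f ⊠ₕ (g ⊞ₕ h)) ≫ δL A' B' C' = δL A B C ≫ ((f ⊠ₕ g) ⊞ₕ h)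
  -- units and linear distributivities
  leftUnit_δL (A B : X) : (λ⊠ (A ⊞ B)).inv ≫ δL ⊤ₗ A B = (λ⊠ A).inv ▷⊞ B
  rightUnit_δR (A B : X) : (ρ⊠ (A ⊞ B)).inv ≫ δR A B ⊤ₗ = A ◁⊞ (ρ⊠ B).inv
  δR_leftUnit (A B : X) : δR ⊥ₗ A B ≫ (λ⊞ (A ⊠ B)).hom = (λ⊞ A).hom ▷⊠ B
  δL_rightUnit (A B : X) : δL A B ⊥ₗ ≫ (ρ⊞ (A ⊠ B)).hom = A ◁⊠ (ρ⊞ B).hom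
  -- associativities and linear distributivities
  δL_tensor_assoc (A B C D : X) :
    δL (A ⊠ B) C D ≫ ((α⊠ A B C).hom ▷⊞ D) =
      (α⊠ A B (C ⊞ D)).hom ≫ (A ◁⊠ δL B C D) ≫ δL A (B ⊠ C) D
  δR_tensor_assoc (A B C D : X) :
    (α⊠ (A ⊞ B) C D).hom ≫ δR A B (C ⊠ D) =
      (δR A B C ▷⊠ D) ≫ δR A (B ⊠ C) D ≫ (A ◁⊞ (α⊠ B C D).hom)
  δL_par_assoc (A B C D : X) :
    δL A B (C ⊞ D) ≫ (α⊞ (A ⊠ B) C D).inv =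
      (A ◁⊠ (α⊞ B C D).inv) ≫ δL A (B ⊞ C) D ≫ (δL A B C ▷⊞ D)
  δR_par_assoc (A B C D : X) :
    ((α⊞ A B C).inv ▷⊠ D) ≫ δR (A ⊞ B) C D =
      δR A (B ⊞ C) D ≫ (A ◁⊞ δR B C D) ≫ (α⊞ A B (C ⊠ D)).inv
  -- left and right linear distributivities
  δL_δR_par (A B C D : X) :
    δL (A ⊞ B) C D ≫ (δR A B C ▷⊞ D) =
      δR A B (C ⊞ D) ≫ (A ◁⊞ δL B C D) ≫ (α⊞ A (B ⊠ C) D).inv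
  δL_δR_tensor (A B C D : X) :
    (δL A B C ▷⊠ D) ≫ δR (A ⊠ B) C D =
      (α⊠ A (B ⊞ C) D).hom ≫ (A ◁⊠ δR B C D) ≫ δL A B (C ⊠ D)

open LinDistCategory

/-- A symmetric linearly distributive category. -/
class SymmLinDistCategory (X : Type u) [Category.{v} X] extends LinDistCategory X where
  tensorSymm : @SymmetricCategory X _ TwoMonoidal.tensor
  parSymm : @SymmetricCategory X _ TwoMonoidal.par
  δR_braiding (A B C : X) :
    δR A B C = (tensorSymm.toBraidedCategory.braiding (A ⊞ B) C).hom ≫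
      (C ◁⊠ (parSymm.toBraidedCategory.braiding A B).hom) ≫ δL C B A ≫
      ((tensorSymm.toBraidedCategory.braiding C B).hom ▷⊞ A) ≫
      (parSymm.toBraidedCategory.braiding (B ⊠ C) A).hom

notation "β⊠" => @BraidedCategory.braiding _ _ TwoMonoidal.tensor
  (@SymmetricCategory.toBraidedCategory _ _ TwoMonoidal.tensor SymmLinDistCategory.tensorSymm)
notation "β⊞" => @BraidedCategory.braiding _ _ TwoMonoidal.par
  (@SymmetricCategory.toBraidedCategory _ _ TwoMonoidal.par SymmLinDistCategory.parSymm)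

/-! ## Cartesian linearly distributive categories -/

/-- The tensor of a symmetric linearly distributive category is cartesian and its par is
cocartesian: `⊤` is terminal, `⊥` is initial, and the canonical maps
`A ≅ A ⊗ ⊤ ← A ⊗ B → ⊤ ⊗ B ≅ B` and `A ≅ A ⊕ ⊥ → A ⊕ B ← ⊥ ⊕ B ≅ B` form product and
coproduct diagrams. The structural isomorphisms are then the ones of the (co)cartesian structure;
this is the form of Mathlib's `CartesianMonoidalCategory`. -/
class CartesianStructure (X : Type u) [Category.{v} X] [SymmLinDistCategory X] where
  topTerminal : IsTerminal (⊤ₗ : X)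
  botInitial : IsInitial (⊥ₗ : X)
  isProduct (A B : X) : IsLimit (BinaryFan.mk
    ((A ◁⊠ topTerminal.from B) ≫ (ρ⊠ A).hom) ((topTerminal.from A ▷⊠ B) ≫ (λ⊠ B).hom))
  isCoproduct (A B : X) : IsColimit (BinaryCofan.mk
    ((ρ⊞ A).inv ≫ (A ◁⊞ botInitial.to B)) ((λ⊞ B).inv ≫ (botInitial.to A ▷⊞ B)))

section Cartesian

variable {X : Type u} [Category.{v} X] [SymmLinDistCategory X] [CartesianStructure X]

open CartesianStructure

/-- The map `t_A : A ⟶ ⊤`. -/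
def toTop (A : X) : A ⟶ ⊤ₗ := topTerminal.from A

/-- The map `b_A : ⊥ ⟶ A`. -/
def fromBot (A : X) : ⊥ₗ ⟶ A := botInitial.to A

/-- The first product projection. -/
def prodFst (A B : X) : A ⊠ B ⟶ A := (A ◁⊠ toTop B) ≫ (ρ⊠ A).hom

/-- The second product projection. -/
def prodSnd (A B : X) : A ⊠ B ⟶ B := (toTop A ▷⊠ B) ≫ (λ⊠ B).hom

/-- The first coproduct injection. -/
def coprodInl (A B : X) : A ⟶ A ⊞ B := (ρ⊞ A).inv ≫ (A ◁⊞ fromBot B)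

/-- The second coproduct injection. -/
def coprodInr (A B : X) : B ⟶ A ⊞ B := (λ⊞ B).inv ≫ (fromBot A ▷⊞ B)

end Cartesian

/-! ## Symmetric medial linearly distributive categories -/

/-- The additional structure that makes a symmetric linearly distributive category a symmetric
medial linearly distributive category. -/
class MedialStructure (X : Type u) [Category.{v} X] [SymmLinDistCategory X] where
  /-- `⊥`-contraction -/
  Δbot : (⊥ₗ : X) ⟶ ⊥ₗ ⊠ ⊥ₗ
  /-- `⊤`-cocontraction -/
  nablaTop : (⊤ₗ : X) ⊞ ⊤ₗ ⟶ ⊤ₗ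
  /-- nullary mix -/
  mix : (⊥ₗ : X) ⟶ ⊤ₗ
  /-- the medial maps -/
  med (A B C D : X) : (A ⊠ B) ⊞ (C ⊠ D) ⟶ (A ⊞ C) ⊠ (B ⊞ D)
  med_natural {A A' B B' C C' D D' : X} (f : A ⟶ A') (g : B ⟶ B') (h : C ⟶ C') (k : D ⟶ D') :
    ((f ⊠ₕ g) ⊞ₕ (h ⊠ₕ k)) ≫ med A' B' C' D' = med A B C D ≫ ((f ⊞ₕ h) ⊠ₕ (g ⊞ₕ k))
  -- the category is mix with nullary mix map `mix`
  mix_law (A B : X) :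
    (A ◁⊠ (λ⊞ B).inv) ≫ (A ◁⊠ (mix ▷⊞ B)) ≫ δL A ⊤ₗ B ≫ ((ρ⊠ A).hom ▷⊞ B) =
      ((ρ⊞ A).inv ▷⊠ B) ≫ ((A ◁⊞ mix) ▷⊠ B) ≫ δR A ⊤ₗ B ≫ (A ◁⊞ (λ⊠ B).hom)
  -- the medial maps and the linear distributivities
  med_δR_tensor (A B C D Z : X) :
    (med A B C D ▷⊠ Z) ≫ (α⊠ (A ⊞ C) (B ⊞ D) Z).hom ≫ ((A ⊞ C) ◁⊠ δR B D Z) =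
      δR (A ⊠ B) (C ⊠ D) Z ≫ ((A ⊠ B) ◁⊞ (α⊠ C D Z).hom) ≫ med A B C (D ⊠ Z)
  med_δL_tensor (A B C D Z : X) :
    (Z ◁⊠ med A B C D) ≫ (α⊠ Z (A ⊞ C) (B ⊞ D)).inv ≫ (δL Z A C ▷⊠ (B ⊞ D)) =
      δL Z (A ⊠ B) (C ⊠ D) ≫ ((α⊠ Z A B).inv ▷⊞ (C ⊠ D)) ≫ med (Z ⊠ A) B C D
  med_δR_par (A B C D Z : X) :
    (δR Z A B ▷⊞ (C ⊠ D)) ≫ (α⊞ Z (A ⊠ B) (C ⊠ D)).hom ≫ (Z ◁⊞ med A B C D) =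
      med (Z ⊞ A) B C D ≫ ((α⊞ Z A C).hom ▷⊠ (B ⊞ D)) ≫ δR Z (A ⊞ C) (B ⊞ D)
  med_δL_par (A B C D Z : X) :
    ((A ⊠ B) ◁⊞ δL C D Z) ≫ (α⊞ (A ⊠ B) (C ⊠ D) Z).inv ≫ (med A B C D ▷⊞ Z) =
      med A B C (D ⊞ Z) ≫ ((A ⊞ C) ◁⊠ (α⊞ B D Z).inv) ≫ δL (A ⊞ C) (B ⊞ D) Z
  -- `⊥` is a cocommutative comonoid and `⊤` a commutative monoid
  Δbot_assoc :
    Δbot ≫ (⊥ₗ ◁⊠ Δbot) = Δbot ≫ (Δbot ▷⊠ ⊥ₗ) ≫ (α⊠ ⊥ₗ ⊥ₗ (⊥ₗ : X)).hom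
  Δbot_mix_right : Δbot ≫ (⊥ₗ ◁⊠ mix) = (ρ⊠ (⊥ₗ : X)).inv
  Δbot_mix_left : Δbot ≫ (mix ▷⊠ ⊥ₗ) = (λ⊠ (⊥ₗ : X)).inv
  Δbot_comm : Δbot ≫ (β⊠ ⊥ₗ (⊥ₗ : X)).hom = Δbot
  nablaTop_assoc :
    (⊤ₗ ◁⊞ nablaTop) ≫ nablaTop = (α⊞ ⊤ₗ ⊤ₗ (⊤ₗ : X)).inv ≫ (nablaTop ▷⊞ ⊤ₗ) ≫ nablaTop
  mix_right_nablaTop : (⊤ₗ ◁⊞ mix) ≫ nablaTop = (ρ⊞ (⊤ₗ : X)).hom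
  mix_left_nablaTop : (mix ▷⊞ ⊤ₗ) ≫ nablaTop = (λ⊞ (⊤ₗ : X)).hom
  nablaTop_comm : (β⊞ ⊤ₗ (⊤ₗ : X)).hom ≫ nablaTop = nablaTop
  -- the medial maps and the associators
  med_tensor_assoc (A B C D E F : X) :
    med (A ⊠ B) C (D ⊠ E) F ≫ (med A B D E ▷⊠ (C ⊞ F)) ≫
        (α⊠ (A ⊞ D) (B ⊞ E) (C ⊞ F)).hom =
      ((α⊠ A B C).hom ⊞ₕ (α⊠ D E F).hom) ≫ med A (B ⊠ C) D (E ⊠ F) ≫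
        ((A ⊞ D) ◁⊠ med B C E F)
  med_par_assoc (A B C D E F : X) :
    (α⊞ (A ⊠ B) (C ⊠ D) (E ⊠ F)).inv ≫ (med A B C D ▷⊞ (E ⊠ F)) ≫
        med (A ⊞ C) (B ⊞ D) E F =
      ((A ⊠ B) ◁⊞ med C D E F) ≫ med A B (C ⊞ E) (D ⊞ F) ≫
        ((α⊞ A C E).inv ⊠ₕ (α⊞ B D F).inv)
  -- the medial maps and the unitors
  Δbot_med_left (A B : X) :
    (Δbot ▷⊞ (A ⊠ B)) ≫ med ⊥ₗ ⊥ₗ A B ≫ ((λ⊞ A).hom ⊠ₕ (λ⊞ B).hom) = (λ⊞ (A ⊠ B)).hom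
  Δbot_med_right (A B : X) :
    ((A ⊠ B) ◁⊞ Δbot) ≫ med A B ⊥ₗ ⊥ₗ ≫ ((ρ⊞ A).hom ⊠ₕ (ρ⊞ B).hom) = (ρ⊞ (A ⊠ B)).hom
  med_nablaTop_left (A B : X) :
    ((λ⊠ A).inv ⊞ₕ (λ⊠ B).inv) ≫ med ⊤ₗ A ⊤ₗ B ≫ (nablaTop ▷⊠ (A ⊞ B)) = (λ⊠ (A ⊞ B)).inv
  med_nablaTop_right (A B : X) :
    ((ρ⊠ A).inv ⊞ₕ (ρ⊠ B).inv) ≫ med A ⊤ₗ B ⊤ₗ ≫ ((A ⊞ B) ◁⊠ nablaTop) = (ρ⊠ (A ⊞ B)).inv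
  -- the medial maps and the braidings
  med_tensor_braiding (A B C D : X) :
    med A B C D ≫ (β⊠ (A ⊞ C) (B ⊞ D)).hom =
      ((β⊠ A B).hom ⊞ₕ (β⊠ C D).hom) ≫ med B A D C
  med_par_braiding (A B C D : X) :
    med A B C D ≫ ((β⊞ A C).hom ⊠ₕ (β⊞ B D).hom) =
      (β⊞ (A ⊠ B) (C ⊠ D)).hom ≫ med C D A B

open MedialStructure

/-! ## Linear functors -/

section Functors

variable (X : Type u₁) [Category.{v₁} X] (Y : Type u₂) [Category.{v₂} Y]

/-- A functor which is monoidal for the tensor structures. -/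
abbrev TensorLax {X : Type u₁} [Category.{v₁} X] {Y : Type u₂} [Category.{v₂} Y]
    [TwoMonoidal X] [TwoMonoidal Y] (F : X ⥤ Y) :=
  @Functor.LaxMonoidal X _ TwoMonoidal.tensor Y _ TwoMonoidal.tensor F

/-- A functor which is comonoidal for the tensor structures. -/
abbrev TensorOplax {X : Type u₁} [Category.{v₁} X] {Y : Type u₂} [Category.{v₂} Y]
    [TwoMonoidal X] [TwoMonoidal Y] (F : X ⥤ Y) :=
  @Functor.OplaxMonoidal X _ TwoMonoidal.tensor Y _ TwoMonoidal.tensor F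

/-- A functor which is monoidal for the par structures. -/
abbrev ParLax {X : Type u₁} [Category.{v₁} X] {Y : Type u₂} [Category.{v₂} Y]
    [TwoMonoidal X] [TwoMonoidal Y] (F : X ⥤ Y) :=
  @Functor.LaxMonoidal X _ TwoMonoidal.par Y _ TwoMonoidal.par F

/-- A functor which is comonoidal for the par structures. -/
abbrev ParOplax {X : Type u₁} [Category.{v₁} X] {Y : Type u₂} [Category.{v₂} Y]
    [TwoMonoidal X] [TwoMonoidal Y] (F : X ⥤ Y) :=
  @Functor.OplaxMonoidal X _ TwoMonoidal.par Y _ TwoMonoidal.par F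

/-- The data of a linear functor: a `⊗`-monoidal functor `T = F_⊗`, a `⊕`-comonoidal functor
`P = F_⊕` and the four linear strengths. -/
structure LinearFunctorData [TwoMonoidal X] [TwoMonoidal Y] where
  T : X ⥤ Y
  P : X ⥤ Y
  lax : TensorLax T
  oplax : ParOplax P
  νRT (A B : X) : T.obj (A ⊞ B) ⟶ P.obj A ⊞ T.obj B
  νLT (A B : X) : T.obj (A ⊞ B) ⟶ T.obj A ⊞ P.obj B
  νRP (A B : X) : T.obj A ⊠ P.obj B ⟶ P.obj (A ⊠ B)
  νLP (A B : X) : P.obj A ⊠ T.obj B ⟶ P.obj (A ⊠ B)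

namespace LinearFunctorData

variable {X Y}
variable [TwoMonoidal X] [TwoMonoidal Y] (F : LinearFunctorData X Y)

/-- `m_⊤ : ⊤ ⟶ F_⊗ ⊤` -/
abbrev mTop : ⊤ₗ ⟶ F.T.obj ⊤ₗ :=
  @Functor.LaxMonoidal.ε X _ TwoMonoidal.tensor Y _ TwoMonoidal.tensor F.T F.lax

/-- `m_⊗ : F_⊗ A ⊗ F_⊗ B ⟶ F_⊗ (A ⊗ B)` -/
abbrev mTen (A B : X) : F.T.obj A ⊠ F.T.obj B ⟶ F.T.obj (A ⊠ B) :=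
  @Functor.LaxMonoidal.μ X _ TwoMonoidal.tensor Y _ TwoMonoidal.tensor F.T F.lax A B

/-- `n_⊥ : F_⊕ ⊥ ⟶ ⊥` -/
abbrev nBot : F.P.obj ⊥ₗ ⟶ ⊥ₗ :=
  @Functor.OplaxMonoidal.η X _ TwoMonoidal.par Y _ TwoMonoidal.par F.P F.oplax

/-- `n_⊕ : F_⊕ (A ⊕ B) ⟶ F_⊕ A ⊕ F_⊕ B` -/
abbrev nPar (A B : X) : F.P.obj (A ⊞ B) ⟶ F.P.obj A ⊞ F.P.obj B :=
  @Functor.OplaxMonoidal.δ X _ TwoMonoidal.par Y _ TwoMonoidal.par F.P F.oplax A B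

end LinearFunctorData

/-- A linear functor between linearly distributive categories. -/
structure LinearFunctor [LinDistCategory X] [LinDistCategory Y]
    extends LinearFunctorData X Y where
  νRT_natural {A A' B B' : X} (f : A ⟶ A') (g : B ⟶ B') :
    T.map (f ⊞ₕ g) ≫ νRT A' B' = νRT A B ≫ (P.map f ⊞ₕ T.map g)
  νLT_natural {A A' B B' : X} (f : A ⟶ A') (g : B ⟶ B') :
    T.map (f ⊞ₕ g) ≫ νLT A' B' = νLT A B ≫ (T.map f ⊞ₕ P.map g)
  νRP_natural {A A' B B' : X} (f : A ⟶ A') (g : B ⟶ B') :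
    (T.map f ⊠ₕ P.map g) ≫ νRP A' B' = νRP A B ≫ P.map (f ⊠ₕ g)
  νLP_natural {A A' B B' : X} (f : A ⟶ A') (g : B ⟶ B') :
    (P.map f ⊠ₕ T.map g) ≫ νLP A' B' = νLP A B ≫ P.map (f ⊠ₕ g)
  -- units
  νRT_unit (A : X) :
    νRT ⊥ₗ A ≫ (toLinearFunctorData.nBot ▷⊞ T.obj A) ≫ (λ⊞ (T.obj A)).hom =
      T.map (λ⊞ A).hom
  νLT_unit (A : X) :
    νLT A ⊥ₗ ≫ (T.obj A ◁⊞ toLinearFunctorData.nBot) ≫ (ρ⊞ (T.obj A)).hom =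
      T.map (ρ⊞ A).hom
  νRP_unit (A : X) :
    (λ⊠ (P.obj A)).inv ≫ (toLinearFunctorData.mTop ▷⊠ P.obj A) ≫ νRP ⊤ₗ A =
      P.map (λ⊠ A).inv
  νLP_unit (A : X) :
    (ρ⊠ (P.obj A)).inv ≫ (P.obj A ◁⊠ toLinearFunctorData.mTop) ≫ νLP A ⊤ₗ =
      P.map (ρ⊠ A).inv
  -- associativities
  νRT_assoc (A B C : X) :
    νRT A (B ⊞ C) ≫ (P.obj A ◁⊞ νRT B C) ≫ (α⊞ (P.obj A) (P.obj B) (T.obj C)).inv =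
      T.map (α⊞ A B C).inv ≫ νRT (A ⊞ B) C ≫ (toLinearFunctorData.nPar A B ▷⊞ T.obj C)
  νLT_assoc (A B C : X) :
    νLT A (B ⊞ C) ≫ (T.obj A ◁⊞ toLinearFunctorData.nPar B C) ≫
        (α⊞ (T.obj A) (P.obj B) (P.obj C)).inv =
      T.map (α⊞ A B C).inv ≫ νLT (A ⊞ B) C ≫ (νLT A B ▷⊞ P.obj C)
  νRP_assoc (A B C : X) :
    (α⊠ (T.obj A) (T.obj B) (P.obj C)).hom ≫ (T.obj A ◁⊠ νRP B C) ≫ νRP A (B ⊠ C) =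
      (toLinearFunctorData.mTen A B ▷⊠ P.obj C) ≫ νRP (A ⊠ B) C ≫ P.map (α⊠ A B C).hom
  νLP_assoc (A B C : X) :
    (α⊠ (P.obj A) (T.obj B) (T.obj C)).hom ≫ (P.obj A ◁⊠ toLinearFunctorData.mTen B C) ≫
        νLP A (B ⊠ C) =
      (νLP A B ▷⊠ T.obj C) ≫ νLP (A ⊠ B) C ≫ P.map (α⊠ A B C).hom
  -- linear distributivities
  mTen_δR_νRT (A B C : X) :
    toLinearFunctorData.mTen (A ⊞ B) C ≫ T.map (δR A B C) ≫ νRT A (B ⊠ C) =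
      (νRT A B ▷⊠ T.obj C) ≫ δR (P.obj A) (T.obj B) (T.obj C) ≫
        (P.obj A ◁⊞ toLinearFunctorData.mTen B C)
  mTen_δL_νLT (A B C : X) :
    toLinearFunctorData.mTen A (B ⊞ C) ≫ T.map (δL A B C) ≫ νLT (A ⊠ B) C =
      (T.obj A ◁⊠ νLT B C) ≫ δL (T.obj A) (T.obj B) (P.obj C) ≫
        (toLinearFunctorData.mTen A B ▷⊞ P.obj C)
  νRP_δL_nPar (A B C : X) :
    νRP A (B ⊞ C) ≫ P.map (δL A B C) ≫ toLinearFunctorData.nPar (A ⊠ B) C =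
      (T.obj A ◁⊠ toLinearFunctorData.nPar B C) ≫ δL (T.obj A) (P.obj B) (P.obj C) ≫
        (νRP A B ▷⊞ P.obj C)
  νLP_δR_nPar (A B C : X) :
    νLP (A ⊞ B) C ≫ P.map (δR A B C) ≫ toLinearFunctorData.nPar A (B ⊠ C) =
      (toLinearFunctorData.nPar A B ▷⊠ T.obj C) ≫ δR (P.obj A) (P.obj B) (T.obj C) ≫
        (P.obj A ◁⊞ νLP B C)
  -- the other linear strengths via associators
  νRT_νLT (A B C : X) :
    νRT A (B ⊞ C) ≫ (P.obj A ◁⊞ νLT B C) ≫ (α⊞ (P.obj A) (T.obj B) (P.obj C)).inv =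
      T.map (α⊞ A B C).inv ≫ νLT (A ⊞ B) C ≫ (νRT A B ▷⊞ P.obj C)
  νLP_νRP (A B C : X) :
    (α⊠ (T.obj A) (P.obj B) (T.obj C)).hom ≫ (T.obj A ◁⊠ νLP B C) ≫ νRP A (B ⊠ C) =
      (νRP A B ▷⊠ T.obj C) ≫ νLP (A ⊠ B) C ≫ P.map (α⊠ A B C).hom
  -- the other linear strengths via linear distributivities
  mTen_δL_νRT (A B C : X) :
    toLinearFunctorData.mTen A (B ⊞ C) ≫ T.map (δL A B C) ≫ νRT (A ⊠ B) C =
      (T.obj A ◁⊠ νRT B C) ≫ δL (T.obj A) (P.obj B) (T.obj C) ≫ (νRP A B ▷⊞ T.obj C)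
  mTen_δR_νLT (A B C : X) :
    toLinearFunctorData.mTen (A ⊞ B) C ≫ T.map (δR A B C) ≫ νLT A (B ⊠ C) =
      (νLT A B ▷⊠ T.obj C) ≫ δR (T.obj A) (P.obj B) (T.obj C) ≫ (T.obj A ◁⊞ νLP B C)
  νRP_δR_nPar (A B C : X) :
    νRP (A ⊞ B) C ≫ P.map (δR A B C) ≫ toLinearFunctorData.nPar A (B ⊠ C) =
      (νRT A B ▷⊠ P.obj C) ≫ δR (P.obj A) (T.obj B) (P.obj C) ≫ (P.obj A ◁⊞ νRP B C)
  νLP_δL_nPar (A B C : X) :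
    νLP A (B ⊞ C) ≫ P.map (δL A B C) ≫ toLinearFunctorData.nPar (A ⊠ B) C =
      (P.obj A ◁⊠ νLT B C) ≫ δL (P.obj A) (T.obj B) (P.obj C) ≫ (νLP A B ▷⊞ P.obj C)

/-- A strong symmetric linear functor between symmetric linearly distributive categories.
Between cartesian linearly distributive categories these are the cartesian linear functors. -/
structure StrongSymmLinearFunctor [SymmLinDistCategory X] [SymmLinDistCategory Y]
    extends LinearFunctor X Y where
  -- strength
  isIso_mTop : IsIso toLinearFunctorData.mTop
  isIso_mTen (A B : X) : IsIso (toLinearFunctorData.mTen A B)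
  isIso_nBot : IsIso toLinearFunctorData.nBot
  isIso_nPar (A B : X) : IsIso (toLinearFunctorData.nPar A B)
  -- symmetry
  mTen_braiding (A B : X) :
    toLinearFunctorData.mTen A B ≫ T.map (β⊠ A B).hom =
      (β⊠ (T.obj A) (T.obj B)).hom ≫ toLinearFunctorData.mTen B A
  nPar_braiding (A B : X) :
    toLinearFunctorData.nPar A B ≫ (β⊞ (P.obj A) (P.obj B)).hom =
      P.map (β⊞ A B).hom ≫ toLinearFunctorData.nPar B A
  νRT_braiding (A B : X) :
    νRT A B ≫ (β⊞ (P.obj A) (T.obj B)).hom = T.map (β⊞ A B).hom ≫ νLT B A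
  νRP_braiding (A B : X) :
    νRP A B ≫ P.map (β⊠ A B).hom = (β⊠ (T.obj A) (P.obj B)).hom ≫ νLP B A

attribute [instance] StrongSymmLinearFunctor.isIso_mTop StrongSymmLinearFunctor.isIso_mTen
  StrongSymmLinearFunctor.isIso_nBot StrongSymmLinearFunctor.isIso_nPar

variable {X Y}

/-- The additional structure that makes a strong symmetric linear functor between symmetric medial
linearly distributive categories a strong symmetric medial linear functor, before the
compatibilities. -/
structure MedialFunctorData [SymmLinDistCategory X] [SymmLinDistCategory Y]
    (F : StrongSymmLinearFunctor X Y) where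
  parLax : ParLax F.T
  tenOplax : TensorOplax F.P

namespace MedialFunctorData

variable [SymmLinDistCategory X] [SymmLinDistCategory Y] {F : StrongSymmLinearFunctor X Y}
  (M : MedialFunctorData F)

/-- `m_⊥ : ⊥ ⟶ F_⊗ ⊥` -/
abbrev mBot : ⊥ₗ ⟶ F.T.obj ⊥ₗ :=
  @Functor.LaxMonoidal.ε X _ TwoMonoidal.par Y _ TwoMonoidal.par F.T M.parLax

/-- `m_⊕ : F_⊗ A ⊕ F_⊗ B ⟶ F_⊗ (A ⊕ B)` -/
abbrev mPar (A B : X) : F.T.obj A ⊞ F.T.obj B ⟶ F.T.obj (A ⊞ B) :=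
  @Functor.LaxMonoidal.μ X _ TwoMonoidal.par Y _ TwoMonoidal.par F.T M.parLax A B

/-- `n_⊤ : F_⊕ ⊤ ⟶ ⊤` -/
abbrev nTop : F.P.obj ⊤ₗ ⟶ ⊤ₗ :=
  @Functor.OplaxMonoidal.η X _ TwoMonoidal.tensor Y _ TwoMonoidal.tensor F.P M.tenOplax

/-- `n_⊗ : F_⊕ (A ⊗ B) ⟶ F_⊕ A ⊗ F_⊕ B` -/
abbrev nTen (A B : X) : F.P.obj (A ⊠ B) ⟶ F.P.obj A ⊠ F.P.obj B :=
  @Functor.OplaxMonoidal.δ X _ TwoMonoidal.tensor Y _ TwoMonoidal.tensor F.P M.tenOplax A B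

end MedialFunctorData

/-- The structure that makes a strong symmetric linear functor between symmetric medial linearly
distributive categories a strong symmetric medial linear functor. -/
structure MedialFunctorStructure [SymmLinDistCategory X] [SymmLinDistCategory Y]
    [MedialStructure X] [MedialStructure Y] (F : StrongSymmLinearFunctor X Y)
    extends MedialFunctorData F where
  -- symmetry of the two additional (co)monoidal structures
  mPar_braiding (A B : X) :
    toMedialFunctorData.mPar A B ≫ F.T.map (β⊞ A B).hom =
      (β⊞ (F.T.obj A) (F.T.obj B)).hom ≫ toMedialFunctorData.mPar B A
  nTen_braiding (A B : X) :
    toMedialFunctorData.nTen A B ≫ (β⊠ (F.P.obj A) (F.P.obj B)).hom =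
      F.P.map (β⊠ A B).hom ≫ toMedialFunctorData.nTen B A
  -- `F_⊗` is a bilax duoidal functor
  T_Δbot :
    Δbot ≫ (toMedialFunctorData.mBot ⊠ₕ toMedialFunctorData.mBot) ≫ F.mTen ⊥ₗ ⊥ₗ =
      toMedialFunctorData.mBot ≫ F.T.map Δbot
  T_nablaTop :
    (F.mTop ⊞ₕ F.mTop) ≫ toMedialFunctorData.mPar ⊤ₗ ⊤ₗ ≫ F.T.map nablaTop =
      nablaTop ≫ F.mTop
  T_mix : mix ≫ F.mTop = toMedialFunctorData.mBot ≫ F.T.map mix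
  T_med (A B C D : X) :
    (F.mTen A B ⊞ₕ F.mTen C D) ≫ toMedialFunctorData.mPar (A ⊠ B) (C ⊠ D) ≫
        F.T.map (med A B C D) =
      med (F.T.obj A) (F.T.obj B) (F.T.obj C) (F.T.obj D) ≫
        (toMedialFunctorData.mPar A C ⊠ₕ toMedialFunctorData.mPar B D) ≫
        F.mTen (A ⊞ C) (B ⊞ D)
  -- `F_⊕` is a bilax duoidal functor
  P_Δbot :
    F.P.map Δbot ≫ toMedialFunctorData.nTen ⊥ₗ ⊥ₗ ≫ (F.nBot ⊠ₕ F.nBot) = F.nBot ≫ Δbot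
  P_nablaTop :
    F.nPar ⊤ₗ ⊤ₗ ≫ (toMedialFunctorData.nTop ⊞ₕ toMedialFunctorData.nTop) ≫ nablaTop =
      F.P.map nablaTop ≫ toMedialFunctorData.nTop
  P_mix : F.nBot ≫ mix = F.P.map mix ≫ toMedialFunctorData.nTop
  P_med (A B C D : X) :
    F.P.map (med A B C D) ≫ toMedialFunctorData.nTen (A ⊞ C) (B ⊞ D) ≫
        (F.nPar A C ⊠ₕ F.nPar B D) =
      F.nPar (A ⊠ B) (C ⊠ D) ≫
        (toMedialFunctorData.nTen A B ⊞ₕ toMedialFunctorData.nTen C D) ≫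
        med (F.P.obj A) (F.P.obj B) (F.P.obj C) (F.P.obj D)
  -- the linear strengths, `⊥`-contraction and `⊤`-cocontraction
  νRP_Δbot :
    F.P.map Δbot =
      F.nBot ≫ Δbot ≫ (toMedialFunctorData.mBot ⊠ₕ inv F.nBot) ≫ F.νRP ⊥ₗ ⊥ₗ
  νRT_nablaTop :
    F.T.map nablaTop =
      F.νRT ⊤ₗ ⊤ₗ ≫ (toMedialFunctorData.nTop ⊞ₕ inv F.mTop) ≫ nablaTop ≫ F.mTop
  -- the linear strengths and the medial maps
  νRT_med (A B C D : X) :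
    F.T.map (med A B C D) ≫ inv (F.mTen (A ⊞ C) (B ⊞ D)) ≫ (F.νRT A C ⊠ₕ F.νRT B D) =
      F.νRT (A ⊠ B) (C ⊠ D) ≫ (toMedialFunctorData.nTen A B ⊞ₕ inv (F.mTen C D)) ≫
        med (F.P.obj A) (F.P.obj B) (F.T.obj C) (F.T.obj D)
  νRP_med (A B C D : X) :
    (F.νRP A B ⊞ₕ F.νRP C D) ≫ inv (F.nPar (A ⊠ B) (C ⊠ D)) ≫ F.P.map (med A B C D) =
      med (F.T.obj A) (F.P.obj B) (F.T.obj C) (F.P.obj D) ≫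
        (toMedialFunctorData.mPar A C ⊠ₕ inv (F.nPar B D)) ≫ F.νRP (A ⊞ C) (B ⊞ D)
  -- the linear strengths, `m_⊕` and `n_⊗`
  mPar_νRT (A B C : X) :
    toMedialFunctorData.mPar (A ⊞ B) C ≫ F.T.map (α⊞ A B C).hom ≫ F.νRT A (B ⊞ C) =
      (F.νRT A B ▷⊞ F.T.obj C) ≫ (α⊞ (F.P.obj A) (F.T.obj B) (F.T.obj C)).hom ≫
        (F.P.obj A ◁⊞ toMedialFunctorData.mPar B C)
  νRP_nTen (A B C : X) :
    F.νRP A (B ⊠ C) ≫ F.P.map (α⊠ A B C).inv ≫ toMedialFunctorData.nTen (A ⊠ B) C =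
      (F.T.obj A ◁⊠ toMedialFunctorData.nTen B C) ≫
        (α⊠ (F.T.obj A) (F.P.obj B) (F.P.obj C)).inv ≫ (F.νRP A B ▷⊠ F.P.obj C)

variable (X Y) in
/-- A strong symmetric medial linear functor. -/
structure MedialLinearFunctor [SymmLinDistCategory X] [SymmLinDistCategory Y]
    [MedialStructure X] [MedialStructure Y] extends StrongSymmLinearFunctor X Y where
  medial : MedialFunctorStructure toStrongSymmLinearFunctor

/-! ## Linear transformations -/

/-- A linear transformation `F ⟹ G`: a monoidal transformation `F_⊗ ⟹ G_⊗` and a comonoidal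
transformation `G_⊕ ⟹ F_⊕`, compatible with the linear strengths. -/
@[ext]
structure LinearTransformation [LinDistCategory X] [LinDistCategory Y]
    (F G : LinearFunctor X Y) where
  t : F.T ⟶ G.T
  p : G.P ⟶ F.P
  t_mTop : F.mTop ≫ t.app ⊤ₗ = G.mTop
  t_mTen (A B : X) : F.mTen A B ≫ t.app (A ⊠ B) = (t.app A ⊠ₕ t.app B) ≫ G.mTen A B
  p_nBot : p.app ⊥ₗ ≫ F.nBot = G.nBot
  p_nPar (A B : X) : p.app (A ⊞ B) ≫ F.nPar A B = G.nPar A B ≫ (p.app A ⊞ₕ p.app B)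
  νRT_comm (A B : X) :
    t.app (A ⊞ B) ≫ G.νRT A B ≫ (p.app A ▷⊞ G.T.obj B) =
      F.νRT A B ≫ (F.P.obj A ◁⊞ t.app B)
  νLT_comm (A B : X) :
    t.app (A ⊞ B) ≫ G.νLT A B ≫ (G.T.obj A ◁⊞ p.app B) =
      F.νLT A B ≫ (t.app A ▷⊞ F.P.obj B)
  νLP_comm (A B : X) :
    (G.P.obj A ◁⊠ t.app B) ≫ G.νLP A B ≫ p.app (A ⊠ B) =
      (p.app A ▷⊠ F.T.obj B) ≫ F.νLP A B
  νRP_comm (A B : X) :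
    (t.app A ▷⊠ G.P.obj B) ≫ G.νRP A B ≫ p.app (A ⊠ B) =
      (F.T.obj A ◁⊠ p.app B) ≫ F.νRP A B

/-- The additional conditions on a linear transformation between medial linear functors to be a
medial linear transformation. -/
structure IsMedialTransformation [SymmLinDistCategory X] [SymmLinDistCategory Y]
    {F G : StrongSymmLinearFunctor X Y} (M : MedialFunctorData F) (N : MedialFunctorData G)
    (α : LinearTransformation F.toLinearFunctor G.toLinearFunctor) : Prop where
  t_mBot : M.mBot ≫ α.t.app ⊥ₗ = N.mBot
  t_mPar (A B : X) : M.mPar A B ≫ α.t.app (A ⊞ B) = (α.t.app A ⊞ₕ α.t.app B) ≫ N.mPar A B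
  p_nTop : α.p.app ⊤ₗ ≫ M.nTop = N.nTop
  p_nTen (A B : X) : α.p.app (A ⊠ B) ≫ M.nTen A B = N.nTen A B ≫ (α.p.app A ⊠ₕ α.p.app B)

/-- A (strong) medial linear transformation. -/
@[ext]
structure MedialLinearTransformation [SymmLinDistCategory X] [SymmLinDistCategory Y]
    [MedialStructure X] [MedialStructure Y] (F G : MedialLinearFunctor X Y)
    extends LinearTransformation F.toLinearFunctor G.toLinearFunctor where
  isMedial : IsMedialTransformation F.medial.toMedialFunctorData G.medial.toMedialFunctorData
    toLinearTransformation

end Functors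

section Composition

variable {X : Type u₁} [Category.{v₁} X] {Y : Type u₂} [Category.{v₂} Y]
  {Z : Type u₃} [Category.{v₃} Z]

namespace LinearFunctorData

/-- The identity data. -/
def id (X : Type u₁) [Category.{v₁} X] [TwoMonoidal X] : LinearFunctorData X X where
  T := 𝟭 X
  P := 𝟭 X
  lax := @Functor.LaxMonoidal.id X _ TwoMonoidal.tensor
  oplax := @Functor.OplaxMonoidal.id X _ TwoMonoidal.par
  νRT A B := 𝟙 (A ⊞ B)
  νLT A B := 𝟙 (A ⊞ B)
  νRP A B := 𝟙 (A ⊠ B)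
  νLP A B := 𝟙 (A ⊠ B)

/-- The composite data. -/
def comp [TwoMonoidal X] [TwoMonoidal Y] [TwoMonoidal Z]
    (F : LinearFunctorData X Y) (G : LinearFunctorData Y Z) : LinearFunctorData X Z where
  T := F.T ⋙ G.T
  P := F.P ⋙ G.P
  lax := @Functor.LaxMonoidal.comp X _ TwoMonoidal.tensor Y _ TwoMonoidal.tensor
    Z _ TwoMonoidal.tensor F.T G.T F.lax G.lax
  oplax := @Functor.OplaxMonoidal.comp X _ TwoMonoidal.par Y _ TwoMonoidal.par
    Z _ TwoMonoidal.par F.P G.P F.oplax G.oplax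
  νRT A B := G.T.map (F.νRT A B) ≫ G.νRT (F.P.obj A) (F.T.obj B)
  νLT A B := G.T.map (F.νLT A B) ≫ G.νLT (F.T.obj A) (F.P.obj B)
  νRP A B := G.νRP (F.T.obj A) (F.P.obj B) ≫ G.P.map (F.νRP A B)
  νLP A B := G.νLP (F.P.obj A) (F.T.obj B) ≫ G.P.map (F.νLP A B)

section

variable [TwoMonoidal X]

@[simp] lemma id_T : (id X).T = 𝟭 X := rfl
@[simp] lemma id_P : (id X).P = 𝟭 X := rfl
@[simp] lemma id_mTop : (id X).mTop = 𝟙 _ := rfl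
@[simp] lemma id_mTen (A B : X) : (id X).mTen A B = 𝟙 _ := rfl
@[simp] lemma id_nBot : (id X).nBot = 𝟙 _ := rfl
@[simp] lemma id_nPar (A B : X) : (id X).nPar A B = 𝟙 _ := rfl
@[simp] lemma id_νRT (A B : X) : (id X).νRT A B = 𝟙 _ := rfl
@[simp] lemma id_νLT (A B : X) : (id X).νLT A B = 𝟙 _ := rfl
@[simp] lemma id_νRP (A B : X) : (id X).νRP A B = 𝟙 _ := rfl
@[simp] lemma id_νLP (A B : X) : (id X).νLP A B = 𝟙 _ := rfl

variable [TwoMonoidal Y] [TwoMonoidal Z] (F : LinearFunctorData X Y) (G : LinearFunctorData Y Z)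

@[simp] lemma comp_T : (F.comp G).T = F.T ⋙ G.T := rfl
@[simp] lemma comp_P : (F.comp G).P = F.P ⋙ G.P := rfl
@[simp] lemma comp_mTop : (F.comp G).mTop = G.mTop ≫ G.T.map F.mTop := rfl
@[simp] lemma comp_mTen (A B : X) :
    (F.comp G).mTen A B = G.mTen _ _ ≫ G.T.map (F.mTen A B) := rfl
@[simp] lemma comp_nBot : (F.comp G).nBot = G.P.map F.nBot ≫ G.nBot := rfl
@[simp] lemma comp_nPar (A B : X) :
    (F.comp G).nPar A B = G.P.map (F.nPar A B) ≫ G.nPar _ _ := rfl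
@[simp] lemma comp_νRT (A B : X) :
    (F.comp G).νRT A B = G.T.map (F.νRT A B) ≫ G.νRT _ _ := rfl
@[simp] lemma comp_νLT (A B : X) :
    (F.comp G).νLT A B = G.T.map (F.νLT A B) ≫ G.νLT _ _ := rfl
@[simp] lemma comp_νRP (A B : X) :
    (F.comp G).νRP A B = G.νRP _ _ ≫ G.P.map (F.νRP A B) := rfl
@[simp] lemma comp_νLP (A B : X) :
    (F.comp G).νLP A B = G.νLP _ _ ≫ G.P.map (F.νLP A B) := rfl

end

section

variable [TwoMonoidal X] [TwoMonoidal Y] (F : LinearFunctorData X Y)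

lemma mTen_natural {A A' B B' : X} (f : A ⟶ A') (g : B ⟶ B') :
    (F.T.map f ⊠ₕ F.T.map g) ≫ F.mTen A' B' = F.mTen A B ≫ F.T.map (f ⊠ₕ g) :=
  @Functor.LaxMonoidal.μ_natural X _ TwoMonoidal.tensor Y _ TwoMonoidal.tensor F.T F.lax
    _ _ _ _ f g

lemma nPar_natural {A A' B B' : X} (f : A ⟶ A') (g : B ⟶ B') :
    F.nPar A B ≫ (F.P.map f ⊞ₕ F.P.map g) = F.P.map (f ⊞ₕ g) ≫ F.nPar A' B' :=
  @Functor.OplaxMonoidal.δ_natural X _ TwoMonoidal.par Y _ TwoMonoidal.par F.P F.oplax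
    _ _ _ _ f g

lemma mTen_natural_left {A A' : X} (f : A ⟶ A') (B : X) :
    (F.T.map f ▷⊠ F.T.obj B) ≫ F.mTen A' B = F.mTen A B ≫ F.T.map (f ▷⊠ B) :=
  @Functor.LaxMonoidal.μ_natural_left X _ TwoMonoidal.tensor Y _ TwoMonoidal.tensor F.T F.lax
    _ _ f B

lemma mTen_natural_right (A : X) {B B' : X} (f : B ⟶ B') :
    (F.T.obj A ◁⊠ F.T.map f) ≫ F.mTen A B' = F.mTen A B ≫ F.T.map (A ◁⊠ f) :=
  @Functor.LaxMonoidal.μ_natural_right X _ TwoMonoidal.tensor Y _ TwoMonoidal.tensor F.T F.lax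
    _ _ A f

lemma nPar_natural_left {A A' : X} (f : A ⟶ A') (B : X) :
    F.nPar A B ≫ (F.P.map f ▷⊞ F.P.obj B) = F.P.map (f ▷⊞ B) ≫ F.nPar A' B :=
  @Functor.OplaxMonoidal.δ_natural_left X _ TwoMonoidal.par Y _ TwoMonoidal.par F.P F.oplax
    _ _ f B

lemma nPar_natural_right (A : X) {B B' : X} (f : B ⟶ B') :
    F.nPar A B ≫ (F.P.obj A ◁⊞ F.P.map f) = F.P.map (A ◁⊞ f) ≫ F.nPar A B' :=
  @Functor.OplaxMonoidal.δ_natural_right X _ TwoMonoidal.par Y _ TwoMonoidal.par F.P F.oplax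
    _ _ A f

end

end LinearFunctorData

namespace LinearFunctor

section Naturality

variable [LinDistCategory X] [LinDistCategory Y] (F : LinearFunctor X Y)

lemma νRT_natural_left {A A' : X} (f : A ⟶ A') (B : X) :
    F.νRT A B ≫ (F.P.map f ▷⊞ F.T.obj B) = F.T.map (f ▷⊞ B) ≫ F.νRT A' B := by
  simpa only [F.T.map_id, MonoidalCategory.tensorHom_id] using (F.νRT_natural f (𝟙 B)).symm

lemma νRT_natural_right (A : X) {B B' : X} (f : B ⟶ B') :
    F.νRT A B ≫ (F.P.obj A ◁⊞ F.T.map f) = F.T.map (A ◁⊞ f) ≫ F.νRT A B' := by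
  simpa only [F.P.map_id, MonoidalCategory.id_tensorHom] using (F.νRT_natural (𝟙 A) f).symm

lemma νLT_natural_left {A A' : X} (f : A ⟶ A') (B : X) :
    F.νLT A B ≫ (F.T.map f ▷⊞ F.P.obj B) = F.T.map (f ▷⊞ B) ≫ F.νLT A' B := by
  simpa only [F.P.map_id, MonoidalCategory.tensorHom_id] using (F.νLT_natural f (𝟙 B)).symm

lemma νLT_natural_right (A : X) {B B' : X} (f : B ⟶ B') :
    F.νLT A B ≫ (F.T.obj A ◁⊞ F.P.map f) = F.T.map (A ◁⊞ f) ≫ F.νLT A B' := by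
  simpa only [F.T.map_id, MonoidalCategory.id_tensorHom] using (F.νLT_natural (𝟙 A) f).symm

lemma νRP_natural_left {A A' : X} (f : A ⟶ A') (B : X) :
    (F.T.map f ▷⊠ F.P.obj B) ≫ F.νRP A' B = F.νRP A B ≫ F.P.map (f ▷⊠ B) := by
  simpa only [F.P.map_id, MonoidalCategory.tensorHom_id] using F.νRP_natural f (𝟙 B)

lemma νRP_natural_right (A : X) {B B' : X} (f : B ⟶ B') :
    (F.T.obj A ◁⊠ F.P.map f) ≫ F.νRP A B' = F.νRP A B ≫ F.P.map (A ◁⊠ f) := by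
  simpa only [F.T.map_id, MonoidalCategory.id_tensorHom] using F.νRP_natural (𝟙 A) f

lemma νLP_natural_left {A A' : X} (f : A ⟶ A') (B : X) :
    (F.P.map f ▷⊠ F.T.obj B) ≫ F.νLP A' B = F.νLP A B ≫ F.P.map (f ▷⊠ B) := by
  simpa only [F.T.map_id, MonoidalCategory.tensorHom_id] using F.νLP_natural f (𝟙 B)

lemma νLP_natural_right (A : X) {B B' : X} (f : B ⟶ B') :
    (F.P.obj A ◁⊠ F.T.map f) ≫ F.νLP A B' = F.νLP A B ≫ F.P.map (A ◁⊠ f) := by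
  simpa only [F.P.map_id, MonoidalCategory.id_tensorHom] using F.νLP_natural (𝟙 A) f

end Naturality

/-- The identity linear functor. -/
def id (X : Type u₁) [Category.{v₁} X] [LinDistCategory X] : LinearFunctor X X where
  toLinearFunctorData := LinearFunctorData.id X
  νRT_natural f g := by simp
  νLT_natural f g := by simp
  νRP_natural f g := by simp
  νLP_natural f g := by simp
  νRT_unit A := by simp
  νLT_unit A := by simp
  νRP_unit A := by simp
  νLP_unit A := by simp
  νRT_assoc A B C := by simp
  νLT_assoc A B C := by simp
  νRP_assoc A B C := by simp
  νLP_assoc A B C := by simp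
  mTen_δR_νRT A B C := by simp
  mTen_δL_νLT A B C := by simp
  νRP_δL_nPar A B C := by simp
  νLP_δR_nPar A B C := by simp
  νRT_νLT A B C := by simp
  νLP_νRP A B C := by simp
  mTen_δL_νRT A B C := by simp
  mTen_δR_νLT A B C := by simp
  νRP_δR_nPar A B C := by simp
  νLP_δL_nPar A B C := by simp

variable [LinDistCategory X] [LinDistCategory Y] [LinDistCategory Z]

/-- The composite of linear functors. -/
def comp (F : LinearFunctor X Y) (G : LinearFunctor Y Z) : LinearFunctor X Z where
  toLinearFunctorData := F.toLinearFunctorData.comp G.toLinearFunctorData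
  νRT_natural f g := by
    dsimp
    rw [Category.assoc, ← G.νRT_natural, ← G.T.map_comp_assoc, ← G.T.map_comp_assoc,
      F.νRT_natural]
  νLT_natural f g := by
    dsimp
    rw [Category.assoc, ← G.νLT_natural, ← G.T.map_comp_assoc, ← G.T.map_comp_assoc,
      F.νLT_natural]
  νRP_natural f g := by
    dsimp
    rw [Category.assoc, reassoc_of% G.νRP_natural, ← G.P.map_comp, ← G.P.map_comp,
      F.νRP_natural]
  νLP_natural f g := by
    dsimp
    rw [Category.assoc, reassoc_of% G.νLP_natural, ← G.P.map_comp, ← G.P.map_comp,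
      F.νLP_natural]
  νRT_unit A := by
    dsimp
    simp only [MonoidalCategory.comp_whiskerRight, Category.assoc]
    rw [reassoc_of% G.νRT_natural_left, G.νRT_unit, ← F.νRT_unit]
    simp only [Functor.map_comp]
  νLT_unit A := by
    dsimp
    simp only [MonoidalCategory.whiskerLeft_comp, Category.assoc]
    rw [reassoc_of% G.νLT_natural_right, G.νLT_unit, ← F.νLT_unit]
    simp only [Functor.map_comp]
  νRP_unit A := by
    dsimp
    simp only [MonoidalCategory.comp_whiskerRight, Category.assoc]
    rw [reassoc_of% G.νRP_natural_left, reassoc_of% G.νRP_unit, ← F.νRP_unit]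
    simp only [Functor.map_comp]
  νLP_unit A := by
    dsimp
    simp only [MonoidalCategory.whiskerLeft_comp, Category.assoc]
    rw [reassoc_of% G.νLP_natural_right, reassoc_of% G.νLP_unit, ← F.νLP_unit]
    simp only [Functor.map_comp]
  νRT_assoc A B C := by
    dsimp
    simp only [MonoidalCategory.comp_whiskerRight, MonoidalCategory.whiskerLeft_comp,
      Category.assoc]
    rw [reassoc_of% G.νRT_natural_right, reassoc_of% G.νRT_natural_left, G.νRT_assoc]
    simp only [← Functor.map_comp_assoc]
    rw [F.νRT_assoc]
  νLT_assoc A B C := by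
    dsimp
    simp only [MonoidalCategory.comp_whiskerRight, MonoidalCategory.whiskerLeft_comp,
      Category.assoc]
    rw [reassoc_of% G.νLT_natural_right, reassoc_of% G.νLT_natural_left, G.νLT_assoc]
    simp only [← Functor.map_comp_assoc]
    rw [F.νLT_assoc]
  νRP_assoc A B C := by
    dsimp
    simp only [MonoidalCategory.comp_whiskerRight, MonoidalCategory.whiskerLeft_comp,
      Category.assoc]
    rw [reassoc_of% G.νRP_natural_right, reassoc_of% G.νRP_natural_left, reassoc_of% G.νRP_assoc]
    simp only [← Functor.map_comp]
    rw [F.νRP_assoc]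
  νLP_assoc A B C := by
    dsimp
    simp only [MonoidalCategory.comp_whiskerRight, MonoidalCategory.whiskerLeft_comp,
      Category.assoc]
    rw [reassoc_of% G.νLP_natural_right, reassoc_of% G.νLP_natural_left, reassoc_of% G.νLP_assoc]
    simp only [← Functor.map_comp]
    rw [F.νLP_assoc]
  mTen_δR_νRT A B C := by
    dsimp
    simp only [MonoidalCategory.comp_whiskerRight, MonoidalCategory.whiskerLeft_comp,
      Category.assoc]
    rw [← reassoc_of% G.mTen_δR_νRT, G.νRT_natural_right, reassoc_of% G.mTen_natural_left]
    simp only [← Functor.map_comp_assoc]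
    rw [F.mTen_δR_νRT]
  mTen_δL_νLT A B C := by
    dsimp
    simp only [MonoidalCategory.comp_whiskerRight, MonoidalCategory.whiskerLeft_comp,
      Category.assoc]
    rw [← reassoc_of% G.mTen_δL_νLT, G.νLT_natural_left, reassoc_of% G.mTen_natural_right]
    simp only [← Functor.map_comp_assoc]
    rw [F.mTen_δL_νLT]
  νRP_δL_nPar A B C := by
    dsimp
    simp only [MonoidalCategory.comp_whiskerRight, MonoidalCategory.whiskerLeft_comp,
      Category.assoc]
    rw [← reassoc_of% G.νRP_δL_nPar, G.nPar_natural_left, reassoc_of% G.νRP_natural_right]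
    simp only [← Functor.map_comp_assoc]
    rw [F.νRP_δL_nPar]
  νLP_δR_nPar A B C := by
    dsimp
    simp only [MonoidalCategory.comp_whiskerRight, MonoidalCategory.whiskerLeft_comp,
      Category.assoc]
    rw [← reassoc_of% G.νLP_δR_nPar, G.nPar_natural_right, reassoc_of% G.νLP_natural_left]
    simp only [← Functor.map_comp_assoc]
    rw [F.νLP_δR_nPar]
  νRT_νLT A B C := by
    dsimp
    simp only [MonoidalCategory.comp_whiskerRight, MonoidalCategory.whiskerLeft_comp,
      Category.assoc]
    rw [reassoc_of% G.νRT_natural_right, reassoc_of% G.νLT_natural_left, G.νRT_νLT]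
    simp only [← Functor.map_comp_assoc]
    rw [F.νRT_νLT]
  νLP_νRP A B C := by
    dsimp
    simp only [MonoidalCategory.comp_whiskerRight, MonoidalCategory.whiskerLeft_comp,
      Category.assoc]
    rw [reassoc_of% G.νRP_natural_right, reassoc_of% G.νLP_natural_left, reassoc_of% G.νLP_νRP]
    simp only [← Functor.map_comp]
    rw [F.νLP_νRP]
  mTen_δL_νRT A B C := by
    dsimp
    simp only [MonoidalCategory.comp_whiskerRight, MonoidalCategory.whiskerLeft_comp,
      Category.assoc]
    rw [← reassoc_of% G.mTen_δL_νRT, G.νRT_natural_left, reassoc_of% G.mTen_natural_right]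
    simp only [← Functor.map_comp_assoc]
    rw [F.mTen_δL_νRT]
  mTen_δR_νLT A B C := by
    dsimp
    simp only [MonoidalCategory.comp_whiskerRight, MonoidalCategory.whiskerLeft_comp,
      Category.assoc]
    rw [← reassoc_of% G.mTen_δR_νLT, G.νLT_natural_right, reassoc_of% G.mTen_natural_left]
    simp only [← Functor.map_comp_assoc]
    rw [F.mTen_δR_νLT]
  νRP_δR_nPar A B C := by
    dsimp
    simp only [MonoidalCategory.comp_whiskerRight, MonoidalCategory.whiskerLeft_comp,
      Category.assoc]
    rw [← reassoc_of% G.νRP_δR_nPar, G.nPar_natural_right, reassoc_of% G.νRP_natural_left]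
    simp only [← Functor.map_comp_assoc]
    rw [F.νRP_δR_nPar]
  νLP_δL_nPar A B C := by
    dsimp
    simp only [MonoidalCategory.comp_whiskerRight, MonoidalCategory.whiskerLeft_comp,
      Category.assoc]
    rw [← reassoc_of% G.νLP_δL_nPar, G.nPar_natural_left, reassoc_of% G.νLP_natural_right]
    simp only [← Functor.map_comp_assoc]
    rw [F.νLP_δL_nPar]

end LinearFunctor

end Composition

section StrongComposition

variable {X : Type u₁} [Category.{v₁} X] {Y : Type u₂} [Category.{v₂} Y]
  {Z : Type u₃} [Category.{v₃} Z]
variable [SymmLinDistCategory X] [SymmLinDistCategory Y] [SymmLinDistCategory Z]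

namespace StrongSymmLinearFunctor

/-- The identity strong symmetric linear functor. -/
def id (X : Type u₁) [Category.{v₁} X] [SymmLinDistCategory X] :
    StrongSymmLinearFunctor X X where
  toLinearFunctor := LinearFunctor.id X
  isIso_mTop := inferInstanceAs (IsIso (𝟙 _))
  isIso_mTen A B := inferInstanceAs (IsIso (𝟙 _))
  isIso_nBot := inferInstanceAs (IsIso (𝟙 _))
  isIso_nPar A B := inferInstanceAs (IsIso (𝟙 _))
  mTen_braiding A B := by dsimp [LinearFunctor.id]; simp
  nPar_braiding A B := by dsimp [LinearFunctor.id]; simp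
  νRT_braiding A B := by dsimp [LinearFunctor.id]; simp
  νRP_braiding A B := by dsimp [LinearFunctor.id]; simp

/-- The composite of strong symmetric linear functors. -/
def comp (F : StrongSymmLinearFunctor X Y) (G : StrongSymmLinearFunctor Y Z) :
    StrongSymmLinearFunctor X Z where
  toLinearFunctor := F.toLinearFunctor.comp G.toLinearFunctor
  isIso_mTop := inferInstanceAs (IsIso (G.mTop ≫ G.T.map F.mTop))
  isIso_mTen A B := inferInstanceAs (IsIso (G.mTen _ _ ≫ G.T.map (F.mTen A B)))
  isIso_nBot := inferInstanceAs (IsIso (G.P.map F.nBot ≫ G.nBot))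
  isIso_nPar A B := inferInstanceAs (IsIso (G.P.map (F.nPar A B) ≫ G.nPar _ _))
  mTen_braiding A B := by
    dsimp [LinearFunctor.comp]
    rw [← reassoc_of% G.mTen_braiding, Category.assoc, ← Functor.map_comp, F.mTen_braiding,
      Functor.map_comp]
  nPar_braiding A B := by
    dsimp [LinearFunctor.comp]
    rw [Category.assoc, G.nPar_braiding, ← Functor.map_comp_assoc, F.nPar_braiding,
      Functor.map_comp_assoc]
  νRT_braiding A B := by
    dsimp [LinearFunctor.comp]
    rw [Category.assoc, G.νRT_braiding, ← Functor.map_comp_assoc, F.νRT_braiding,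
      Functor.map_comp_assoc]
  νRP_braiding A B := by
    dsimp [LinearFunctor.comp]
    rw [← reassoc_of% G.νRP_braiding, Category.assoc, ← Functor.map_comp, F.νRP_braiding,
      Functor.map_comp]

@[simp] lemma id_toData :
    (StrongSymmLinearFunctor.id X).toLinearFunctorData = LinearFunctorData.id X := rfl

@[simp] lemma comp_toData (F : StrongSymmLinearFunctor X Y) (G : StrongSymmLinearFunctor Y Z) :
    (F.comp G).toLinearFunctorData = F.toLinearFunctorData.comp G.toLinearFunctorData := rfl

end StrongSymmLinearFunctor

namespace MedialFunctorData

/-- The identity functor with its identity structure. -/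
def id (X : Type u₁) [Category.{v₁} X] [SymmLinDistCategory X] :
    MedialFunctorData (StrongSymmLinearFunctor.id X) where
  parLax := @Functor.LaxMonoidal.id X _ TwoMonoidal.par
  tenOplax := @Functor.OplaxMonoidal.id X _ TwoMonoidal.tensor

/-- The composite structure. -/
def comp {F : StrongSymmLinearFunctor X Y} {G : StrongSymmLinearFunctor Y Z}
    (M : MedialFunctorData F) (N : MedialFunctorData G) : MedialFunctorData (F.comp G) where
  parLax := @Functor.LaxMonoidal.comp X _ TwoMonoidal.par Y _ TwoMonoidal.par
    Z _ TwoMonoidal.par F.T G.T M.parLax N.parLax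
  tenOplax := @Functor.OplaxMonoidal.comp X _ TwoMonoidal.tensor Y _ TwoMonoidal.tensor
    Z _ TwoMonoidal.tensor F.P G.P M.tenOplax N.tenOplax

@[simp] lemma id_mBot : (id X).mBot = 𝟙 _ := rfl
@[simp] lemma id_mPar (A B : X) : (id X).mPar A B = 𝟙 _ := rfl
@[simp] lemma id_nTop : (id X).nTop = 𝟙 _ := rfl
@[simp] lemma id_nTen (A B : X) : (id X).nTen A B = 𝟙 _ := rfl

section

variable {F : StrongSymmLinearFunctor X Y} {G : StrongSymmLinearFunctor Y Z}
  (M : MedialFunctorData F) (N : MedialFunctorData G)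

@[simp] lemma comp_mBot : (M.comp N).mBot = N.mBot ≫ G.T.map M.mBot := rfl
@[simp] lemma comp_mPar (A B : X) :
    (M.comp N).mPar A B = N.mPar _ _ ≫ G.T.map (M.mPar A B) := rfl
@[simp] lemma comp_nTop : (M.comp N).nTop = G.P.map M.nTop ≫ N.nTop := rfl
@[simp] lemma comp_nTen (A B : X) :
    (M.comp N).nTen A B = G.P.map (M.nTen A B) ≫ N.nTen _ _ := rfl

lemma mPar_natural {A A' B B' : X} (f : A ⟶ A') (g : B ⟶ B') :
    (F.T.map f ⊞ₕ F.T.map g) ≫ M.mPar A' B' = M.mPar A B ≫ F.T.map (f ⊞ₕ g) :=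
  @Functor.LaxMonoidal.μ_natural X _ TwoMonoidal.par Y _ TwoMonoidal.par F.T M.parLax
    _ _ _ _ f g

lemma nTen_natural {A A' B B' : X} (f : A ⟶ A') (g : B ⟶ B') :
    M.nTen A B ≫ (F.P.map f ⊠ₕ F.P.map g) = F.P.map (f ⊠ₕ g) ≫ M.nTen A' B' :=
  @Functor.OplaxMonoidal.δ_natural X _ TwoMonoidal.tensor Y _ TwoMonoidal.tensor F.P M.tenOplax
    _ _ _ _ f g

lemma mPar_natural_left {A A' : X} (f : A ⟶ A') (B : X) :
    (F.T.map f ▷⊞ F.T.obj B) ≫ M.mPar A' B = M.mPar A B ≫ F.T.map (f ▷⊞ B) :=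
  @Functor.LaxMonoidal.μ_natural_left X _ TwoMonoidal.par Y _ TwoMonoidal.par F.T M.parLax
    _ _ f B

lemma nTen_natural_left {A A' : X} (f : A ⟶ A') (B : X) :
    M.nTen A B ≫ (F.P.map f ▷⊠ F.P.obj B) = F.P.map (f ▷⊠ B) ≫ M.nTen A' B :=
  @Functor.OplaxMonoidal.δ_natural_left X _ TwoMonoidal.tensor Y _ TwoMonoidal.tensor F.P
    M.tenOplax _ _ f B

end

end MedialFunctorData

namespace MedialFunctorStructure

variable [MedialStructure X] [MedialStructure Y] [MedialStructure Z]

/-- The identity functor is a medial linear functor. -/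
def id (X : Type u₁) [Category.{v₁} X] [SymmLinDistCategory X] [MedialStructure X] :
    MedialFunctorStructure (StrongSymmLinearFunctor.id X) where
  toMedialFunctorData := MedialFunctorData.id X
  mPar_braiding A B := by dsimp; simp
  nTen_braiding A B := by dsimp; simp
  T_Δbot := by dsimp; simp
  T_nablaTop := by dsimp; simp
  T_mix := by dsimp; simp
  T_med A B C D := by dsimp; simp
  P_Δbot := by dsimp; simp
  P_nablaTop := by dsimp; simp
  P_mix := by dsimp; simp
  P_med A B C D := by dsimp; simp
  νRP_Δbot := by dsimp; simp
  νRT_nablaTop := by dsimp; simp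
  νRT_med A B C D := by dsimp; simp
  νRP_med A B C D := by dsimp; simp
  mPar_νRT A B C := by dsimp; simp
  νRP_nTen A B C := by dsimp; simp

/-- The composite of medial linear functors is a medial linear functor. -/
def comp {F : StrongSymmLinearFunctor X Y} {G : StrongSymmLinearFunctor Y Z}
    (M : MedialFunctorStructure F) (N : MedialFunctorStructure G) :
    MedialFunctorStructure (F.comp G) where
  toMedialFunctorData := M.toMedialFunctorData.comp N.toMedialFunctorData
  mPar_braiding A B := by
    dsimp
    rw [← reassoc_of% N.mPar_braiding, Category.assoc, ← Functor.map_comp, M.mPar_braiding,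
      Functor.map_comp]
  nTen_braiding A B := by
    dsimp
    rw [Category.assoc, N.nTen_braiding, ← Functor.map_comp_assoc, M.nTen_braiding,
      Functor.map_comp_assoc]
  T_Δbot := by
    dsimp
    simp only [← MonoidalCategory.tensorHom_comp_tensorHom, Category.assoc]
    rw [reassoc_of% G.mTen_natural, reassoc_of% N.T_Δbot]
    simp only [← Functor.map_comp]
    rw [M.T_Δbot]
  T_nablaTop := by
    dsimp
    simp only [← MonoidalCategory.tensorHom_comp_tensorHom, Category.assoc]
    rw [reassoc_of% N.mPar_natural, ← reassoc_of% N.T_nablaTop]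
    simp only [← Functor.map_comp]
    rw [M.T_nablaTop]
  T_mix := by
    dsimp
    rw [reassoc_of% N.T_mix, ← Functor.map_comp, M.T_mix, Functor.map_comp, Category.assoc]
  T_med A B C D := by
    dsimp
    simp only [← MonoidalCategory.tensorHom_comp_tensorHom, Category.assoc]
    rw [reassoc_of% N.mPar_natural, reassoc_of% G.mTen_natural, ← reassoc_of% N.T_med]
    simp only [← Functor.map_comp]
    rw [M.T_med]
  P_Δbot := by
    dsimp
    simp only [← MonoidalCategory.tensorHom_comp_tensorHom, Category.assoc]
    rw [reassoc_of% N.nTen_natural, ← N.P_Δbot]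
    simp only [← Functor.map_comp_assoc]
    rw [M.P_Δbot]
  P_nablaTop := by
    dsimp
    simp only [← MonoidalCategory.tensorHom_comp_tensorHom, Category.assoc]
    rw [reassoc_of% G.nPar_natural, N.P_nablaTop]
    simp only [← Functor.map_comp_assoc]
    rw [M.P_nablaTop]
  P_mix := by
    dsimp
    rw [Category.assoc, N.P_mix, ← Functor.map_comp_assoc, M.P_mix, Functor.map_comp_assoc]
  P_med A B C D := by
    dsimp
    simp only [← MonoidalCategory.tensorHom_comp_tensorHom, Category.assoc]
    rw [reassoc_of% N.nTen_natural, reassoc_of% G.nPar_natural, ← N.P_med]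
    simp only [← Functor.map_comp_assoc]
    rw [M.P_med]
  νRP_Δbot := by
    dsimp
    simp only [IsIso.inv_comp, ← Functor.map_inv, ← MonoidalCategory.tensorHom_comp_tensorHom,
      Category.assoc]
    rw [reassoc_of% G.νRP_natural, ← reassoc_of% N.νRP_Δbot, M.νRP_Δbot]
    simp only [Functor.map_comp]
  νRT_nablaTop := by
    dsimp
    simp only [IsIso.inv_comp, ← Functor.map_inv, ← MonoidalCategory.tensorHom_comp_tensorHom,
      Category.assoc]
    rw [← reassoc_of% G.νRT_natural, ← reassoc_of% N.νRT_nablaTop, M.νRT_nablaTop]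
    simp only [Functor.map_comp]
  νRT_med A B C D := by
    dsimp
    simp only [IsIso.inv_comp, ← Functor.map_inv, ← MonoidalCategory.tensorHom_comp_tensorHom,
      Category.assoc]
    have h : inv (G.mTen (F.T.obj (A ⊞ C)) (F.T.obj (B ⊞ D))) ≫
        (G.T.map (F.νRT A C) ⊠ₕ G.T.map (F.νRT B D)) =
        G.T.map (F.νRT A C ⊠ₕ F.νRT B D) ≫ inv (G.mTen _ _) := by
      rw [IsIso.inv_comp_eq, ← reassoc_of% G.mTen_natural, IsIso.hom_inv_id, Category.comp_id]
    rw [reassoc_of% h, ← reassoc_of% G.νRT_natural, ← N.νRT_med]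
    simp only [← Functor.map_comp_assoc]
    rw [M.νRT_med]
  νRP_med A B C D := by
    dsimp
    simp only [IsIso.inv_comp, ← Functor.map_inv, ← MonoidalCategory.tensorHom_comp_tensorHom,
      Category.assoc]
    have h : (G.P.map (F.νRP A B) ⊞ₕ G.P.map (F.νRP C D)) ≫
        inv (G.nPar (F.P.obj (A ⊠ B)) (F.P.obj (C ⊠ D))) =
        inv (G.nPar _ _) ≫ G.P.map (F.νRP A B ⊞ₕ F.νRP C D) := by
      rw [IsIso.eq_inv_comp, reassoc_of% G.nPar_natural, IsIso.hom_inv_id, Category.comp_id]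
    rw [reassoc_of% h, reassoc_of% G.νRP_natural, ← reassoc_of% N.νRP_med]
    simp only [← Functor.map_comp]
    rw [M.νRP_med]
  mPar_νRT A B C := by
    dsimp
    simp only [MonoidalCategory.comp_whiskerRight, MonoidalCategory.whiskerLeft_comp,
      Category.assoc]
    rw [← reassoc_of% N.mPar_νRT, G.νRT_natural_right, reassoc_of% N.mPar_natural_left]
    simp only [← Functor.map_comp_assoc]
    rw [M.mPar_νRT]
  νRP_nTen A B C := by
    dsimp
    simp only [MonoidalCategory.comp_whiskerRight, MonoidalCategory.whiskerLeft_comp,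
      Category.assoc]
    rw [← reassoc_of% N.νRP_nTen, N.nTen_natural_left, reassoc_of% G.νRP_natural_right]
    simp only [← Functor.map_comp_assoc]
    rw [M.νRP_nTen]

end MedialFunctorStructure

end StrongComposition

section Transformations

variable {X : Type u₁} [Category.{v₁} X] {Y : Type u₂} [Category.{v₂} Y]
  {Z : Type u₃} [Category.{v₃} Z]

namespace LinearTransformation

variable [LinDistCategory X] [LinDistCategory Y] [LinDistCategory Z]

/-- The identity linear transformation. -/
def id (F : LinearFunctor X Y) : LinearTransformation F F where
  t := 𝟙 _
  p := 𝟙 _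
  t_mTop := by simp
  t_mTen A B := by simp
  p_nBot := by simp
  p_nPar A B := by simp
  νRT_comm A B := by simp
  νLT_comm A B := by simp
  νLP_comm A B := by simp
  νRP_comm A B := by simp

/-- The vertical composite of linear transformations. -/
def vcomp {F G H : LinearFunctor X Y} (α : LinearTransformation F G)
    (β : LinearTransformation G H) : LinearTransformation F H where
  t := α.t ≫ β.t
  p := β.p ≫ α.p
  t_mTop := by rw [NatTrans.comp_app, reassoc_of% α.t_mTop, β.t_mTop]
  t_mTen A B := by
    simp only [NatTrans.comp_app, ← MonoidalCategory.tensorHom_comp_tensorHom, Category.assoc]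
    rw [reassoc_of% α.t_mTen, β.t_mTen]
  p_nBot := by rw [NatTrans.comp_app, Category.assoc, α.p_nBot, β.p_nBot]
  p_nPar A B := by
    simp only [NatTrans.comp_app, ← MonoidalCategory.tensorHom_comp_tensorHom, Category.assoc]
    rw [α.p_nPar, reassoc_of% β.p_nPar]
  νRT_comm A B := by
    simp only [NatTrans.comp_app, MonoidalCategory.comp_whiskerRight,
      MonoidalCategory.whiskerLeft_comp, Category.assoc]
    rw [reassoc_of% β.νRT_comm, ← reassoc_of% α.νRT_comm]
    simp only [MonoidalCategory.whisker_exchange]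
  νLT_comm A B := by
    simp only [NatTrans.comp_app, MonoidalCategory.comp_whiskerRight,
      MonoidalCategory.whiskerLeft_comp, Category.assoc]
    rw [reassoc_of% β.νLT_comm, ← reassoc_of% α.νLT_comm]
    simp only [MonoidalCategory.whisker_exchange]
  νLP_comm A B := by
    simp only [NatTrans.comp_app, MonoidalCategory.comp_whiskerRight,
      MonoidalCategory.whiskerLeft_comp, Category.assoc]
    rw [reassoc_of% β.νLP_comm, ← α.νLP_comm]
    simp only [MonoidalCategory.whisker_exchange_assoc]
  νRP_comm A B := by
    simp only [NatTrans.comp_app, MonoidalCategory.comp_whiskerRight,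
      MonoidalCategory.whiskerLeft_comp, Category.assoc]
    rw [reassoc_of% β.νRP_comm, ← α.νRP_comm]
    simp only [MonoidalCategory.whisker_exchange_assoc]

/-- Precomposition of a linear transformation with a linear functor. -/
def whiskerLeft (F : LinearFunctor X Y) {G H : LinearFunctor Y Z}
    (β : LinearTransformation G H) : LinearTransformation (F.comp G) (F.comp H) where
  t := Functor.whiskerLeft F.T β.t
  p := Functor.whiskerLeft F.P β.p
  t_mTop := by
    dsimp [LinearFunctor.comp]
    rw [Category.assoc, β.t.naturality, reassoc_of% β.t_mTop]
  t_mTen A B := by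
    dsimp [LinearFunctor.comp]
    rw [Category.assoc, β.t.naturality, reassoc_of% β.t_mTen]
  p_nBot := by
    dsimp [LinearFunctor.comp]
    rw [← β.p.naturality_assoc, β.p_nBot]
  p_nPar A B := by
    dsimp [LinearFunctor.comp]
    rw [← β.p.naturality_assoc, β.p_nPar, Category.assoc]
  νRT_comm A B := by
    dsimp [LinearFunctor.comp]
    simp only [Category.assoc]
    rw [← β.t.naturality_assoc, β.νRT_comm]
  νLT_comm A B := by
    dsimp [LinearFunctor.comp]
    simp only [Category.assoc]
    rw [← β.t.naturality_assoc, β.νLT_comm]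
  νLP_comm A B := by
    dsimp [LinearFunctor.comp]
    simp only [Category.assoc]
    rw [β.p.naturality, reassoc_of% β.νLP_comm]
  νRP_comm A B := by
    dsimp [LinearFunctor.comp]
    simp only [Category.assoc]
    rw [β.p.naturality, reassoc_of% β.νRP_comm]

/-- Postcomposition of a linear transformation with a linear functor. -/
def whiskerRight {F G : LinearFunctor X Y} (α : LinearTransformation F G)
    (H : LinearFunctor Y Z) : LinearTransformation (F.comp H) (G.comp H) where
  t := Functor.whiskerRight α.t H.T
  p := Functor.whiskerRight α.p H.P
  t_mTop := by
    dsimp [LinearFunctor.comp]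
    rw [Category.assoc, ← Functor.map_comp, α.t_mTop]
  t_mTen A B := by
    dsimp [LinearFunctor.comp]
    rw [Category.assoc, ← Functor.map_comp, α.t_mTen, Functor.map_comp,
      reassoc_of% H.mTen_natural]
  p_nBot := by
    dsimp [LinearFunctor.comp]
    rw [← Functor.map_comp_assoc, α.p_nBot]
  p_nPar A B := by
    dsimp [LinearFunctor.comp]
    rw [← Functor.map_comp_assoc, α.p_nPar, Functor.map_comp, Category.assoc, Category.assoc,
      H.nPar_natural]
  νRT_comm A B := by
    dsimp [LinearFunctor.comp]
    simp only [Category.assoc]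
    rw [H.νRT_natural_left, H.νRT_natural_right]
    simp only [← Functor.map_comp_assoc]
    rw [α.νRT_comm]
  νLT_comm A B := by
    dsimp [LinearFunctor.comp]
    simp only [Category.assoc]
    rw [H.νLT_natural_left, H.νLT_natural_right]
    simp only [← Functor.map_comp_assoc]
    rw [α.νLT_comm]
  νLP_comm A B := by
    dsimp [LinearFunctor.comp]
    rw [Category.assoc, reassoc_of% H.νLP_natural_left, reassoc_of% H.νLP_natural_right]
    simp only [← Functor.map_comp]
    rw [α.νLP_comm]
  νRP_comm A B := by
    dsimp [LinearFunctor.comp]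
    rw [Category.assoc, reassoc_of% H.νRP_natural_left, reassoc_of% H.νRP_natural_right]
    simp only [← Functor.map_comp]
    rw [α.νRP_comm]

end LinearTransformation

namespace IsMedialTransformation

variable [SymmLinDistCategory X] [SymmLinDistCategory Y] [SymmLinDistCategory Z]

lemma id {F : StrongSymmLinearFunctor X Y} (M : MedialFunctorData F) :
    IsMedialTransformation M M (LinearTransformation.id F.toLinearFunctor) where
  t_mBot := by simp [LinearTransformation.id]
  t_mPar A B := by simp [LinearTransformation.id]
  p_nTop := by simp [LinearTransformation.id]
  p_nTen A B := by simp [LinearTransformation.id]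

lemma vcomp {F G H : StrongSymmLinearFunctor X Y} {M : MedialFunctorData F}
    {N : MedialFunctorData G} {K : MedialFunctorData H}
    {α : LinearTransformation F.toLinearFunctor G.toLinearFunctor}
    {β : LinearTransformation G.toLinearFunctor H.toLinearFunctor}
    (hα : IsMedialTransformation M N α) (hβ : IsMedialTransformation N K β) :
    IsMedialTransformation M K (α.vcomp β) where
  t_mBot := by
    dsimp [LinearTransformation.vcomp]
    rw [reassoc_of% hα.t_mBot, hβ.t_mBot]
  t_mPar A B := by
    dsimp [LinearTransformation.vcomp]
    simp only [← MonoidalCategory.tensorHom_comp_tensorHom, Category.assoc]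
    rw [reassoc_of% hα.t_mPar, hβ.t_mPar]
  p_nTop := by
    dsimp [LinearTransformation.vcomp]
    rw [Category.assoc, hα.p_nTop, hβ.p_nTop]
  p_nTen A B := by
    dsimp [LinearTransformation.vcomp]
    simp only [← MonoidalCategory.tensorHom_comp_tensorHom, Category.assoc]
    rw [hα.p_nTen, reassoc_of% hβ.p_nTen]

lemma whiskerLeft {F : StrongSymmLinearFunctor X Y} (M : MedialFunctorData F)
    {G H : StrongSymmLinearFunctor Y Z} {N : MedialFunctorData G} {K : MedialFunctorData H}
    {β : LinearTransformation G.toLinearFunctor H.toLinearFunctor}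
    (hβ : IsMedialTransformation N K β) :
    IsMedialTransformation (F := F.comp G) (G := F.comp H) (M.comp N) (M.comp K)
      (LinearTransformation.whiskerLeft F.toLinearFunctor β) where
  t_mBot := by
    dsimp [LinearTransformation.whiskerLeft]
    rw [Category.assoc, β.t.naturality, reassoc_of% hβ.t_mBot]
  t_mPar A B := by
    dsimp [LinearTransformation.whiskerLeft]
    rw [Category.assoc, β.t.naturality, reassoc_of% hβ.t_mPar]
  p_nTop := by
    dsimp [LinearTransformation.whiskerLeft]
    rw [← β.p.naturality_assoc, hβ.p_nTop]
  p_nTen A B := by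
    dsimp [LinearTransformation.whiskerLeft]
    rw [← β.p.naturality_assoc, hβ.p_nTen, Category.assoc]

lemma whiskerRight {F G : StrongSymmLinearFunctor X Y} {M : MedialFunctorData F}
    {N : MedialFunctorData G} {α : LinearTransformation F.toLinearFunctor G.toLinearFunctor}
    (hα : IsMedialTransformation M N α)
    {H : StrongSymmLinearFunctor Y Z} (K : MedialFunctorData H) :
    IsMedialTransformation (F := F.comp H) (G := G.comp H) (M.comp K) (N.comp K)
      (LinearTransformation.whiskerRight α H.toLinearFunctor) where
  t_mBot := by
    dsimp [LinearTransformation.whiskerRight]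
    rw [Category.assoc, ← Functor.map_comp, hα.t_mBot]
  t_mPar A B := by
    dsimp [LinearTransformation.whiskerRight]
    rw [Category.assoc, ← Functor.map_comp, hα.t_mPar, Functor.map_comp,
      reassoc_of% K.mPar_natural]
  p_nTop := by
    dsimp [LinearTransformation.whiskerRight]
    rw [← Functor.map_comp_assoc, hα.p_nTop]
  p_nTen A B := by
    dsimp [LinearTransformation.whiskerRight]
    rw [← Functor.map_comp_assoc, hα.p_nTen, Functor.map_comp, Category.assoc, Category.assoc,
      K.nTen_natural]

end IsMedialTransformation

end Transformations

/-! ## Unit and associativity laws of the composition of functors -/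

section StrictLaws

variable {X : Type u₁} [Category.{v₁} X] {Y : Type u₂} [Category.{v₂} Y]

lemma LinearFunctorData.ext_of_heq [TwoMonoidal X] [TwoMonoidal Y] {F G : LinearFunctorData X Y}
    (hT : F.T = G.T) (hP : F.P = G.P) (hmTop : HEq F.mTop G.mTop) (hmTen : HEq F.mTen G.mTen)
    (hnBot : HEq F.nBot G.nBot) (hnPar : HEq F.nPar G.nPar) (hνRT : HEq F.νRT G.νRT)
    (hνLT : HEq F.νLT G.νLT) (hνRP : HEq F.νRP G.νRP) (hνLP : HEq F.νLP G.νLP) : F = G := by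
  obtain ⟨T, P, lax, oplax, _, _, _, _⟩ := F
  obtain ⟨T', P', lax', oplax', _, _, _, _⟩ := G
  dsimp only at hT hP
  subst hT hP
  obtain rfl : lax = lax' := by
    apply Functor.LaxMonoidal.ext
    · exact eq_of_heq hmTop
    · exact eq_of_heq hmTen
  obtain rfl : oplax = oplax' := by
    apply Functor.OplaxMonoidal.ext
    · exact eq_of_heq hnBot
    · exact eq_of_heq hnPar
  cases hνRT
  cases hνLT
  cases hνRP
  cases hνLP
  rfl

lemma StrongSymmLinearFunctor.ext_data [SymmLinDistCategory X] [SymmLinDistCategory Y]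
    {F G : StrongSymmLinearFunctor X Y} (h : F.toLinearFunctorData = G.toLinearFunctorData) :
    F = G := by
  obtain ⟨⟨F⟩⟩ := F
  obtain ⟨⟨G⟩⟩ := G
  dsimp only at h
  subst h
  rfl

lemma MedialLinearFunctor.ext_of_heq [SymmLinDistCategory X] [SymmLinDistCategory Y]
    [MedialStructure X] [MedialStructure Y] {F G : MedialLinearFunctor X Y}
    (h : F.toStrongSymmLinearFunctor = G.toStrongSymmLinearFunctor)
    (hmBot : HEq F.medial.mBot G.medial.mBot) (hmPar : HEq F.medial.mPar G.medial.mPar)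
    (hnTop : HEq F.medial.nTop G.medial.nTop) (hnTen : HEq F.medial.nTen G.medial.nTen) :
    F = G := by
  obtain ⟨F, ⟨⟨lax, oplax⟩⟩⟩ := F
  obtain ⟨G, ⟨⟨lax', oplax'⟩⟩⟩ := G
  dsimp only at h
  subst h
  obtain rfl : lax = lax' := by
    apply Functor.LaxMonoidal.ext
    · exact eq_of_heq hmBot
    · exact eq_of_heq hmPar
  obtain rfl : oplax = oplax' := by
    apply Functor.OplaxMonoidal.ext
    · exact eq_of_heq hnTop
    · exact eq_of_heq hnTen
  rfl

variable {Z : Type u₃} [Category.{v₃} Z] {W : Type u} [Category.{v} W]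

section

variable [SymmLinDistCategory X] [SymmLinDistCategory Y] [SymmLinDistCategory Z]
  [SymmLinDistCategory W]

namespace StrongSymmLinearFunctor

lemma id_comp (F : StrongSymmLinearFunctor X Y) : (StrongSymmLinearFunctor.id X).comp F = F := by
  apply ext_data
  refine LinearFunctorData.ext_of_heq rfl rfl (heq_of_eq ?_) (heq_of_eq ?_) (heq_of_eq ?_)
    (heq_of_eq ?_) (heq_of_eq ?_) (heq_of_eq ?_) (heq_of_eq ?_) (heq_of_eq ?_)
  all_goals first | funext A B; dsimp; simp | dsimp; simp

lemma comp_id (F : StrongSymmLinearFunctor X Y) : F.comp (StrongSymmLinearFunctor.id Y) = F := by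
  apply ext_data
  refine LinearFunctorData.ext_of_heq rfl rfl (heq_of_eq ?_) (heq_of_eq ?_) (heq_of_eq ?_)
    (heq_of_eq ?_) (heq_of_eq ?_) (heq_of_eq ?_) (heq_of_eq ?_) (heq_of_eq ?_)
  all_goals first | funext A B; dsimp; simp | dsimp; simp

lemma comp_assoc (F : StrongSymmLinearFunctor X Y) (G : StrongSymmLinearFunctor Y Z)
    (H : StrongSymmLinearFunctor Z W) : (F.comp G).comp H = F.comp (G.comp H) := by
  apply ext_data
  refine LinearFunctorData.ext_of_heq rfl rfl (heq_of_eq ?_) (heq_of_eq ?_) (heq_of_eq ?_)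
    (heq_of_eq ?_) (heq_of_eq ?_) (heq_of_eq ?_) (heq_of_eq ?_) (heq_of_eq ?_)
  all_goals first | funext A B; dsimp; simp | dsimp; simp

end StrongSymmLinearFunctor

end

namespace MedialLinearFunctor

/-- The identity medial linear functor. -/
def id (X : Type u₁) [Category.{v₁} X] [SymmLinDistCategory X] [MedialStructure X] :
    MedialLinearFunctor X X where
  toStrongSymmLinearFunctor := StrongSymmLinearFunctor.id X
  medial := MedialFunctorStructure.id X

variable [SymmLinDistCategory X] [SymmLinDistCategory Y] [SymmLinDistCategory Z]
  [SymmLinDistCategory W] [MedialStructure X] [MedialStructure Y] [MedialStructure Z]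
  [MedialStructure W]

/-- The composite of medial linear functors. -/
def comp (F : MedialLinearFunctor X Y) (G : MedialLinearFunctor Y Z) :
    MedialLinearFunctor X Z where
  toStrongSymmLinearFunctor := F.toStrongSymmLinearFunctor.comp G.toStrongSymmLinearFunctor
  medial := F.medial.comp G.medial

lemma id_comp (F : MedialLinearFunctor X Y) : (MedialLinearFunctor.id X).comp F = F := by
  refine ext_of_heq (StrongSymmLinearFunctor.id_comp _) (heq_of_eq ?_) (heq_of_eq ?_)
    (heq_of_eq ?_) (heq_of_eq ?_)
  all_goals
    first | funext A B; dsimp [comp, id, MedialFunctorStructure.comp, MedialFunctorStructure.id] | dsimp [comp, id, MedialFunctorStructure.comp, MedialFunctorStructure.id]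
    simp

lemma comp_id (F : MedialLinearFunctor X Y) : F.comp (MedialLinearFunctor.id Y) = F := by
  refine ext_of_heq (StrongSymmLinearFunctor.comp_id _) (heq_of_eq ?_) (heq_of_eq ?_)
    (heq_of_eq ?_) (heq_of_eq ?_)
  all_goals
    first | funext A B; dsimp [comp, id, MedialFunctorStructure.comp, MedialFunctorStructure.id] | dsimp [comp, id, MedialFunctorStructure.comp, MedialFunctorStructure.id]
    simp

lemma comp_assoc (F : MedialLinearFunctor X Y) (G : MedialLinearFunctor Y Z)
    (H : MedialLinearFunctor Z W) : (F.comp G).comp H = F.comp (G.comp H) := by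
  refine ext_of_heq (StrongSymmLinearFunctor.comp_assoc _ _ _) (heq_of_eq ?_) (heq_of_eq ?_)
    (heq_of_eq ?_) (heq_of_eq ?_)
  all_goals
    first | funext A B; dsimp [comp, MedialFunctorStructure.comp] | dsimp [comp, MedialFunctorStructure.comp]
    simp

end MedialLinearFunctor

end StrictLaws

/-! ## The 2-categories of cartesian and of medial linearly distributive categories -/

/-- A cartesian linearly distributive category. -/
structure CLDC where
  carrier : Type u
  [cat : Category.{v} carrier]
  [symm : SymmLinDistCategory carrier]
  [cart : CartesianStructure carrier]

attribute [instance] CLDC.cat CLDC.symm CLDC.cart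

/-- A symmetric medial linearly distributive category. -/
structure SMLDC where
  carrier : Type u
  [cat : Category.{v} carrier]
  [symm : SymmLinDistCategory carrier]
  [medial : MedialStructure carrier]

attribute [instance] SMLDC.cat SMLDC.symm SMLDC.medial

namespace CLDC

/-- 1-cells are cartesian (that is, strong symmetric) linear functors, composed in
diagrammatic order. -/
instance : CategoryStruct CLDC.{v, u} where
  Hom X Y := StrongSymmLinearFunctor X.carrier Y.carrier
  id X := StrongSymmLinearFunctor.id X.carrier
  comp F G := StrongSymmLinearFunctor.comp F G

/-- 2-cells are linear transformations. -/
instance (X Y : CLDC.{v, u}) : Category (X ⟶ Y) where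
  Hom F G := LinearTransformation F.toLinearFunctor G.toLinearFunctor
  id F := LinearTransformation.id F.toLinearFunctor
  comp α β := LinearTransformation.vcomp α β
  id_comp α := LinearTransformation.ext (Category.id_comp α.t) (Category.comp_id α.p)
  comp_id α := LinearTransformation.ext (Category.comp_id α.t) (Category.id_comp α.p)
  assoc α β γ := LinearTransformation.ext (Category.assoc α.t β.t γ.t)
    (Category.assoc γ.p β.p α.p).symm

variable {X Y Z W : CLDC.{v, u}}

lemma hom_id_comp (F : X ⟶ Y) : 𝟙 X ≫ F = F := StrongSymmLinearFunctor.id_comp F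

lemma hom_comp_id (F : X ⟶ Y) : F ≫ 𝟙 Y = F := StrongSymmLinearFunctor.comp_id F

lemma hom_comp_assoc (F : X ⟶ Y) (G : Y ⟶ Z) (H : Z ⟶ W) : (F ≫ G) ≫ H = F ≫ G ≫ H :=
  StrongSymmLinearFunctor.comp_assoc F G H

/-- Left whiskering of 2-cells. -/
def whiskerLeft (F : X ⟶ Y) {G H : Y ⟶ Z} (β : G ⟶ H) : F ≫ G ⟶ F ≫ H :=
  LinearTransformation.whiskerLeft F.toLinearFunctor β

/-- Right whiskering of 2-cells. -/
def whiskerRight {F G : X ⟶ Y} (α : F ⟶ G) (H : Y ⟶ Z) : F ≫ H ⟶ G ≫ H :=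
  LinearTransformation.whiskerRight α H.toLinearFunctor

lemma whiskerLeft_eqToHom (F : X ⟶ Y) {G H : Y ⟶ Z} (h : G = H) :
    whiskerLeft F (eqToHom h) = eqToHom (by rw [h]) := by
  subst h
  exact LinearTransformation.ext rfl rfl

lemma eqToHom_whiskerRight {F G : X ⟶ Y} (h : F = G) (H : Y ⟶ Z) :
    whiskerRight (eqToHom h) H = eqToHom (by rw [h]) := by
  subst h
  exact LinearTransformation.ext (Functor.whiskerRight_id _) (Functor.whiskerRight_id _)

lemma eq_conj {F F' G G' : X ⟶ Y} (hF : F = F') (hG : G' = G) (α : F ⟶ G) (β : F' ⟶ G')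
    (ht : HEq α.t β.t) (hp : HEq α.p β.p) : α = eqToHom hF ≫ β ≫ eqToHom hG := by
  subst hF hG
  rw [eqToHom_refl, eqToHom_refl, Category.id_comp, Category.comp_id]
  exact LinearTransformation.ext (eq_of_heq ht) (eq_of_heq hp)

lemma id_whiskerLeft_eq {F G : X ⟶ Y} (η : F ⟶ G) :
    whiskerLeft (𝟙 X) η = eqToHom (hom_id_comp F) ≫ η ≫ eqToHom (hom_id_comp G).symm :=
  eq_conj _ _ _ _ HEq.rfl HEq.rfl

lemma whiskerRight_id_eq {F G : X ⟶ Y} (η : F ⟶ G) :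
    whiskerRight η (𝟙 Y) = eqToHom (hom_comp_id F) ≫ η ≫ eqToHom (hom_comp_id G).symm :=
  eq_conj _ _ _ _ HEq.rfl HEq.rfl

lemma comp_whiskerLeft_eq (F : X ⟶ Y) (G : Y ⟶ Z) {H H' : Z ⟶ W} (η : H ⟶ H') :
    whiskerLeft (F ≫ G) η = eqToHom (hom_comp_assoc F G H) ≫
      whiskerLeft F (whiskerLeft G η) ≫ eqToHom (hom_comp_assoc F G H').symm :=
  eq_conj _ _ _ _ HEq.rfl HEq.rfl

lemma whiskerRight_comp_eq {F F' : X ⟶ Y} (η : F ⟶ F') (G : Y ⟶ Z) (H : Z ⟶ W) :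
    whiskerRight η (G ≫ H) = eqToHom (hom_comp_assoc F G H).symm ≫
      whiskerRight (whiskerRight η G) H ≫ eqToHom (hom_comp_assoc F' G H) :=
  eq_conj _ _ _ _ HEq.rfl HEq.rfl

lemma whisker_assoc_eq (F : X ⟶ Y) {G G' : Y ⟶ Z} (η : G ⟶ G') (H : Z ⟶ W) :
    whiskerRight (whiskerLeft F η) H = eqToHom (hom_comp_assoc F G H) ≫
      whiskerLeft F (whiskerRight η H) ≫ eqToHom (hom_comp_assoc F G' H).symm :=
  eq_conj _ _ _ _ HEq.rfl HEq.rfl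

lemma whisker_exchange_eq {F G : X ⟶ Y} {H K : Y ⟶ Z} (η : F ⟶ G) (θ : H ⟶ K) :
    whiskerLeft F θ ≫ whiskerRight η K = whiskerRight η H ≫ whiskerLeft G θ :=
  LinearTransformation.ext (NatTrans.ext (funext fun _ => (θ.t.naturality _).symm))
    (NatTrans.ext (funext fun _ => θ.p.naturality _))

/-- The 2-category of cartesian linearly distributive categories. -/
instance : Bicategory CLDC.{v, u} where
  whiskerLeft F _ _ β := whiskerLeft F β
  whiskerRight α H := whiskerRight α H
  associator F G H := eqToIso (hom_comp_assoc F G H)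
  leftUnitor F := eqToIso (hom_id_comp F)
  rightUnitor F := eqToIso (hom_comp_id F)
  whiskerLeft_id F G := LinearTransformation.ext rfl rfl
  whiskerLeft_comp F _ _ _ η θ := LinearTransformation.ext rfl rfl
  id_whiskerRight F G :=
    LinearTransformation.ext (Functor.whiskerRight_id _) (Functor.whiskerRight_id _)
  comp_whiskerRight η θ G :=
    LinearTransformation.ext (Functor.whiskerRight_comp _ _ _)
      (Functor.whiskerRight_comp _ _ _)
  id_whiskerLeft η := id_whiskerLeft_eq η
  comp_whiskerLeft F G _ _ η := comp_whiskerLeft_eq F G η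
  whiskerRight_id η := whiskerRight_id_eq η
  whiskerRight_comp η G H := whiskerRight_comp_eq η G H
  whisker_assoc F _ _ η H := whisker_assoc_eq F η H
  whisker_exchange η θ := whisker_exchange_eq η θ
  pentagon F G H K := by
    simp only [eqToIso.hom, whiskerLeft_eqToHom, eqToHom_whiskerRight, eqToHom_trans]
  triangle F G := by
    simp only [eqToIso.hom, whiskerLeft_eqToHom, eqToHom_whiskerRight, eqToHom_trans]

instance : Bicategory.Strict CLDC.{v, u} where
  id_comp := hom_id_comp
  comp_id := hom_comp_id
  assoc := hom_comp_assoc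
  leftUnitor_eqToIso _ := rfl
  rightUnitor_eqToIso _ := rfl
  associator_eqToIso _ _ _ := rfl

end CLDC

namespace SMLDC

/-- 1-cells are strong symmetric medial linear functors, composed in
diagrammatic order. -/
instance : CategoryStruct SMLDC.{v, u} where
  Hom X Y := MedialLinearFunctor X.carrier Y.carrier
  id X := MedialLinearFunctor.id X.carrier
  comp F G := MedialLinearFunctor.comp F G

/-- 2-cells are medial linear transformations. -/
instance (X Y : SMLDC.{v, u}) : Category (X ⟶ Y) where
  Hom F G := MedialLinearTransformation F G
  id F := ⟨LinearTransformation.id F.toLinearFunctor, IsMedialTransformation.id _⟩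
  comp α β := ⟨LinearTransformation.vcomp α.toLinearTransformation β.toLinearTransformation,
    IsMedialTransformation.vcomp α.isMedial β.isMedial⟩
  id_comp α := MedialLinearTransformation.ext (Category.id_comp α.t) (Category.comp_id α.p)
  comp_id α := MedialLinearTransformation.ext (Category.comp_id α.t) (Category.id_comp α.p)
  assoc α β γ := MedialLinearTransformation.ext (Category.assoc α.t β.t γ.t)
    (Category.assoc γ.p β.p α.p).symm

variable {X Y Z W : SMLDC.{v, u}}

lemma hom_id_comp (F : X ⟶ Y) : 𝟙 X ≫ F = F := MedialLinearFunctor.id_comp F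

lemma hom_comp_id (F : X ⟶ Y) : F ≫ 𝟙 Y = F := MedialLinearFunctor.comp_id F

lemma hom_comp_assoc (F : X ⟶ Y) (G : Y ⟶ Z) (H : Z ⟶ W) : (F ≫ G) ≫ H = F ≫ G ≫ H :=
  MedialLinearFunctor.comp_assoc F G H

/-- Left whiskering of 2-cells. -/
def whiskerLeft (F : X ⟶ Y) {G H : Y ⟶ Z} (β : G ⟶ H) : F ≫ G ⟶ F ≫ H :=
  ⟨LinearTransformation.whiskerLeft F.toLinearFunctor β.toLinearTransformation,
    IsMedialTransformation.whiskerLeft _ β.isMedial⟩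

/-- Right whiskering of 2-cells. -/
def whiskerRight {F G : X ⟶ Y} (α : F ⟶ G) (H : Y ⟶ Z) : F ≫ H ⟶ G ≫ H :=
  ⟨LinearTransformation.whiskerRight α.toLinearTransformation H.toLinearFunctor,
    IsMedialTransformation.whiskerRight α.isMedial _⟩

lemma whiskerLeft_eqToHom (F : X ⟶ Y) {G H : Y ⟶ Z} (h : G = H) :
    whiskerLeft F (eqToHom h) = eqToHom (by rw [h]) := by
  subst h
  exact MedialLinearTransformation.ext rfl rfl

lemma eqToHom_whiskerRight {F G : X ⟶ Y} (h : F = G) (H : Y ⟶ Z) :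
    whiskerRight (eqToHom h) H = eqToHom (by rw [h]) := by
  subst h
  exact MedialLinearTransformation.ext (Functor.whiskerRight_id _) (Functor.whiskerRight_id _)

lemma eq_conj {F F' G G' : X ⟶ Y} (hF : F = F') (hG : G' = G) (α : F ⟶ G) (β : F' ⟶ G')
    (ht : HEq α.t β.t) (hp : HEq α.p β.p) : α = eqToHom hF ≫ β ≫ eqToHom hG := by
  subst hF hG
  rw [eqToHom_refl, eqToHom_refl, Category.id_comp, Category.comp_id]
  exact MedialLinearTransformation.ext (eq_of_heq ht) (eq_of_heq hp)

lemma id_whiskerLeft_eq {F G : X ⟶ Y} (η : F ⟶ G) :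
    whiskerLeft (𝟙 X) η = eqToHom (hom_id_comp F) ≫ η ≫ eqToHom (hom_id_comp G).symm :=
  eq_conj _ _ _ _ HEq.rfl HEq.rfl

lemma whiskerRight_id_eq {F G : X ⟶ Y} (η : F ⟶ G) :
    whiskerRight η (𝟙 Y) = eqToHom (hom_comp_id F) ≫ η ≫ eqToHom (hom_comp_id G).symm :=
  eq_conj _ _ _ _ HEq.rfl HEq.rfl

lemma comp_whiskerLeft_eq (F : X ⟶ Y) (G : Y ⟶ Z) {H H' : Z ⟶ W} (η : H ⟶ H') :
    whiskerLeft (F ≫ G) η = eqToHom (hom_comp_assoc F G H) ≫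
      whiskerLeft F (whiskerLeft G η) ≫ eqToHom (hom_comp_assoc F G H').symm :=
  eq_conj _ _ _ _ HEq.rfl HEq.rfl

lemma whiskerRight_comp_eq {F F' : X ⟶ Y} (η : F ⟶ F') (G : Y ⟶ Z) (H : Z ⟶ W) :
    whiskerRight η (G ≫ H) = eqToHom (hom_comp_assoc F G H).symm ≫
      whiskerRight (whiskerRight η G) H ≫ eqToHom (hom_comp_assoc F' G H) :=
  eq_conj _ _ _ _ HEq.rfl HEq.rfl

lemma whisker_assoc_eq (F : X ⟶ Y) {G G' : Y ⟶ Z} (η : G ⟶ G') (H : Z ⟶ W) :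
    whiskerRight (whiskerLeft F η) H = eqToHom (hom_comp_assoc F G H) ≫
      whiskerLeft F (whiskerRight η H) ≫ eqToHom (hom_comp_assoc F G' H).symm :=
  eq_conj _ _ _ _ HEq.rfl HEq.rfl

lemma whisker_exchange_eq {F G : X ⟶ Y} {H K : Y ⟶ Z} (η : F ⟶ G) (θ : H ⟶ K) :
    whiskerLeft F θ ≫ whiskerRight η K = whiskerRight η H ≫ whiskerLeft G θ :=
  MedialLinearTransformation.ext (NatTrans.ext (funext fun _ => (θ.t.naturality _).symm))
    (NatTrans.ext (funext fun _ => θ.p.naturality _))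

/-- The 2-category of symmetric medial linearly distributive categories. -/
instance : Bicategory SMLDC.{v, u} where
  whiskerLeft F _ _ β := whiskerLeft F β
  whiskerRight α H := whiskerRight α H
  associator F G H := eqToIso (hom_comp_assoc F G H)
  leftUnitor F := eqToIso (hom_id_comp F)
  rightUnitor F := eqToIso (hom_comp_id F)
  whiskerLeft_id F G := MedialLinearTransformation.ext rfl rfl
  whiskerLeft_comp F _ _ _ η θ := MedialLinearTransformation.ext rfl rfl
  id_whiskerRight F G :=
    MedialLinearTransformation.ext (Functor.whiskerRight_id _) (Functor.whiskerRight_id _)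
  comp_whiskerRight η θ G :=
    MedialLinearTransformation.ext (Functor.whiskerRight_comp _ _ _)
      (Functor.whiskerRight_comp _ _ _)
  id_whiskerLeft η := id_whiskerLeft_eq η
  comp_whiskerLeft F G _ _ η := comp_whiskerLeft_eq F G η
  whiskerRight_id η := whiskerRight_id_eq η
  whiskerRight_comp η G H := whiskerRight_comp_eq η G H
  whisker_assoc F _ _ η H := whisker_assoc_eq F η H
  whisker_exchange η θ := whisker_exchange_eq η θ
  pentagon F G H K := by
    simp only [eqToIso.hom, whiskerLeft_eqToHom, eqToHom_whiskerRight, eqToHom_trans]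
  triangle F G := by
    simp only [eqToIso.hom, whiskerLeft_eqToHom, eqToHom_whiskerRight, eqToHom_trans]

instance : Bicategory.Strict SMLDC.{v, u} where
  id_comp := hom_id_comp
  comp_id := hom_comp_id
  assoc := hom_comp_assoc
  leftUnitor_eqToIso _ := rfl
  rightUnitor_eqToIso _ := rfl
  associator_eqToIso _ _ _ := rfl

end SMLDC

/-! ## The inclusion -/

/-- A medial structure on a cartesian linearly distributive category is the canonical one:
`Δ_⊥ = b = ⟨1, 1⟩`, `∇_⊤ = t = [1, 1]`, `m = t_⊥ = b_⊤` and
`μ = ⟨π₀ + π₀, π₁ + π₁⟩ = [ι₀ × ι₀, ι₁ × ι₁]`. -/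
structure IsCanonicalMedialStructure {X : Type u} [Category.{v} X] [SymmLinDistCategory X]
    [CartesianStructure X] (M : MedialStructure X) : Prop where
  Δbot_eq : M.Δbot = fromBot (⊥ₗ ⊠ ⊥ₗ)
  Δbot_fst : M.Δbot ≫ prodFst ⊥ₗ ⊥ₗ = 𝟙 ⊥ₗ
  Δbot_snd : M.Δbot ≫ prodSnd ⊥ₗ ⊥ₗ = 𝟙 ⊥ₗ
  nablaTop_eq : M.nablaTop = toTop ((⊤ₗ : X) ⊞ ⊤ₗ)
  inl_nablaTop : coprodInl ⊤ₗ ⊤ₗ ≫ M.nablaTop = 𝟙 ⊤ₗ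
  inr_nablaTop : coprodInr ⊤ₗ ⊤ₗ ≫ M.nablaTop = 𝟙 ⊤ₗ
  mix_eq_toTop : M.mix = toTop ⊥ₗ
  mix_eq_fromBot : M.mix = fromBot ⊤ₗ
  med_fst (A B C D : X) : M.med A B C D ≫ prodFst (A ⊞ C) (B ⊞ D) = prodFst A B ⊞ₕ prodFst C D
  med_snd (A B C D : X) : M.med A B C D ≫ prodSnd (A ⊞ C) (B ⊞ D) = prodSnd A B ⊞ₕ prodSnd C D
  inl_med (A B C D : X) :
    coprodInl (A ⊠ B) (C ⊠ D) ≫ M.med A B C D = coprodInl A C ⊠ₕ coprodInl B D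
  inr_med (A B C D : X) :
    coprodInr (A ⊠ B) (C ⊠ D) ≫ M.med A B C D = coprodInr A C ⊠ₕ coprodInr B D

/-- A medial structure on a cartesian linear functor `F` is the canonical one: `m_⊥ = b` and
`m_⊕ = [F_⊗ ι₀, F_⊗ ι₁]` on `F_⊗`, and `n_⊤ = t` and `n_⊗ = ⟨F_⊕ π₀, F_⊕ π₁⟩` on `F_⊕`. -/
structure IsCanonicalMedialFunctor {X : Type u₁} [Category.{v₁} X] {Y : Type u₂}
    [Category.{v₂} Y] [SymmLinDistCategory X] [SymmLinDistCategory Y] [CartesianStructure X]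
    [CartesianStructure Y] {F : StrongSymmLinearFunctor X Y} (M : MedialFunctorData F) : Prop where
  mBot_eq : M.mBot = fromBot (F.T.obj ⊥ₗ)
  inl_mPar (A B : X) :
    coprodInl (F.T.obj A) (F.T.obj B) ≫ M.mPar A B = F.T.map (coprodInl A B)
  inr_mPar (A B : X) :
    coprodInr (F.T.obj A) (F.T.obj B) ≫ M.mPar A B = F.T.map (coprodInr A B)
  nTop_eq : M.nTop = toTop (F.P.obj ⊤ₗ)
  nTen_fst (A B : X) :
    M.nTen A B ≫ prodFst (F.P.obj A) (F.P.obj B) = F.P.map (prodFst A B)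
  nTen_snd (A B : X) :
    M.nTen A B ≫ prodSnd (F.P.obj A) (F.P.obj B) = F.P.map (prodSnd A B)

/-- The assignment on 0-cells, 1-cells and 2-cells which leaves all the data of cartesian linearly
distributive categories, cartesian linear functors and linear transformations unchanged and equips
them with the given medial structures. -/
def inclusionStruct (med : ∀ X : CLDC.{v, u}, MedialStructure X.carrier)
    (medF : ∀ {X Y : CLDC.{v, u}} (F : X ⟶ Y),
      @MedialFunctorStructure X.carrier _ Y.carrier _ _ _ (med X) (med Y) F)
    (medT : ∀ {X Y : CLDC.{v, u}} {F G : X ⟶ Y} (α : F ⟶ G),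
      IsMedialTransformation (medF F).toMedialFunctorData (medF G).toMedialFunctorData α) :
    PrelaxFunctorStruct CLDC.{v, u} SMLDC.{v, u} where
  obj X := @SMLDC.mk X.carrier _ _ (med X)
  map {X Y} F :=
    @MedialLinearFunctor.mk X.carrier _ Y.carrier _ _ _ (med X) (med Y) F (medF F)
  map₂ {X Y F G} α :=
    @MedialLinearTransformation.mk X.carrier _ Y.carrier _ _ _ (med X) (med Y)
      (@MedialLinearFunctor.mk X.carrier _ Y.carrier _ _ _ (med X) (med Y) F (medF F))
      (@MedialLinearFunctor.mk X.carrier _ Y.carrier _ _ _ (med X) (med Y) G (medF G))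
      α (medT α)

end LinDist

namespace LinDist

open LinDistCategory

section Cartesian

variable {X : Type u} [Category.{v} X] [SymmLinDistCategory X] [CartesianStructure X]

/-! ## Products and coproducts in a cartesian linearly distributive category -/

/-! All the medial data of a cartesian linearly distributive category are forced by universal
properties. The maps Δ, ∇ and m start at the initial object or end at the terminal one, and μ goes
from a coproduct to a product, so it is a matrix of components. Most laws are therefore checked with
`toTop_ext`, `fromBot_ext`, `prod_ext` and `coprod_ext`, once the structure isomorphisms are known
on projections and injections. The laws that involve the linear distributivities need more, because
no explicit formula for δ is available.

The mix law is the only law that universal properties do not yield. It rests on `toBot_ext`: any two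
maps into ⊥ agree, because one coherence law relating δL and δR can be evaluated to give either of
them. In particular π₀ = π₁ on ⊥ ⊗ ⊥. Then `toTop_mix_law` takes the other coherence law between δL
and δR at A, ⊥, ⊥, B and reads one side with π₀ and the other with π₁.

For the laws between μ and δ, the four unit laws say what δL and δR do against one projection and
one injection each (`δL_snd`, `δR_fst`, `inl_δL`, `inr_δR`). Of the two components of each law, one
follows from these formulas and the other from naturality of δ.

For a cartesian linear functor, strength means that F_⊗ preserves products and F_⊕ preserves
coproducts (`mTen_fst`, `inl_nPar` and their companions), and the unit laws of the strengths give
`inr_νRT` and `νRP_snd`. On components, the medial laws then become naturality of the structure maps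
and of the right strengths. A linear transformation is medial by naturality alone.

The inclusion is strict because canonical structures are unique
(`MedialLinearFunctor.ext_of_isCanonical`) and are closed under identities and composition. -/

lemma toTop_ext {A : X} (f g : A ⟶ ⊤ₗ) : f = g := CartesianStructure.topTerminal.hom_ext f g

lemma fromBot_ext {A : X} (f g : ⊥ₗ ⟶ A) : f = g := CartesianStructure.botInitial.hom_ext f g

/-- The pairing of two maps into a product. -/
def prodLift {Z A B : X} (f : Z ⟶ A) (g : Z ⟶ B) : Z ⟶ A ⊠ B :=
  (CartesianStructure.isProduct A B).lift (BinaryFan.mk f g)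

@[simp]
lemma prodLift_fst {Z A B : X} (f : Z ⟶ A) (g : Z ⟶ B) :
    prodLift f g ≫ prodFst A B = f :=
  (CartesianStructure.isProduct A B).fac (BinaryFan.mk f g) ⟨WalkingPair.left⟩

@[simp]
lemma prodLift_fst_assoc {Z A B : X} (f : Z ⟶ A) (g : Z ⟶ B) {W : X} (h : _ ⟶ W) :
    prodLift f g ≫ prodFst A B ≫ h = f ≫ h := by
  rw [reassoc_of% prodLift_fst]

@[simp]
lemma prodLift_snd {Z A B : X} (f : Z ⟶ A) (g : Z ⟶ B) :
    prodLift f g ≫ prodSnd A B = g :=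
  (CartesianStructure.isProduct A B).fac (BinaryFan.mk f g) ⟨WalkingPair.right⟩

@[simp]
lemma prodLift_snd_assoc {Z A B : X} (f : Z ⟶ A) (g : Z ⟶ B) {W : X} (h : _ ⟶ W) :
    prodLift f g ≫ prodSnd A B ≫ h = g ≫ h := by
  rw [reassoc_of% prodLift_snd]

lemma prod_ext {Z A B : X} {f g : Z ⟶ A ⊠ B} (h₀ : f ≫ prodFst A B = g ≫ prodFst A B)
    (h₁ : f ≫ prodSnd A B = g ≫ prodSnd A B) : f = g :=
  BinaryFan.IsLimit.hom_ext (CartesianStructure.isProduct A B) h₀ h₁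

/-- The copairing of two maps out of a coproduct. -/
def coprodDesc {Z A B : X} (f : A ⟶ Z) (g : B ⟶ Z) : A ⊞ B ⟶ Z :=
  (CartesianStructure.isCoproduct A B).desc (BinaryCofan.mk f g)

@[simp]
lemma inl_coprodDesc {Z A B : X} (f : A ⟶ Z) (g : B ⟶ Z) :
    coprodInl A B ≫ coprodDesc f g = f :=
  (CartesianStructure.isCoproduct A B).fac (BinaryCofan.mk f g) ⟨WalkingPair.left⟩

@[simp]
lemma inl_coprodDesc_assoc {Z A B : X} (f : A ⟶ Z) (g : B ⟶ Z) {W : X} (h : _ ⟶ W) :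
    coprodInl A B ≫ coprodDesc f g ≫ h = f ≫ h := by
  rw [reassoc_of% inl_coprodDesc]

@[simp]
lemma inr_coprodDesc {Z A B : X} (f : A ⟶ Z) (g : B ⟶ Z) :
    coprodInr A B ≫ coprodDesc f g = g :=
  (CartesianStructure.isCoproduct A B).fac (BinaryCofan.mk f g) ⟨WalkingPair.right⟩

@[simp]
lemma inr_coprodDesc_assoc {Z A B : X} (f : A ⟶ Z) (g : B ⟶ Z) {W : X} (h : _ ⟶ W) :
    coprodInr A B ≫ coprodDesc f g ≫ h = g ≫ h := by
  rw [reassoc_of% inr_coprodDesc]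

lemma coprod_ext {Z A B : X} {f g : A ⊞ B ⟶ Z} (h₀ : coprodInl A B ≫ f = coprodInl A B ≫ g)
    (h₁ : coprodInr A B ≫ f = coprodInr A B ≫ g) : f = g :=
  BinaryCofan.IsColimit.hom_ext (CartesianStructure.isCoproduct A B) h₀ h₁

/-! ### Projections against the structure maps of the tensor. -/

section Tensor

-- Only one of the two monoidal structures is made an instance in a section: both live on `X`, and
-- instance search and `monoidal` would otherwise be ambiguous.
attribute [local instance] TwoMonoidal.tensor

-- Terminality absorbs `g` into `toTop B`; what remains is naturality of the right unitor.
@[simp]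
lemma tensorHom_fst {A A' B B' : X} (f : A ⟶ A') (g : B ⟶ B') :
    (f ⊠ₕ g) ≫ prodFst A' B' = prodFst A B ≫ f := by
  simp only [prodFst, MonoidalCategory.tensorHom_def, Category.assoc]
  rw [← MonoidalCategory.whiskerLeft_comp_assoc, toTop_ext (g ≫ toTop B') (toTop B),
    ← MonoidalCategory.whisker_exchange_assoc, MonoidalCategory.rightUnitor_naturality]

@[simp]
lemma tensorHom_fst_assoc {A A' B B' : X} (f : A ⟶ A') (g : B ⟶ B') {W : X} (h : _ ⟶ W) :
    (f ⊠ₕ g) ≫ prodFst A' B' ≫ h = prodFst A B ≫ f ≫ h := by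
  rw [reassoc_of% tensorHom_fst]

@[simp]
lemma tensorHom_snd {A A' B B' : X} (f : A ⟶ A') (g : B ⟶ B') :
    (f ⊠ₕ g) ≫ prodSnd A' B' = prodSnd A B ≫ g := by
  simp only [prodSnd, MonoidalCategory.tensorHom_def', Category.assoc]
  rw [← MonoidalCategory.comp_whiskerRight_assoc, toTop_ext (f ≫ toTop A') (toTop A),
    MonoidalCategory.whisker_exchange_assoc, MonoidalCategory.leftUnitor_naturality]

@[simp]
lemma tensorHom_snd_assoc {A A' B B' : X} (f : A ⟶ A') (g : B ⟶ B') {W : X} (h : _ ⟶ W) :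
    (f ⊠ₕ g) ≫ prodSnd A' B' ≫ h = prodSnd A B ≫ g ≫ h := by
  rw [reassoc_of% tensorHom_snd]

@[simp]
lemma tensorLeft_fst (A : X) {B B' : X} (g : B ⟶ B') :
    (A ◁⊠ g) ≫ prodFst A B' = prodFst A B := by
  rw [← MonoidalCategory.id_tensorHom, tensorHom_fst, Category.comp_id]

@[simp]
lemma tensorLeft_snd (A : X) {B B' : X} (g : B ⟶ B') :
    (A ◁⊠ g) ≫ prodSnd A B' = prodSnd A B ≫ g := by
  rw [← MonoidalCategory.id_tensorHom, tensorHom_snd]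

@[simp]
lemma tensorLeft_snd_assoc (A : X) {B B' : X} (g : B ⟶ B') {W : X} (h : _ ⟶ W) :
    (A ◁⊠ g) ≫ prodSnd A B' ≫ h = prodSnd A B ≫ g ≫ h := by
  rw [reassoc_of% tensorLeft_snd]

@[simp]
lemma tensorRight_fst {A A' : X} (f : A ⟶ A') (B : X) :
    (f ▷⊠ B) ≫ prodFst A' B = prodFst A B ≫ f := by
  rw [← MonoidalCategory.tensorHom_id, tensorHom_fst]

@[simp]
lemma tensorRight_fst_assoc {A A' : X} (f : A ⟶ A') (B : X) {W : X} (h : _ ⟶ W) :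
    (f ▷⊠ B) ≫ prodFst A' B ≫ h = prodFst A B ≫ f ≫ h := by
  rw [reassoc_of% tensorRight_fst]

@[simp]
lemma tensorRight_snd {A A' : X} (f : A ⟶ A') (B : X) :
    (f ▷⊠ B) ≫ prodSnd A' B = prodSnd A B := by
  rw [← MonoidalCategory.tensorHom_id, tensorHom_snd, Category.comp_id]

-- As `simp` rules, this lemma and the next remove the tensor unitors in favour of projections,
-- using that the endomorphism `toTop ⊤ₗ` is the identity.
@[simp]
lemma tensorRightUnitor_hom (A : X) : (ρ⊠ A).hom = prodFst A ⊤ₗ := by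
  rw [prodFst, toTop_ext (toTop ⊤ₗ) (𝟙 (⊤ₗ : X)), MonoidalCategory.whiskerLeft_id,
    Category.id_comp]

@[simp]
lemma tensorLeftUnitor_hom (A : X) : (λ⊠ A).hom = prodSnd ⊤ₗ A := by
  rw [prodSnd, toTop_ext (toTop ⊤ₗ) (𝟙 (⊤ₗ : X)), MonoidalCategory.id_whiskerRight,
    Category.id_comp]

@[simp]
lemma tensorRightUnitor_inv_fst (A : X) :
    (ρ⊠ A).inv ≫ prodFst A ⊤ₗ = 𝟙 A := by
  rw [← tensorRightUnitor_hom, Iso.inv_hom_id]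

@[simp]
lemma tensorLeftUnitor_inv_snd (A : X) :
    (λ⊠ A).inv ≫ prodSnd ⊤ₗ A = 𝟙 A := by
  rw [← tensorLeftUnitor_hom, Iso.inv_hom_id]

@[simp]
lemma tensorAssociator_hom_fst (A B C : X) :
    (α⊠ A B C).hom ≫ prodFst A (B ⊠ C) = prodFst (A ⊠ B) C ≫ prodFst A B := by
  -- Discarding `B ⊠ C` in two stages, `C` and then `B`, makes both sides composites of the same two
  -- discarding maps, so that only monoidal coherence is left.
  have h : toTop (B ⊠ C) = prodFst B C ≫ toTop B := toTop_ext _ _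
  rw [prodFst, h, prodFst, prodFst, prodFst]
  monoidal

@[simp]
lemma tensorAssociator_hom_fst_assoc (A B C : X) {W : X} (h : _ ⟶ W) :
    (α⊠ A B C).hom ≫ prodFst A (B ⊠ C) ≫ h = prodFst (A ⊠ B) C ≫ prodFst A B ≫ h := by
  rw [reassoc_of% tensorAssociator_hom_fst]

@[simp]
lemma tensorAssociator_hom_snd_fst (A B C : X) :
    (α⊠ A B C).hom ≫ prodSnd A (B ⊠ C) ≫ prodFst B C = prodFst (A ⊠ B) C ≫ prodSnd A B := by
  -- Taking the first projection of `B ⊠ C` before discarding `A` lets `prodSnd A B` cancel; the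
  -- rest is coherence between the associator and the right unitors.
  rw [← tensorLeft_snd, ← Category.assoc]
  congr 1
  simp only [prodFst]
  monoidal

@[simp]
lemma tensorAssociator_hom_snd_fst_assoc (A B C : X) {W : X} (h : _ ⟶ W) :
    (α⊠ A B C).hom ≫ prodSnd A (B ⊠ C) ≫ prodFst B C ≫ h = prodFst (A ⊠ B) C ≫ prodSnd A B ≫ h := by
  rw [reassoc_of% tensorAssociator_hom_snd_fst]

@[simp]
lemma tensorAssociator_hom_snd_snd (A B C : X) :
    (α⊠ A B C).hom ≫ prodSnd A (B ⊠ C) ≫ prodSnd B C = prodSnd (A ⊠ B) C := by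
  have h : toTop (A ⊠ B) = prodSnd A B ≫ toTop B := toTop_ext _ _
  rw [prodSnd, prodSnd, prodSnd, h, prodSnd]
  monoidal

@[simp]
lemma tensorAssociator_hom_snd_snd_assoc (A B C : X) {W : X} (h : _ ⟶ W) :
    (α⊠ A B C).hom ≫ prodSnd A (B ⊠ C) ≫ prodSnd B C ≫ h = prodSnd (A ⊠ B) C ≫ h := by
  rw [reassoc_of% tensorAssociator_hom_snd_snd]

@[simp]
lemma tensorAssociator_inv_fst_fst (A B C : X) :
    (α⊠ A B C).inv ≫ prodFst (A ⊠ B) C ≫ prodFst A B = prodFst A (B ⊠ C) := by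
  rw [← tensorAssociator_hom_fst, Iso.inv_hom_id_assoc]

@[simp]
lemma tensorAssociator_inv_fst_snd (A B C : X) :
    (α⊠ A B C).inv ≫ prodFst (A ⊠ B) C ≫ prodSnd A B = prodSnd A (B ⊠ C) ≫ prodFst B C := by
  rw [← tensorAssociator_hom_snd_fst, Iso.inv_hom_id_assoc]

@[simp]
lemma tensorAssociator_inv_snd (A B C : X) :
    (α⊠ A B C).inv ≫ prodSnd (A ⊠ B) C = prodSnd A (B ⊠ C) ≫ prodSnd B C := by
  rw [← tensorAssociator_hom_snd_snd, Iso.inv_hom_id_assoc]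

@[simp]
lemma tensorAssociator_inv_snd_assoc (A B C : X) {W : X} (h : _ ⟶ W) :
    (α⊠ A B C).inv ≫ prodSnd (A ⊠ B) C ≫ h = prodSnd A (B ⊠ C) ≫ prodSnd B C ≫ h := by
  rw [reassoc_of% tensorAssociator_inv_snd]

attribute [local instance] SymmLinDistCategory.tensorSymm

-- The braiding is natural in the discarded variable, and with a unit it exchanges the two unitors.
@[simp]
lemma tensorBraiding_hom_fst (A B : X) :
    (β⊠ A B).hom ≫ prodFst B A = prodSnd A B := by
  rw [prodFst, ← BraidedCategory.braiding_naturality_left_assoc, braiding_rightUnitor, prodSnd]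

@[simp]
lemma tensorBraiding_hom_fst_assoc (A B : X) {W : X} (h : _ ⟶ W) :
    (β⊠ A B).hom ≫ prodFst B A ≫ h = prodSnd A B ≫ h := by
  rw [reassoc_of% tensorBraiding_hom_fst]

@[simp]
lemma tensorBraiding_hom_snd (A B : X) :
    (β⊠ A B).hom ≫ prodSnd B A = prodFst A B := by
  rw [prodSnd, ← BraidedCategory.braiding_naturality_right_assoc, braiding_leftUnitor, prodFst]

@[simp]
lemma tensorBraiding_hom_snd_assoc (A B : X) {W : X} (h : _ ⟶ W) :
    (β⊠ A B).hom ≫ prodSnd B A ≫ h = prodFst A B ≫ h := by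
  rw [reassoc_of% tensorBraiding_hom_snd]

end Tensor

/-! ### Injections against the structure maps of the par, dual to the previous part. -/

section Par

attribute [local instance] TwoMonoidal.par

-- Dual to `tensorHom_fst`: initiality absorbs `g`, leaving naturality of the inverse right unitor.
@[simp]
lemma inl_parHom {A A' B B' : X} (f : A ⟶ A') (g : B ⟶ B') :
    coprodInl A B ≫ (f ⊞ₕ g) = f ≫ coprodInl A' B' := by
  simp only [coprodInl, MonoidalCategory.tensorHom_def', Category.assoc]
  rw [← MonoidalCategory.whiskerLeft_comp_assoc, fromBot_ext (fromBot B ≫ g) (fromBot B'),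
    MonoidalCategory.whisker_exchange, MonoidalCategory.rightUnitor_inv_naturality_assoc]

@[simp]
lemma inl_parHom_assoc {A A' B B' : X} (f : A ⟶ A') (g : B ⟶ B') {W : X} (h : _ ⟶ W) :
    coprodInl A B ≫ (f ⊞ₕ g) ≫ h = f ≫ coprodInl A' B' ≫ h := by
  rw [reassoc_of% inl_parHom]

@[simp]
lemma inr_parHom {A A' B B' : X} (f : A ⟶ A') (g : B ⟶ B') :
    coprodInr A B ≫ (f ⊞ₕ g) = g ≫ coprodInr A' B' := by
  simp only [coprodInr, MonoidalCategory.tensorHom_def, Category.assoc]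
  rw [← MonoidalCategory.comp_whiskerRight_assoc, fromBot_ext (fromBot A ≫ f) (fromBot A'),
    ← MonoidalCategory.whisker_exchange, MonoidalCategory.leftUnitor_inv_naturality_assoc]

@[simp]
lemma inr_parHom_assoc {A A' B B' : X} (f : A ⟶ A') (g : B ⟶ B') {W : X} (h : _ ⟶ W) :
    coprodInr A B ≫ (f ⊞ₕ g) ≫ h = g ≫ coprodInr A' B' ≫ h := by
  rw [reassoc_of% inr_parHom]

@[simp]
lemma inl_parLeft (A : X) {B B' : X} (g : B ⟶ B') :
    coprodInl A B ≫ (A ◁⊞ g) = coprodInl A B' := by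
  rw [← MonoidalCategory.id_tensorHom, inl_parHom, Category.id_comp]

@[simp]
lemma inl_parLeft_assoc (A : X) {B B' : X} (g : B ⟶ B') {W : X} (h : _ ⟶ W) :
    coprodInl A B ≫ (A ◁⊞ g) ≫ h = coprodInl A B' ≫ h := by
  rw [reassoc_of% inl_parLeft]

@[simp]
lemma inr_parLeft (A : X) {B B' : X} (g : B ⟶ B') :
    coprodInr A B ≫ (A ◁⊞ g) = g ≫ coprodInr A B' := by
  rw [← MonoidalCategory.id_tensorHom, inr_parHom]

@[simp]
lemma inr_parLeft_assoc (A : X) {B B' : X} (g : B ⟶ B') {W : X} (h : _ ⟶ W) :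
    coprodInr A B ≫ (A ◁⊞ g) ≫ h = g ≫ coprodInr A B' ≫ h := by
  rw [reassoc_of% inr_parLeft]

@[simp]
lemma inl_parRight {A A' : X} (f : A ⟶ A') (B : X) :
    coprodInl A B ≫ (f ▷⊞ B) = f ≫ coprodInl A' B := by
  rw [← MonoidalCategory.tensorHom_id, inl_parHom]

@[simp]
lemma inl_parRight_assoc {A A' : X} (f : A ⟶ A') (B : X) {W : X} (h : _ ⟶ W) :
    coprodInl A B ≫ (f ▷⊞ B) ≫ h = f ≫ coprodInl A' B ≫ h := by
  rw [reassoc_of% inl_parRight]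

@[simp]
lemma inr_parRight {A A' : X} (f : A ⟶ A') (B : X) :
    coprodInr A B ≫ (f ▷⊞ B) = coprodInr A' B := by
  rw [← MonoidalCategory.tensorHom_id, inr_parHom, Category.id_comp]

@[simp]
lemma inr_parRight_assoc {A A' : X} (f : A ⟶ A') (B : X) {W : X} (h : _ ⟶ W) :
    coprodInr A B ≫ (f ▷⊞ B) ≫ h = coprodInr A' B ≫ h := by
  rw [reassoc_of% inr_parRight]

@[simp]
lemma parRightUnitor_inv (A : X) : (ρ⊞ A).inv = coprodInl A ⊥ₗ := by
  rw [coprodInl, fromBot_ext (fromBot ⊥ₗ) (𝟙 (⊥ₗ : X)), MonoidalCategory.whiskerLeft_id,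
    Category.comp_id]

@[simp]
lemma parLeftUnitor_inv (A : X) : (λ⊞ A).inv = coprodInr ⊥ₗ A := by
  rw [coprodInr, fromBot_ext (fromBot ⊥ₗ) (𝟙 (⊥ₗ : X)), MonoidalCategory.id_whiskerRight,
    Category.comp_id]

@[simp]
lemma inl_parRightUnitor_hom (A : X) :
    coprodInl A ⊥ₗ ≫ (ρ⊞ A).hom = 𝟙 A := by
  rw [← parRightUnitor_inv, Iso.inv_hom_id]

@[simp]
lemma inl_parRightUnitor_hom_assoc (A : X) {W : X} (h : _ ⟶ W) :
    coprodInl A ⊥ₗ ≫ (ρ⊞ A).hom ≫ h = h := by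
  rw [reassoc_of% inl_parRightUnitor_hom]

@[simp]
lemma inr_parLeftUnitor_hom (A : X) :
    coprodInr ⊥ₗ A ≫ (λ⊞ A).hom = 𝟙 A := by
  rw [← parLeftUnitor_inv, Iso.inv_hom_id]

@[simp]
lemma inr_parLeftUnitor_hom_assoc (A : X) {W : X} (h : _ ⟶ W) :
    coprodInr ⊥ₗ A ≫ (λ⊞ A).hom ≫ h = h := by
  rw [reassoc_of% inr_parLeftUnitor_hom]

@[simp]
lemma inl_parAssociator_inv (A B C : X) :
    coprodInl A (B ⊞ C) ≫ (α⊞ A B C).inv = coprodInl A B ≫ coprodInl (A ⊞ B) C := by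
  -- The summands `B` and `C` are inserted one after the other, so that both sides differ only by
  -- coherence isomorphisms.
  have h : fromBot (B ⊞ C) = fromBot B ≫ coprodInl B C := fromBot_ext _ _
  rw [coprodInl, h, coprodInl, coprodInl, coprodInl]
  monoidal

@[simp]
lemma inl_parAssociator_inv_assoc (A B C : X) {W : X} (h : _ ⟶ W) :
    coprodInl A (B ⊞ C) ≫ (α⊞ A B C).inv ≫ h = coprodInl A B ≫ coprodInl (A ⊞ B) C ≫ h := by
  rw [reassoc_of% inl_parAssociator_inv]

@[simp]
lemma inl_inr_parAssociator_inv (A B C : X) :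
    coprodInl B C ≫ coprodInr A (B ⊞ C) ≫ (α⊞ A B C).inv = coprodInr A B ≫ coprodInl (A ⊞ B) C := by
  rw [← inr_parLeft_assoc]
  congr 1
  simp only [coprodInl]
  monoidal

@[simp]
lemma inl_inr_parAssociator_inv_assoc (A B C : X) {W : X} (h : _ ⟶ W) :
    coprodInl B C ≫ coprodInr A (B ⊞ C) ≫ (α⊞ A B C).inv ≫ h =
      coprodInr A B ≫ coprodInl (A ⊞ B) C ≫ h := by
  rw [reassoc_of% inl_inr_parAssociator_inv]

@[simp]
lemma inr_inr_parAssociator_inv (A B C : X) :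
    coprodInr B C ≫ coprodInr A (B ⊞ C) ≫ (α⊞ A B C).inv = coprodInr (A ⊞ B) C := by
  have h : fromBot (A ⊞ B) = fromBot B ≫ coprodInr A B := fromBot_ext _ _
  rw [coprodInr, coprodInr, coprodInr, h, coprodInr]
  monoidal

@[simp]
lemma inr_inr_parAssociator_inv_assoc (A B C : X) {W : X} (h : _ ⟶ W) :
    coprodInr B C ≫ coprodInr A (B ⊞ C) ≫ (α⊞ A B C).inv ≫ h = coprodInr (A ⊞ B) C ≫ h := by
  rw [reassoc_of% inr_inr_parAssociator_inv]

@[simp]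
lemma inl_inl_parAssociator_hom (A B C : X) :
    coprodInl A B ≫ coprodInl (A ⊞ B) C ≫ (α⊞ A B C).hom = coprodInl A (B ⊞ C) := by
  rw [← inl_parAssociator_inv_assoc, Iso.inv_hom_id, Category.comp_id]

@[simp]
lemma inl_inl_parAssociator_hom_assoc (A B C : X) {W : X} (h : _ ⟶ W) :
    coprodInl A B ≫ coprodInl (A ⊞ B) C ≫ (α⊞ A B C).hom ≫ h = coprodInl A (B ⊞ C) ≫ h := by
  rw [reassoc_of% inl_inl_parAssociator_hom]

@[simp]
lemma inr_inl_parAssociator_hom (A B C : X) :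
    coprodInr A B ≫ coprodInl (A ⊞ B) C ≫ (α⊞ A B C).hom = coprodInl B C ≫ coprodInr A (B ⊞ C) := by
  rw [← inl_inr_parAssociator_inv_assoc, Iso.inv_hom_id, Category.comp_id]

@[simp]
lemma inr_inl_parAssociator_hom_assoc (A B C : X) {W : X} (h : _ ⟶ W) :
    coprodInr A B ≫ coprodInl (A ⊞ B) C ≫ (α⊞ A B C).hom ≫ h =
      coprodInl B C ≫ coprodInr A (B ⊞ C) ≫ h := by
  rw [reassoc_of% inr_inl_parAssociator_hom]

@[simp]
lemma inr_parAssociator_hom (A B C : X) :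
    coprodInr (A ⊞ B) C ≫ (α⊞ A B C).hom = coprodInr B C ≫ coprodInr A (B ⊞ C) := by
  rw [← inr_inr_parAssociator_inv_assoc, Iso.inv_hom_id, Category.comp_id]

@[simp]
lemma inr_parAssociator_hom_assoc (A B C : X) {W : X} (h : _ ⟶ W) :
    coprodInr (A ⊞ B) C ≫ (α⊞ A B C).hom ≫ h = coprodInr B C ≫ coprodInr A (B ⊞ C) ≫ h := by
  rw [reassoc_of% inr_parAssociator_hom]

attribute [local instance] SymmLinDistCategory.parSymm

@[simp]
lemma inl_parBraiding_hom (A B : X) :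
    coprodInl A B ≫ (β⊞ A B).hom = coprodInr B A := by
  rw [coprodInl, Category.assoc, BraidedCategory.braiding_naturality_right,
    rightUnitor_inv_braiding_assoc, coprodInr]

@[simp]
lemma inl_parBraiding_hom_assoc (A B : X) {W : X} (h : _ ⟶ W) :
    coprodInl A B ≫ (β⊞ A B).hom ≫ h = coprodInr B A ≫ h := by
  rw [reassoc_of% inl_parBraiding_hom]

@[simp]
lemma inr_parBraiding_hom (A B : X) :
    coprodInr A B ≫ (β⊞ A B).hom = coprodInl B A := by
  rw [coprodInr, Category.assoc, BraidedCategory.braiding_naturality_left,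
    leftUnitor_inv_braiding_assoc, coprodInl]

@[simp]
lemma inr_parBraiding_hom_assoc (A B : X) {W : X} (h : _ ⟶ W) :
    coprodInr A B ≫ (β⊞ A B).hom ≫ h = coprodInl B A ≫ h := by
  rw [reassoc_of% inr_parBraiding_hom]

end Par

end Cartesian

section Distributivities

variable {X : Type u} [Category.{v} X] [LinDistCategory X]

/-! ## Naturality of the linear distributivities in each variable -/

lemma δL_natural_left {A A' : X} (f : A ⟶ A') (B C : X) :
    (f ▷⊠ (B ⊞ C)) ≫ δL A' B C = δL A B C ≫ ((f ▷⊠ B) ▷⊞ C) := by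
  simpa only [MonoidalCategory.tensorHom_id, MonoidalCategory.id_whiskerRight] using
    δL_natural f (𝟙 B) (𝟙 C)

lemma δL_natural_middle (A : X) {B B' : X} (g : B ⟶ B') (C : X) :
    (A ◁⊠ (g ▷⊞ C)) ≫ δL A B' C = δL A B C ≫ ((A ◁⊠ g) ▷⊞ C) := by
  simpa only [MonoidalCategory.tensorHom_id, MonoidalCategory.id_tensorHom] using
    δL_natural (𝟙 A) g (𝟙 C)

lemma δL_natural_right (A B : X) {C C' : X} (h : C ⟶ C') :
    (A ◁⊠ (B ◁⊞ h)) ≫ δL A B C' = δL A B C ≫ ((A ⊠ B) ◁⊞ h) := by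
  simpa only [MonoidalCategory.id_tensorHom, MonoidalCategory.whiskerLeft_id] using
    δL_natural (𝟙 A) (𝟙 B) h

lemma δR_natural_left {A A' : X} (f : A ⟶ A') (B C : X) :
    ((f ▷⊞ B) ▷⊠ C) ≫ δR A' B C = δR A B C ≫ (f ▷⊞ (B ⊠ C)) := by
  simpa only [MonoidalCategory.tensorHom_id, MonoidalCategory.id_whiskerRight] using
    δR_natural f (𝟙 B) (𝟙 C)

lemma δR_natural_middle (A : X) {B B' : X} (g : B ⟶ B') (C : X) :
    ((A ◁⊞ g) ▷⊠ C) ≫ δR A B' C = δR A B C ≫ (A ◁⊞ (g ▷⊠ C)) := by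
  simpa only [MonoidalCategory.tensorHom_id, MonoidalCategory.id_tensorHom] using
    δR_natural (𝟙 A) g (𝟙 C)

lemma δR_natural_right (A B : X) {C C' : X} (h : C ⟶ C') :
    ((A ⊞ B) ◁⊠ h) ≫ δR A B C' = δR A B C ≫ (A ◁⊞ (B ◁⊠ h)) := by
  simpa only [MonoidalCategory.id_tensorHom, MonoidalCategory.whiskerLeft_id] using
    δR_natural (𝟙 A) (𝟙 B) h

end Distributivities

section Medial

variable {X : Type u} [Category.{v} X] [SymmLinDistCategory X] [CartesianStructure X]

/-! ## Linear distributivities, projections and injections -/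

/-- The unit law determines `δL ⊤ₗ B C`; naturality along `toTop A` carries this to arbitrary `A`.
The next three lemmas exploit the other three unit laws in the same way, and together they are all
that is used about δ on projections and injections besides naturality and coherence. -/
lemma δL_snd (A B C : X) : δL A B C ≫ (prodSnd A B ▷⊞ C) = prodSnd A (B ⊞ C) := by
  have h : δL ⊤ₗ B C = (λ⊠ (B ⊞ C)).hom ≫ ((λ⊠ B).inv ▷⊞ C) := by
    rw [← leftUnit_δL, Iso.hom_inv_id_assoc]
  simp only [prodSnd, MonoidalCategory.comp_whiskerRight]
  rw [← reassoc_of% δL_natural_left, h, Category.assoc]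
  simp only [MonoidalCategory.inv_hom_whiskerRight, Category.comp_id]

lemma δR_fst (A B C : X) : δR A B C ≫ (A ◁⊞ prodFst B C) = prodFst (A ⊞ B) C := by
  have h : δR A B ⊤ₗ = (ρ⊠ (A ⊞ B)).hom ≫ (A ◁⊞ (ρ⊠ B).inv) := by
    rw [← rightUnit_δR, Iso.hom_inv_id_assoc]
  simp only [prodFst, MonoidalCategory.whiskerLeft_comp]
  rw [← reassoc_of% δR_natural_right, h, Category.assoc]
  simp only [MonoidalCategory.whiskerLeft_inv_hom, Category.comp_id]

/-- Here the unit is ⊥ in the last variable, and naturality is taken along `fromBot C`. -/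
lemma inl_δL (A B C : X) : (A ◁⊠ coprodInl B C) ≫ δL A B C = coprodInl (A ⊠ B) C := by
  have h : δL A B ⊥ₗ = (A ◁⊠ (ρ⊞ B).hom) ≫ (ρ⊞ (A ⊠ B)).inv := by
    rw [← δL_rightUnit, Category.assoc, Iso.hom_inv_id, Category.comp_id]
  simp only [coprodInl, MonoidalCategory.whiskerLeft_comp, Category.assoc]
  rw [δL_natural_right, h, Category.assoc]
  simp only [MonoidalCategory.whiskerLeft_inv_hom_assoc]

lemma inr_δR (A B C : X) : (coprodInr A B ▷⊠ C) ≫ δR A B C = coprodInr A (B ⊠ C) := by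
  have h : δR ⊥ₗ B C = ((λ⊞ B).hom ▷⊠ C) ≫ (λ⊞ (B ⊠ C)).inv := by
    rw [← δR_leftUnit, Category.assoc, Iso.hom_inv_id, Category.comp_id]
  simp only [coprodInr, MonoidalCategory.comp_whiskerRight, Category.assoc]
  rw [δR_natural_left, h, Category.assoc]
  simp only [MonoidalCategory.inv_hom_whiskerRight_assoc]

/-! ## The mix law -/

/-- All maps into the initial object are equal: the two composites of the linear distributivities
`(⊥ ⊗ (⊥ ⊕ ⊥)) ⊗ ⊥ ⟶ (⊥ ⊗ ⊥) ⊕ (⊥ ⊗ ⊥)`, followed by `[π₀, π₁]`, are the last and the first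
projection. -/
lemma toBot_ext {A : X} (f g : A ⟶ ⊥ₗ) : f = g := by
  -- The copairing [π₀, π₁] can be written as "apply π₀ to the left summand, remove the resulting ⊥,
  -- apply π₁". Naturality moves π₀ in front of δR, and the unit law for `δR ⊥ₗ` finishes.
  have hR : δR (⊥ₗ ⊠ ⊥ₗ) ⊥ₗ ⊥ₗ ≫ coprodDesc (prodFst ⊥ₗ ⊥ₗ) (prodSnd ⊥ₗ (⊥ₗ : X)) =
      prodSnd ((⊥ₗ ⊠ ⊥ₗ) ⊞ ⊥ₗ : X) ⊥ₗ := by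
    have h : coprodDesc (prodFst ⊥ₗ ⊥ₗ) (prodSnd ⊥ₗ (⊥ₗ : X)) =
        (prodFst ⊥ₗ ⊥ₗ ▷⊞ (⊥ₗ ⊠ ⊥ₗ)) ≫ (λ⊞ (⊥ₗ ⊠ ⊥ₗ)).hom ≫ prodSnd ⊥ₗ ⊥ₗ := by
      apply coprod_ext
      -- On the left summand the factorization adds an endomorphism of ⊥ after π₀; by initiality it
      -- is the identity.
      · simp [fromBot_ext (coprodInl ⊥ₗ (⊥ₗ ⊠ ⊥ₗ) ≫ (λ⊞ (⊥ₗ ⊠ ⊥ₗ)).hom ≫ prodSnd ⊥ₗ ⊥ₗ)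
          (𝟙 (⊥ₗ : X))]
      · simp
    rw [h, ← reassoc_of% δR_natural_left, reassoc_of% δR_leftUnit]
    simp
  -- The same copairing, now factored through the right summand, collapses δL to the first
  -- projection.
  have hL : δL ⊥ₗ ⊥ₗ (⊥ₗ ⊠ ⊥ₗ) ≫ coprodDesc (prodFst ⊥ₗ ⊥ₗ) (prodSnd ⊥ₗ (⊥ₗ : X)) =
      prodFst ⊥ₗ (⊥ₗ ⊞ (⊥ₗ ⊠ ⊥ₗ) : X) := by
    have h : coprodDesc (prodFst ⊥ₗ ⊥ₗ) (prodSnd ⊥ₗ (⊥ₗ : X)) =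
        ((⊥ₗ ⊠ ⊥ₗ) ◁⊞ prodSnd ⊥ₗ ⊥ₗ) ≫ (ρ⊞ (⊥ₗ ⊠ ⊥ₗ)).hom ≫ prodFst ⊥ₗ ⊥ₗ := by
      apply coprod_ext
      · simp
      · simp [fromBot_ext (coprodInr (⊥ₗ ⊠ ⊥ₗ) ⊥ₗ ≫ (ρ⊞ (⊥ₗ ⊠ ⊥ₗ)).hom ≫ prodFst ⊥ₗ ⊥ₗ)
          (𝟙 (⊥ₗ : X))]
    rw [h, ← reassoc_of% δL_natural_right, reassoc_of% δL_rightUnit]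
    simp
  -- The coherence law is evaluated at the generalized element ((f, ι₀f), g). By `hR` one side
  -- yields the last entry `g`, and by `hL` the other yields the first entry `f`. The middle entry
  -- plays no role; `f ≫ coprodInl ⊥ₗ ⊥ₗ` is just an available map to `⊥ₗ ⊞ ⊥ₗ`.
  have h := prodLift (prodLift f (f ≫ coprodInl ⊥ₗ ⊥ₗ)) g ≫=
    (δL_δR_tensor ⊥ₗ ⊥ₗ ⊥ₗ (⊥ₗ : X) =≫ coprodDesc (prodFst ⊥ₗ ⊥ₗ) (prodSnd ⊥ₗ ⊥ₗ))
  simp only [Category.assoc] at h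
  rw [hR, hL] at h
  simpa using h.symm

/-- The nullary mix map `⊥ ⟶ ⊤` satisfies the mix law. -/
lemma toTop_mix_law (A B : X) :
    (A ◁⊠ (λ⊞ B).inv) ≫ (A ◁⊠ (toTop ⊥ₗ ▷⊞ B)) ≫ δL A ⊤ₗ B ≫ ((ρ⊠ A).hom ▷⊞ B) =
      ((ρ⊞ A).inv ▷⊠ B) ≫ ((A ◁⊞ toTop ⊥ₗ) ▷⊠ B) ≫ δR A ⊤ₗ B ≫ (A ◁⊞ (λ⊠ B).hom) := by
  -- Moving `toTop ⊥ₗ` past the distributivities turns the unitors into projections: the claim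
  -- compares `δL A ⊥ₗ B` followed by π₀ with `δR A ⊥ₗ B` followed by π₁.
  rw [reassoc_of% δL_natural_middle, reassoc_of% δR_natural_middle]
  simp only [← MonoidalCategory.comp_whiskerRight, ← MonoidalCategory.whiskerLeft_comp]
  rw [← prodFst, ← prodSnd]
  -- Both sides end in (A ⊕ (⊥ ⊗ ⊥)) ⊕ B. Collapsing ⊥ ⊗ ⊥ by π₀ eliminates δR from the left side
  -- through `δR_fst`.
  have h := δL_δR_par A ⊥ₗ ⊥ₗ B =≫ ((A ◁⊞ prodFst ⊥ₗ ⊥ₗ) ▷⊞ B)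
  simp only [Category.assoc, ← MonoidalCategory.comp_whiskerRight, δR_fst,
    ← MonoidalCategory.associator_inv_naturality_middle] at h
  -- On the right side the inner δL is eliminated by π₁ and not by π₀, so the equality of the two
  -- projections of ⊥ ⊗ ⊥ is essential here.
  rw [toBot_ext (prodFst ⊥ₗ ⊥ₗ) (prodSnd ⊥ₗ (⊥ₗ : X))] at h
  simp only [← MonoidalCategory.whiskerLeft_comp_assoc, δL_snd] at h
  -- The spurious copies of ⊥ in (A ⊕ ⊥) ⊗ (⊥ ⊕ B) and (A ⊕ ⊥) ⊕ B are removed by injections before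
  -- and a unitor after.
  have h' := (coprodInl A ⊥ₗ ⊠ₕ coprodInr ⊥ₗ B) ≫= (h =≫ ((ρ⊞ A).hom ▷⊞ B))
  have hL : (coprodInl A ⊥ₗ ⊠ₕ coprodInr ⊥ₗ B) ≫ δL (A ⊞ ⊥ₗ) ⊥ₗ B =
      (A ◁⊠ coprodInr ⊥ₗ B) ≫ δL A ⊥ₗ B ≫ ((coprodInl A ⊥ₗ ▷⊠ ⊥ₗ) ▷⊞ B) := by
    simp only [MonoidalCategory.tensorHom_def', Category.assoc]
    rw [δL_natural_left]
  have hR : (coprodInl A ⊥ₗ ⊠ₕ coprodInr ⊥ₗ B) ≫ δR A ⊥ₗ (⊥ₗ ⊞ B) =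
      (coprodInl A ⊥ₗ ▷⊠ B) ≫ δR A ⊥ₗ B ≫ (A ◁⊞ (⊥ₗ ◁⊠ coprodInr ⊥ₗ B)) := by
    simp only [MonoidalCategory.tensorHom_def, Category.assoc]
    rw [δR_natural_right]
  simp only [Category.assoc] at h'
  rw [reassoc_of% hL, reassoc_of% hR] at h'
  simpa only [← MonoidalCategory.comp_whiskerRight, ← MonoidalCategory.whiskerLeft_comp,
    tensorRight_fst_assoc, tensorLeft_snd_assoc, MonoidalCategory.triangle_assoc_comp_right,
    inl_parRightUnitor_hom, inr_parLeftUnitor_hom, Category.comp_id, Category.assoc,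
    parLeftUnitor_inv, parRightUnitor_inv] using h'

/-! ## The canonical medial structure -/

/-- The canonical medial map `⟨π₀ + π₀, π₁ + π₁⟩`. -/
def medMap (A B C D : X) : (A ⊠ B) ⊞ (C ⊠ D) ⟶ (A ⊞ C) ⊠ (B ⊞ D) :=
  prodLift (prodFst A B ⊞ₕ prodFst C D) (prodSnd A B ⊞ₕ prodSnd C D)

@[simp]
lemma medMap_fst (A B C D : X) :
    medMap A B C D ≫ prodFst (A ⊞ C) (B ⊞ D) = (prodFst A B ⊞ₕ prodFst C D) :=
  prodLift_fst _ _

@[simp]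
lemma medMap_fst_assoc (A B C D : X) {W : X} (h : _ ⟶ W) :
    medMap A B C D ≫ prodFst (A ⊞ C) (B ⊞ D) ≫ h = (prodFst A B ⊞ₕ prodFst C D) ≫ h := by
  rw [reassoc_of% medMap_fst]

@[simp]
lemma medMap_snd (A B C D : X) :
    medMap A B C D ≫ prodSnd (A ⊞ C) (B ⊞ D) = (prodSnd A B ⊞ₕ prodSnd C D) :=
  prodLift_snd _ _

@[simp]
lemma medMap_snd_assoc (A B C D : X) {W : X} (h : _ ⟶ W) :
    medMap A B C D ≫ prodSnd (A ⊞ C) (B ⊞ D) ≫ h = (prodSnd A B ⊞ₕ prodSnd C D) ≫ h := by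
  rw [reassoc_of% medMap_snd]

-- With its companion for the second injection, this shows that the pairing and the copairing
-- descriptions of μ have the same matrix of components.
@[simp]
lemma inl_medMap (A B C D : X) :
    coprodInl (A ⊠ B) (C ⊠ D) ≫ medMap A B C D = (coprodInl A C ⊠ₕ coprodInl B D) :=
  prod_ext (by simp) (by simp)

@[simp]
lemma inl_medMap_assoc (A B C D : X) {W : X} (h : _ ⟶ W) :
    coprodInl (A ⊠ B) (C ⊠ D) ≫ medMap A B C D ≫ h = (coprodInl A C ⊠ₕ coprodInl B D) ≫ h := by
  rw [reassoc_of% inl_medMap]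

@[simp]
lemma inr_medMap (A B C D : X) :
    coprodInr (A ⊠ B) (C ⊠ D) ≫ medMap A B C D = (coprodInr A C ⊠ₕ coprodInr B D) :=
  prod_ext (by simp) (by simp)

@[simp]
lemma inr_medMap_assoc (A B C D : X) {W : X} (h : _ ⟶ W) :
    coprodInr (A ⊠ B) (C ⊠ D) ≫ medMap A B C D ≫ h = (coprodInr A C ⊠ₕ coprodInr B D) ≫ h := by
  rw [reassoc_of% inr_medMap]

/-- A map from a coproduct to a product is determined by its four components; the coherence laws of
μ below are matrix comparisons of this kind. -/
lemma medMap_natural {A A' B B' C C' D D' : X} (f : A ⟶ A') (g : B ⟶ B') (h : C ⟶ C')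
    (k : D ⟶ D') : ((f ⊠ₕ g) ⊞ₕ (h ⊠ₕ k)) ≫ medMap A' B' C' D' =
      medMap A B C D ≫ ((f ⊞ₕ h) ⊠ₕ (g ⊞ₕ k)) := by
  apply coprod_ext <;> apply prod_ext <;> simp

lemma medMap_tensor_assoc (A B C D E F : X) :
    medMap (A ⊠ B) C (D ⊠ E) F ≫ (medMap A B D E ▷⊠ (C ⊞ F)) ≫
        (α⊠ (A ⊞ D) (B ⊞ E) (C ⊞ F)).hom =
      ((α⊠ A B C).hom ⊞ₕ (α⊠ D E F).hom) ≫ medMap A (B ⊠ C) D (E ⊠ F) ≫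
        ((A ⊞ D) ◁⊠ medMap B C E F) := by
  -- The target is a product of three factors, nested in its second factor only; the last `prod_ext`
  -- succeeds just on those goals.
  apply coprod_ext <;> apply prod_ext <;> try apply prod_ext
  all_goals simp

lemma medMap_par_assoc (A B C D E F : X) :
    (α⊞ (A ⊠ B) (C ⊠ D) (E ⊠ F)).inv ≫ (medMap A B C D ▷⊞ (E ⊠ F)) ≫
        medMap (A ⊞ C) (B ⊞ D) E F =
      ((A ⊠ B) ◁⊞ medMap C D E F) ≫ medMap A B (C ⊞ E) (D ⊞ F) ≫
        ((α⊞ A C E).inv ⊠ₕ (α⊞ B D F).inv) := by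
  apply prod_ext <;> apply coprod_ext <;> try apply coprod_ext
  all_goals simp

lemma medMap_tensor_braiding (A B C D : X) :
    medMap A B C D ≫ (β⊠ (A ⊞ C) (B ⊞ D)).hom =
      ((β⊠ A B).hom ⊞ₕ (β⊠ C D).hom) ≫ medMap B A D C := by
  apply coprod_ext <;> apply prod_ext <;> simp

lemma medMap_par_braiding (A B C D : X) :
    medMap A B C D ≫ ((β⊞ A C).hom ⊠ₕ (β⊞ B D).hom) =
      (β⊞ (A ⊠ B) (C ⊠ D)).hom ≫ medMap C D A B := by
  apply coprod_ext <;> apply prod_ext <;> simp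

end Medial

section MedialStructure

variable {X : Type u} [Category.{v} X] [SymmLinDistCategory X] [CartesianStructure X]

/-! ## Medial maps and linear distributivities -/

/-- Only one factor of the target involves δ. The projection onto the other factor discards `Z`,
where `δR_fst` applies; in the factor with δ, naturality of δR at the second projections suffices.
-/
lemma medMap_δR_tensor (A B C D Z : X) :
    (medMap A B C D ▷⊠ Z) ≫ (α⊠ (A ⊞ C) (B ⊞ D) Z).hom ≫ ((A ⊞ C) ◁⊠ δR B D Z) =
      δR (A ⊠ B) (C ⊠ D) Z ≫ ((A ⊠ B) ◁⊞ (α⊠ C D Z).hom) ≫ medMap A B C (D ⊠ Z) := by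
  apply prod_ext
  · have h : ((A ⊠ B) ◁⊞ (α⊠ C D Z).hom) ≫ (prodFst A B ⊞ₕ prodFst C (D ⊠ Z)) =
        ((A ⊠ B) ◁⊞ prodFst (C ⊠ D) Z) ≫ (prodFst A B ⊞ₕ prodFst C D) := by
      apply coprod_ext <;> simp
    simp only [Category.assoc, tensorLeft_fst, tensorAssociator_hom_fst, tensorRight_fst_assoc,
      medMap_fst]
    rw [h, reassoc_of% δR_fst]
  -- The auxiliary equalities rewrite both sides as δR composed with a parallel tensor of
  -- projections, which is the shape of `δR_natural`.
  · have h : ((A ⊠ B) ◁⊞ (α⊠ C D Z).hom) ≫ (prodSnd A B ⊞ₕ prodSnd C (D ⊠ Z)) =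
        (prodSnd A B ⊞ₕ (prodSnd C D ⊠ₕ 𝟙 Z)) := by
      apply coprod_ext
      · simp
      · rw [inr_parLeft_assoc, inr_parHom, inr_parHom, ← Category.assoc]
        congr 1
        apply prod_ext <;> simp
    have h' : (medMap A B C D ▷⊠ Z) ≫ (α⊠ (A ⊞ C) (B ⊞ D) Z).hom ≫
        prodSnd (A ⊞ C) ((B ⊞ D) ⊠ Z) = ((prodSnd A B ⊞ₕ prodSnd C D) ⊠ₕ 𝟙 Z) := by
      apply prod_ext <;> simp
    simp only [Category.assoc, tensorLeft_snd, medMap_snd]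
    rw [h, ← δR_natural, reassoc_of% h']

/-- The mirror image exchanges the two factors: naturality of δL handles the first, and `δL_snd` the
second. -/
lemma medMap_δL_tensor (A B C D Z : X) :
    (Z ◁⊠ medMap A B C D) ≫ (α⊠ Z (A ⊞ C) (B ⊞ D)).inv ≫ (δL Z A C ▷⊠ (B ⊞ D)) =
      δL Z (A ⊠ B) (C ⊠ D) ≫ ((α⊠ Z A B).inv ▷⊞ (C ⊠ D)) ≫ medMap (Z ⊠ A) B C D := by
  apply prod_ext
  · have h : ((α⊠ Z A B).inv ▷⊞ (C ⊠ D)) ≫ (prodFst (Z ⊠ A) B ⊞ₕ prodFst C D) =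
        ((𝟙 Z ⊠ₕ prodFst A B) ⊞ₕ prodFst C D) := by
      apply coprod_ext
      · rw [inl_parRight_assoc, inl_parHom, inl_parHom, ← Category.assoc]
        congr 1
        apply prod_ext <;> simp
      · simp
    have h' : (Z ◁⊠ medMap A B C D) ≫ (α⊠ Z (A ⊞ C) (B ⊞ D)).inv ≫
        prodFst (Z ⊠ (A ⊞ C)) (B ⊞ D) = (𝟙 Z ⊠ₕ (prodFst A B ⊞ₕ prodFst C D)) := by
      apply prod_ext <;> simp
    simp only [Category.assoc, tensorRight_fst, medMap_fst]
    rw [h, ← δL_natural, reassoc_of% h']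
  · have h : ((α⊠ Z A B).inv ▷⊞ (C ⊠ D)) ≫ (prodSnd (Z ⊠ A) B ⊞ₕ prodSnd C D) =
        (prodSnd Z (A ⊠ B) ▷⊞ (C ⊠ D)) ≫ (prodSnd A B ⊞ₕ prodSnd C D) := by
      apply coprod_ext <;> simp
    simp only [Category.assoc, tensorRight_snd, tensorAssociator_inv_snd, tensorLeft_snd_assoc,
      medMap_snd]
    rw [h, reassoc_of% δL_snd]

/-- In the par laws the source is tested on injections: δR appears on the first summand, where it is
natural, and is removed on the second by `inr_δR`. -/
lemma medMap_δR_par (A B C D Z : X) :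
    (δR Z A B ▷⊞ (C ⊠ D)) ≫ (α⊞ Z (A ⊠ B) (C ⊠ D)).hom ≫ (Z ◁⊞ medMap A B C D) =
      medMap (Z ⊞ A) B C D ≫ ((α⊞ Z A C).hom ▷⊠ (B ⊞ D)) ≫ δR Z (A ⊞ C) (B ⊞ D) := by
  apply coprod_ext
  · have h : (coprodInl (Z ⊞ A) C ⊠ₕ coprodInl B D) ≫ ((α⊞ Z A C).hom ▷⊠ (B ⊞ D)) =
        ((𝟙 Z ⊞ₕ coprodInl A C) ⊠ₕ coprodInl B D) := by
      apply prod_ext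
      · simp only [tensorRight_fst, tensorHom_fst_assoc, tensorHom_fst, Category.assoc]
        congr 1
        apply coprod_ext <;> simp
      · simp
    have h' : coprodInl (Z ⊞ (A ⊠ B)) (C ⊠ D) ≫ (α⊞ Z (A ⊠ B) (C ⊠ D)).hom ≫
        (Z ◁⊞ medMap A B C D) = (𝟙 Z ⊞ₕ (coprodInl A C ⊠ₕ coprodInl B D)) := by
      apply coprod_ext <;> simp
    rw [inl_parRight_assoc, inl_medMap_assoc, h', reassoc_of% h, δR_natural]
  · have h : (coprodInr (Z ⊞ A) C ⊠ₕ coprodInr B D) ≫ ((α⊞ Z A C).hom ▷⊠ (B ⊞ D)) =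
        (coprodInr A C ⊠ₕ coprodInr B D) ≫ (coprodInr Z (A ⊞ C) ▷⊠ (B ⊞ D)) := by
      apply prod_ext <;> simp
    rw [inr_parRight_assoc, inr_medMap_assoc, reassoc_of% h, inr_δR]
    simp

/-- Here `inl_δL` removes δL on the first summand, and naturality handles the second. -/
lemma medMap_δL_par (A B C D Z : X) :
    ((A ⊠ B) ◁⊞ δL C D Z) ≫ (α⊞ (A ⊠ B) (C ⊠ D) Z).inv ≫ (medMap A B C D ▷⊞ Z) =
      medMap A B C (D ⊞ Z) ≫ ((A ⊞ C) ◁⊠ (α⊞ B D Z).inv) ≫ δL (A ⊞ C) (B ⊞ D) Z := by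
  apply coprod_ext
  · have h : (coprodInl A C ⊠ₕ coprodInl B (D ⊞ Z)) ≫ ((A ⊞ C) ◁⊠ (α⊞ B D Z).inv) =
        (coprodInl A C ⊠ₕ coprodInl B D) ≫ ((A ⊞ C) ◁⊠ coprodInl (B ⊞ D) Z) := by
      apply prod_ext <;> simp
    rw [inl_parLeft_assoc, inl_medMap_assoc, reassoc_of% h, inl_δL]
    simp
  · have h : (coprodInr A C ⊠ₕ coprodInr B (D ⊞ Z)) ≫ ((A ⊞ C) ◁⊠ (α⊞ B D Z).inv) =
        (coprodInr A C ⊠ₕ (coprodInr B D ⊞ₕ 𝟙 Z)) := by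
      apply prod_ext
      · simp
      · simp only [tensorLeft_snd, tensorHom_snd_assoc, tensorHom_snd, Category.assoc]
        congr 1
        apply coprod_ext <;> simp
    have h' : coprodInr (A ⊠ B) ((C ⊠ D) ⊞ Z) ≫ (α⊞ (A ⊠ B) (C ⊠ D) Z).inv ≫
        (medMap A B C D ▷⊞ Z) = ((coprodInr A C ⊠ₕ coprodInr B D) ⊞ₕ 𝟙 Z) := by
      apply coprod_ext <;> simp
    rw [inr_parLeft_assoc, inr_medMap_assoc, h', reassoc_of% h, δL_natural]

/-! ## The canonical medial structure -/

variable (X) in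
/-- The canonical medial structure of a cartesian linearly distributive category. -/
@[reducible]
def canonicalMedial : MedialStructure X where
  Δbot := fromBot (⊥ₗ ⊠ ⊥ₗ)
  nablaTop := toTop (⊤ₗ ⊞ ⊤ₗ : X)
  mix := toTop ⊥ₗ
  med := medMap
  med_natural := medMap_natural
  mix_law := toTop_mix_law
  med_δR_tensor := medMap_δR_tensor
  med_δL_tensor := medMap_δL_tensor
  med_δR_par := medMap_δR_par
  med_δL_par := medMap_δL_par
  Δbot_assoc := fromBot_ext _ _
  Δbot_mix_right := fromBot_ext _ _
  Δbot_mix_left := fromBot_ext _ _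
  Δbot_comm := fromBot_ext _ _
  nablaTop_assoc := toTop_ext _ _
  mix_right_nablaTop := toTop_ext _ _
  mix_left_nablaTop := toTop_ext _ _
  nablaTop_comm := toTop_ext _ _
  med_tensor_assoc := medMap_tensor_assoc
  med_par_assoc := medMap_par_assoc
  -- On the summand ⊥ initiality suffices; on `A ⊠ B` the two projections are compared. The ⊤-laws
  -- are dual.
  Δbot_med_left A B := coprod_ext (fromBot_ext _ _) (prod_ext (by simp) (by simp))
  Δbot_med_right A B := coprod_ext (prod_ext (by simp) (by simp)) (fromBot_ext _ _)
  med_nablaTop_left A B :=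
    prod_ext (toTop_ext _ _) (coprod_ext (by simp) (by simp))
  med_nablaTop_right A B :=
    prod_ext (coprod_ext (by simp) (by simp)) (toTop_ext _ _)
  med_tensor_braiding := medMap_tensor_braiding
  med_par_braiding := medMap_par_braiding

variable (X) in
lemma canonicalMedial_isCanonical : IsCanonicalMedialStructure (canonicalMedial X) where
  Δbot_eq := rfl
  Δbot_fst := fromBot_ext _ _
  Δbot_snd := fromBot_ext _ _
  nablaTop_eq := rfl
  inl_nablaTop := toTop_ext _ _
  inr_nablaTop := toTop_ext _ _
  mix_eq_toTop := rfl
  mix_eq_fromBot := fromBot_ext _ _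
  med_fst := medMap_fst
  med_snd := medMap_snd
  inl_med := inl_medMap
  inr_med := inr_medMap

end MedialStructure

section Functors

variable {X : Type u₁} [Category.{v₁} X] [SymmLinDistCategory X] {Y : Type u₂}
  [Category.{v₂} Y] [SymmLinDistCategory Y] [CartesianStructure Y]

/-! ## Functors between cartesian linearly distributive categories -/

namespace StrongSymmLinearFunctor

variable (F : StrongSymmLinearFunctor X Y)

/-- `F_⊗ ⊤` is terminal. -/
lemma toTop_ext {A : Y} (f g : A ⟶ F.T.obj ⊤ₗ) : f = g := by
  -- Strength transports the terminality of ⊤ along `mTop`.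
  rw [← cancel_mono (inv F.mTop)]
  exact LinDist.toTop_ext _ _

/-- `F_⊕ ⊥` is initial. -/
lemma fromBot_ext {A : Y} (f g : F.P.obj ⊥ₗ ⟶ A) : f = g := by
  rw [← cancel_epi (inv F.nBot)]
  exact LinDist.fromBot_ext _ _

end StrongSymmLinearFunctor

variable [CartesianStructure X]

section

attribute [local instance] TwoMonoidal.par

/-- Every functor is canonically monoidal for the coproducts. -/
@[reducible]
def canonicalParLax (T : X ⥤ Y) : ParLax T where
  ε := fromBot (T.obj ⊥ₗ)
  μ A B := coprodDesc (T.map (coprodInl A B)) (T.map (coprodInr A B))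
  μ_natural_left f B := by
    -- On each summand both sides are the image under `T` of a single map, so the laws reduce to the
    -- known identities between injections in `X`.
    apply coprod_ext <;> simp [← Functor.map_comp]
  μ_natural_right A f := by
    apply coprod_ext <;> simp [← Functor.map_comp]
  associativity A B C := by
    apply coprod_ext <;> try apply coprod_ext
    all_goals simp [← Functor.map_comp]
  left_unitality A := coprod_ext (fromBot_ext _ _) (by simp [← Functor.map_comp])
  right_unitality A := coprod_ext (by simp [← Functor.map_comp]) (fromBot_ext _ _)

end

section

attribute [local instance] TwoMonoidal.tensor

/-- Every functor is canonically comonoidal for the products. -/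
@[reducible]
def canonicalTensorOplax (P : X ⥤ Y) : TensorOplax P where
  η := toTop (P.obj ⊤ₗ)
  δ A B := prodLift (P.map (prodFst A B)) (P.map (prodSnd A B))
  δ_natural_left f B := by
    apply prod_ext <;> simp [← Functor.map_comp]
  δ_natural_right A f := by
    apply prod_ext <;> simp [← Functor.map_comp]
  oplax_associativity A B C := by
    apply prod_ext <;> try apply prod_ext
    all_goals simp [← Functor.map_comp]
  oplax_left_unitality A := prod_ext (toTop_ext _ _) (by simp [← Functor.map_comp])
  oplax_right_unitality A := prod_ext (by simp [← Functor.map_comp]) (toTop_ext _ _)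

end

namespace StrongSymmLinearFunctor

variable (F : StrongSymmLinearFunctor X Y)

/-- Right unitality of F_⊗ is this identity when the second argument is ⊤; naturality along `toTop
B` gives the general case. -/
lemma mTen_fst (A B : X) :
    F.mTen A B ≫ F.T.map (prodFst A B) = prodFst (F.T.obj A) (F.T.obj B) := by
  have h := @Functor.LaxMonoidal.right_unitality X _ TwoMonoidal.tensor Y _ TwoMonoidal.tensor
    F.T F.lax A
  -- This is where invertibility of `mTop` enters: discarding in `Y` factors through the image of
  -- discarding in `X`.
  have h' : toTop (F.T.obj B) = F.T.map (toTop B) ≫ inv F.mTop := LinDist.toTop_ext _ _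
  simp only [prodFst, Functor.map_comp]
  rw [← reassoc_of% F.mTen_natural_right, h', h]
  simp only [← MonoidalCategory.whiskerLeft_comp_assoc, Category.assoc, IsIso.inv_hom_id,
    Category.comp_id]

lemma mTen_snd (A B : X) :
    F.mTen A B ≫ F.T.map (prodSnd A B) = prodSnd (F.T.obj A) (F.T.obj B) := by
  have h := @Functor.LaxMonoidal.left_unitality X _ TwoMonoidal.tensor Y _ TwoMonoidal.tensor
    F.T F.lax B
  have h' : toTop (F.T.obj A) = F.T.map (toTop A) ≫ inv F.mTop := LinDist.toTop_ext _ _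
  simp only [prodSnd, Functor.map_comp]
  rw [← reassoc_of% F.mTen_natural_left, h', h]
  simp only [← MonoidalCategory.comp_whiskerRight_assoc, Category.assoc, IsIso.inv_hom_id,
    Category.comp_id]

/-- Dual to `mTen_fst`, from right unitality of the comonoidal functor F_⊕ and invertibility of
`nBot`. -/
lemma inl_nPar (A B : X) :
    F.P.map (coprodInl A B) ≫ F.nPar A B = coprodInl (F.P.obj A) (F.P.obj B) := by
  have h := @Functor.OplaxMonoidal.oplax_right_unitality X _ TwoMonoidal.par Y _ TwoMonoidal.par
    F.P F.oplax A
  have h' : fromBot (F.P.obj B) = inv F.nBot ≫ F.P.map (fromBot B) := LinDist.fromBot_ext _ _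
  simp only [coprodInl, Functor.map_comp, Category.assoc]
  rw [← F.nPar_natural_right, h', h]
  simp only [← MonoidalCategory.whiskerLeft_comp, Category.assoc, IsIso.hom_inv_id_assoc]

lemma inr_nPar (A B : X) :
    F.P.map (coprodInr A B) ≫ F.nPar A B = coprodInr (F.P.obj A) (F.P.obj B) := by
  have h := @Functor.OplaxMonoidal.oplax_left_unitality X _ TwoMonoidal.par Y _ TwoMonoidal.par
    F.P F.oplax B
  have h' : fromBot (F.P.obj A) = inv F.nBot ≫ F.P.map (fromBot A) := LinDist.fromBot_ext _ _
  simp only [coprodInr, Functor.map_comp, Category.assoc]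
  rw [← F.nPar_natural_left, h', h]
  simp only [← MonoidalCategory.comp_whiskerRight, Category.assoc, IsIso.hom_inv_id_assoc]

-- The inverse of `mTen` is thus the canonical product comparison. In this form the medial laws that
-- contain `inv (F.mTen _ _)` can be tested on projections; the lemmas on `inv (F.nPar _ _)` do the
-- same on injections.
@[simp]
lemma inv_mTen_fst (A B : X) :
    inv (F.mTen A B) ≫ prodFst (F.T.obj A) (F.T.obj B) = F.T.map (prodFst A B) := by
  rw [IsIso.inv_comp_eq, mTen_fst]

@[simp]
lemma inv_mTen_snd (A B : X) :
    inv (F.mTen A B) ≫ prodSnd (F.T.obj A) (F.T.obj B) = F.T.map (prodSnd A B) := by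
  rw [IsIso.inv_comp_eq, mTen_snd]

@[simp]
lemma inl_inv_nPar (A B : X) :
    coprodInl (F.P.obj A) (F.P.obj B) ≫ inv (F.nPar A B) = F.P.map (coprodInl A B) := by
  rw [IsIso.comp_inv_eq, inl_nPar]

@[simp]
lemma inr_inv_nPar (A B : X) :
    coprodInr (F.P.obj A) (F.P.obj B) ≫ inv (F.nPar A B) = F.P.map (coprodInr A B) := by
  rw [IsIso.comp_inv_eq, inr_nPar]

/-- The unit law treats the case where the first argument is ⊥; naturality along `fromBot A` extends
it, with `nBot` inverted. -/
lemma inr_νRT (A B : X) :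
    F.T.map (coprodInr A B) ≫ F.νRT A B = coprodInr (F.P.obj A) (F.T.obj B) := by
  have h : F.T.map (λ⊞ B).inv ≫ F.νRT ⊥ₗ B ≫ (F.nBot ▷⊞ F.T.obj B) =
      (λ⊞ (F.T.obj B)).inv := by
    rw [← cancel_mono (λ⊞ (F.T.obj B)).hom, Iso.inv_hom_id, Category.assoc, Category.assoc,
      F.νRT_unit, ← F.T.map_comp, Iso.inv_hom_id, F.T.map_id]
  have h' : fromBot (F.P.obj A) = inv F.nBot ≫ F.P.map (fromBot A) := LinDist.fromBot_ext _ _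
  simp only [coprodInr, Functor.map_comp, Category.assoc]
  rw [← F.νRT_natural_left, h', ← h]
  simp only [← MonoidalCategory.comp_whiskerRight, Category.assoc, IsIso.hom_inv_id_assoc]

/-- Dual to `inr_νRT`, from the unit law at ⊤ and naturality along `toTop A`. -/
lemma νRP_snd (A B : X) :
    F.νRP A B ≫ F.P.map (prodSnd A B) = prodSnd (F.T.obj A) (F.P.obj B) := by
  have h : (F.mTop ▷⊠ F.P.obj B) ≫ F.νRP ⊤ₗ B ≫ F.P.map (λ⊠ B).hom =
      (λ⊠ (F.P.obj B)).hom := by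
    rw [← cancel_epi (λ⊠ (F.P.obj B)).inv, Iso.inv_hom_id, reassoc_of% F.νRP_unit,
      ← F.P.map_comp, Iso.inv_hom_id, F.P.map_id]
  have h' : toTop (F.T.obj A) = F.T.map (toTop A) ≫ inv F.mTop := LinDist.toTop_ext _ _
  simp only [prodSnd, Functor.map_comp]
  rw [← reassoc_of% F.νRP_natural_left, h', ← h]
  simp only [← MonoidalCategory.comp_whiskerRight_assoc, Category.assoc, IsIso.inv_hom_id,
    Category.comp_id]

end StrongSymmLinearFunctor

/-! ## The canonical medial structure on a cartesian linear functor -/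

variable (F : StrongSymmLinearFunctor X Y)

/-- The maps `m_⊥`, `m_⊕`, `n_⊤` and `n_⊗` of a cartesian linear functor. -/
@[reducible]
def canonicalMedialFunctorData : MedialFunctorData F where
  parLax := canonicalParLax F.T
  tenOplax := canonicalTensorOplax F.P

lemma canonicalMedialFunctorData_isCanonical :
    IsCanonicalMedialFunctor (canonicalMedialFunctorData F) where
  mBot_eq := rfl
  inl_mPar _ _ := inl_coprodDesc _ _
  inr_mPar _ _ := inr_coprodDesc _ _
  nTop_eq := rfl
  nTen_fst _ _ := prodLift_fst _ _
  nTen_snd _ _ := prodLift_snd _ _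

end Functors

/-! ### Medial laws of a cartesian linear functor, and linear transformations. -/

section Functors

variable {X : Type u₁} [Category.{v₁} X] [SymmLinDistCategory X] [CartesianStructure X]
  {Y : Type u₂} [Category.{v₂} Y] [SymmLinDistCategory Y] [CartesianStructure Y]

namespace IsCanonicalMedialFunctor

variable {F G : StrongSymmLinearFunctor X Y} {M : MedialFunctorData F} {N : MedialFunctorData G}
  (c : IsCanonicalMedialFunctor M)

include c

/-- Everything in this namespace is derived from the universal characterizations in `c` alone, and
so holds for any canonical structure, not only for the one constructed above. -/
lemma inl_mPar_assoc (A B : X) {Z : Y} (k : F.T.obj (A ⊞ B) ⟶ Z) :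
    coprodInl (F.T.obj A) (F.T.obj B) ≫ M.mPar A B ≫ k = F.T.map (coprodInl A B) ≫ k := by
  rw [← c.inl_mPar, Category.assoc]

lemma inr_mPar_assoc (A B : X) {Z : Y} (k : F.T.obj (A ⊞ B) ⟶ Z) :
    coprodInr (F.T.obj A) (F.T.obj B) ≫ M.mPar A B ≫ k = F.T.map (coprodInr A B) ≫ k := by
  rw [← c.inr_mPar, Category.assoc]

lemma nTen_fst_assoc (A B : X) {Z : Y} (k : F.P.obj A ⟶ Z) :
    M.nTen A B ≫ prodFst (F.P.obj A) (F.P.obj B) ≫ k = F.P.map (prodFst A B) ≫ k := by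
  rw [← c.nTen_fst, Category.assoc]

lemma nTen_snd_assoc (A B : X) {Z : Y} (k : F.P.obj B ⟶ Z) :
    M.nTen A B ≫ prodSnd (F.P.obj A) (F.P.obj B) ≫ k = F.P.map (prodSnd A B) ≫ k := by
  rw [← c.nTen_snd, Category.assoc]

lemma mPar_braiding (A B : X) :
    M.mPar A B ≫ F.T.map (β⊞ A B).hom = (β⊞ (F.T.obj A) (F.T.obj B)).hom ≫ M.mPar B A := by
  apply coprod_ext
  · rw [c.inl_mPar_assoc, inl_parBraiding_hom_assoc, c.inr_mPar, ← F.T.map_comp,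
      inl_parBraiding_hom]
  · rw [c.inr_mPar_assoc, inr_parBraiding_hom_assoc, c.inl_mPar, ← F.T.map_comp,
      inr_parBraiding_hom]

lemma nTen_braiding (A B : X) :
    M.nTen A B ≫ (β⊠ (F.P.obj A) (F.P.obj B)).hom = F.P.map (β⊠ A B).hom ≫ M.nTen B A := by
  apply prod_ext
  · rw [Category.assoc, Category.assoc, tensorBraiding_hom_fst, c.nTen_fst, c.nTen_snd,
      ← F.P.map_comp, tensorBraiding_hom_fst]
  · rw [Category.assoc, Category.assoc, tensorBraiding_hom_snd, c.nTen_fst, c.nTen_snd,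
      ← F.P.map_comp, tensorBraiding_hom_snd]

/-- On each injection μ is a tensor of injections, and the law becomes naturality of `mTen` at
these. -/
lemma T_medMap (A B C D : X) :
    (F.mTen A B ⊞ₕ F.mTen C D) ≫ M.mPar (A ⊠ B) (C ⊠ D) ≫ F.T.map (medMap A B C D) =
      medMap (F.T.obj A) (F.T.obj B) (F.T.obj C) (F.T.obj D) ≫ (M.mPar A C ⊠ₕ M.mPar B D) ≫
        F.mTen (A ⊞ C) (B ⊞ D) := by
  apply coprod_ext
  · rw [inl_parHom_assoc, c.inl_mPar_assoc, ← F.T.map_comp, inl_medMap, inl_medMap_assoc,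
      ← F.mTen_natural]
    simp only [MonoidalCategory.tensorHom_comp_tensorHom_assoc, c.inl_mPar]
  · rw [inr_parHom_assoc, c.inr_mPar_assoc, ← F.T.map_comp, inr_medMap, inr_medMap_assoc,
      ← F.mTen_natural]
    simp only [MonoidalCategory.tensorHom_comp_tensorHom_assoc, c.inr_mPar]

/-- Dually, on each projection μ is a par of projections, and the law becomes naturality of `nPar`.
-/
lemma P_medMap (A B C D : X) :
    F.P.map (medMap A B C D) ≫ M.nTen (A ⊞ C) (B ⊞ D) ≫ (F.nPar A C ⊠ₕ F.nPar B D) =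
      F.nPar (A ⊠ B) (C ⊠ D) ≫ (M.nTen A B ⊞ₕ M.nTen C D) ≫
        medMap (F.P.obj A) (F.P.obj B) (F.P.obj C) (F.P.obj D) := by
  apply prod_ext
  · simp only [Category.assoc, tensorHom_fst, medMap_fst]
    rw [c.nTen_fst_assoc, ← F.P.map_comp_assoc, medMap_fst, ← F.nPar_natural]
    simp only [MonoidalCategory.tensorHom_comp_tensorHom, c.nTen_fst]
  · simp only [Category.assoc, tensorHom_snd, medMap_snd]
    rw [c.nTen_snd_assoc, ← F.P.map_comp_assoc, medMap_snd, ← F.nPar_natural]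
    simp only [MonoidalCategory.tensorHom_comp_tensorHom, c.nTen_snd]

/-- After a projection, `M.nTen` and the inverse of `mTen` both become images of projections,
leaving naturality of νRT at a pair of projections. -/
lemma νRT_medMap (A B C D : X) :
    F.T.map (medMap A B C D) ≫ inv (F.mTen (A ⊞ C) (B ⊞ D)) ≫ (F.νRT A C ⊠ₕ F.νRT B D) =
      F.νRT (A ⊠ B) (C ⊠ D) ≫ (M.nTen A B ⊞ₕ inv (F.mTen C D)) ≫
        medMap (F.P.obj A) (F.P.obj B) (F.T.obj C) (F.T.obj D) := by
  apply prod_ext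
  · simp only [Category.assoc, tensorHom_fst, medMap_fst,
      MonoidalCategory.tensorHom_comp_tensorHom, c.nTen_fst,
      StrongSymmLinearFunctor.inv_mTen_fst]
    rw [reassoc_of% F.inv_mTen_fst, ← F.T.map_comp_assoc, medMap_fst, F.νRT_natural]
  · simp only [Category.assoc, tensorHom_snd, medMap_snd,
      MonoidalCategory.tensorHom_comp_tensorHom, c.nTen_snd,
      StrongSymmLinearFunctor.inv_mTen_snd]
    rw [reassoc_of% F.inv_mTen_snd, ← F.T.map_comp_assoc, medMap_snd, F.νRT_natural]

/-- Before an injection, `M.mPar` and the inverse of `nPar` become images of injections, leaving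
naturality of νRP. -/
lemma νRP_medMap (A B C D : X) :
    (F.νRP A B ⊞ₕ F.νRP C D) ≫ inv (F.nPar (A ⊠ B) (C ⊠ D)) ≫ F.P.map (medMap A B C D) =
      medMap (F.T.obj A) (F.P.obj B) (F.T.obj C) (F.P.obj D) ≫
        (M.mPar A C ⊠ₕ inv (F.nPar B D)) ≫ F.νRP (A ⊞ C) (B ⊞ D) := by
  apply coprod_ext
  · rw [inl_parHom_assoc, reassoc_of% F.inl_inv_nPar, ← F.P.map_comp, inl_medMap,
      inl_medMap_assoc, ← F.νRP_natural]
    simp only [MonoidalCategory.tensorHom_comp_tensorHom_assoc, c.inl_mPar,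
      StrongSymmLinearFunctor.inl_inv_nPar]
  · rw [inr_parHom_assoc, reassoc_of% F.inr_inv_nPar, ← F.P.map_comp, inr_medMap,
      inr_medMap_assoc, ← F.νRP_natural]
    simp only [MonoidalCategory.tensorHom_comp_tensorHom_assoc, c.inr_mPar,
      StrongSymmLinearFunctor.inr_inv_nPar]

/-- On the summand `F.T.obj (A ⊞ B)` this is naturality of νRT in its second variable, along the
injection of `B`; on `F.T.obj C` it is `inr_νRT`. -/
lemma mPar_νRT (A B C : X) :
    M.mPar (A ⊞ B) C ≫ F.T.map (α⊞ A B C).hom ≫ F.νRT A (B ⊞ C) =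
      (F.νRT A B ▷⊞ F.T.obj C) ≫ (α⊞ (F.P.obj A) (F.T.obj B) (F.T.obj C)).hom ≫
        (F.P.obj A ◁⊞ M.mPar B C) := by
  apply coprod_ext
  · have h : coprodInl (A ⊞ B) C ≫ (α⊞ A B C).hom = (A ◁⊞ coprodInl B C) := by
      apply coprod_ext <;> simp
    have h' : coprodInl (F.P.obj A ⊞ F.T.obj B) (F.T.obj C) ≫
        (α⊞ (F.P.obj A) (F.T.obj B) (F.T.obj C)).hom ≫ (F.P.obj A ◁⊞ M.mPar B C) =
        (F.P.obj A ◁⊞ F.T.map (coprodInl B C)) := by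
      apply coprod_ext <;> simp [← c.inl_mPar]
    rw [c.inl_mPar_assoc, ← F.T.map_comp_assoc, h, inl_parRight_assoc, h', F.νRT_natural_right]
  · rw [c.inr_mPar_assoc, ← F.T.map_comp_assoc, inr_parAssociator_hom, F.T.map_comp,
      Category.assoc, F.inr_νRT, inr_parRight_assoc, inr_parAssociator_hom_assoc, inr_parLeft,
      c.inr_mPar_assoc]

/-- Dual to `mPar_νRT`: the first projection uses naturality of νRP in its second variable, and the
last uses `νRP_snd`. -/
lemma νRP_nTen (A B C : X) :
    F.νRP A (B ⊠ C) ≫ F.P.map (α⊠ A B C).inv ≫ M.nTen (A ⊠ B) C =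
      (F.T.obj A ◁⊠ M.nTen B C) ≫ (α⊠ (F.T.obj A) (F.P.obj B) (F.P.obj C)).inv ≫
        (F.νRP A B ▷⊠ F.P.obj C) := by
  apply prod_ext
  · have h : (α⊠ A B C).inv ≫ prodFst (A ⊠ B) C = (A ◁⊠ prodFst B C) := by
      apply prod_ext <;> simp
    have h' : (F.T.obj A ◁⊠ M.nTen B C) ≫ (α⊠ (F.T.obj A) (F.P.obj B) (F.P.obj C)).inv ≫
        prodFst (F.T.obj A ⊠ F.P.obj B) (F.P.obj C) =
        (F.T.obj A ◁⊠ F.P.map (prodFst B C)) := by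
      apply prod_ext <;> simp [← c.nTen_fst]
    simp only [Category.assoc, tensorRight_fst]
    rw [c.nTen_fst, ← F.P.map_comp, h, reassoc_of% h', F.νRP_natural_right]
  · simp only [Category.assoc, tensorRight_snd, tensorAssociator_inv_snd, tensorLeft_snd_assoc,
      c.nTen_snd]
    rw [← F.P.map_comp, tensorAssociator_inv_snd, F.P.map_comp, reassoc_of% F.νRP_snd]

/-- Linear transformations are compatible with canonical medial structures. -/
lemma isMedialTransformation (d : IsCanonicalMedialFunctor N)
    (α : LinearTransformation F.toLinearFunctor G.toLinearFunctor) :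
    IsMedialTransformation M N α where
  t_mBot := fromBot_ext _ _
  t_mPar A B := by
    apply coprod_ext
    · rw [c.inl_mPar_assoc, inl_parHom_assoc, d.inl_mPar, α.t.naturality]
    · rw [c.inr_mPar_assoc, inr_parHom_assoc, d.inr_mPar, α.t.naturality]
  p_nTop := toTop_ext _ _
  p_nTen A B := by
    apply prod_ext
    · simp only [Category.assoc, tensorHom_fst, c.nTen_fst, d.nTen_fst_assoc, α.p.naturality]
    · simp only [Category.assoc, tensorHom_snd, c.nTen_snd, d.nTen_snd_assoc, α.p.naturality]

end IsCanonicalMedialFunctor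

end Functors

/-! ### Canonical structures are unique and stable under composition. -/

section Uniqueness

variable {X : Type u₁} [Category.{v₁} X] [SymmLinDistCategory X] [CartesianStructure X]
  {Y : Type u₂} [Category.{v₂} Y] [SymmLinDistCategory Y] [CartesianStructure Y]
  {Z : Type u₃} [Category.{v₃} Z] [SymmLinDistCategory Z] [CartesianStructure Z]

namespace IsCanonicalMedialFunctor

/-- The medial structure of the identity functor is canonical. -/
lemma id : IsCanonicalMedialFunctor (MedialFunctorData.id X) where
  mBot_eq := fromBot_ext _ _
  inl_mPar _ _ := Category.comp_id _
  inr_mPar _ _ := Category.comp_id _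
  nTop_eq := toTop_ext _ _
  nTen_fst _ _ := Category.id_comp _
  nTen_snd _ _ := Category.id_comp _

/-- Composites of canonical medial structures are canonical. -/
lemma comp {F : StrongSymmLinearFunctor X Y} {G : StrongSymmLinearFunctor Y Z}
    {M : MedialFunctorData F} {N : MedialFunctorData G} (c : IsCanonicalMedialFunctor M)
    (d : IsCanonicalMedialFunctor N) : IsCanonicalMedialFunctor (M.comp N) where
  mBot_eq := fromBot_ext _ _
  inl_mPar A B := by
    rw [MedialFunctorData.comp_mPar]
    exact (d.inl_mPar_assoc _ _ _).trans
      ((G.T.map_comp _ _).symm.trans (congrArg G.T.map (c.inl_mPar A B)))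
  inr_mPar A B := by
    rw [MedialFunctorData.comp_mPar]
    exact (d.inr_mPar_assoc _ _ _).trans
      ((G.T.map_comp _ _).symm.trans (congrArg G.T.map (c.inr_mPar A B)))
  nTop_eq := toTop_ext _ _
  nTen_fst A B := by
    rw [MedialFunctorData.comp_nTen]
    exact (Category.assoc _ _ _).trans ((congrArg (_ ≫ ·) (d.nTen_fst _ _)).trans
      ((G.P.map_comp _ _).symm.trans (congrArg G.P.map (c.nTen_fst A B))))
  nTen_snd A B := by
    rw [MedialFunctorData.comp_nTen]
    exact (Category.assoc _ _ _).trans ((congrArg (_ ≫ ·) (d.nTen_snd _ _)).trans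
      ((G.P.map_comp _ _).symm.trans (congrArg G.P.map (c.nTen_snd A B))))

end IsCanonicalMedialFunctor

/-- Medial linear functors with canonical structures are determined by the underlying linear
functors. -/
lemma MedialLinearFunctor.ext_of_isCanonical [MedialStructure X] [MedialStructure Y]
    {F G : MedialLinearFunctor X Y}
    (h : F.toStrongSymmLinearFunctor = G.toStrongSymmLinearFunctor)
    (c : IsCanonicalMedialFunctor F.medial.toMedialFunctorData)
    (d : IsCanonicalMedialFunctor G.medial.toMedialFunctorData) : F = G := by
  obtain ⟨F, M⟩ := F
  obtain ⟨G, N⟩ := G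
  dsimp only at h
  subst h
  -- The universal properties fix `mBot` and `nTop`; `mPar` and `nTen` are fixed by their injections
  -- and projections, which agree by `c` and `d`.
  refine ext_of_heq rfl (heq_of_eq (fromBot_ext _ _)) (heq_of_eq ?_) (heq_of_eq (toTop_ext _ _))
    (heq_of_eq ?_)
  · funext A B
    exact coprod_ext ((c.inl_mPar A B).trans (d.inl_mPar A B).symm)
      ((c.inr_mPar A B).trans (d.inr_mPar A B).symm)
  · funext A B
    exact prod_ext ((c.nTen_fst A B).trans (d.nTen_fst A B).symm)
      ((c.nTen_snd A B).trans (d.nTen_snd A B).symm)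

/-- The canonical strong symmetric medial linear structure of a cartesian linear functor. -/
@[reducible]
def canonicalMedialFunctor (F : StrongSymmLinearFunctor X Y) :
    @MedialFunctorStructure X _ Y _ _ _ (canonicalMedial X) (canonicalMedial Y) F :=
  letI := canonicalMedial X
  letI := canonicalMedial Y
  have c := canonicalMedialFunctorData_isCanonical F
  { toMedialFunctorData := canonicalMedialFunctorData F
    mPar_braiding := c.mPar_braiding
    nTen_braiding := c.nTen_braiding
    -- Each nullary law has source ⊥ or F_⊕ ⊥, or target ⊤ or F_⊗ ⊤; these are initial and terminal
    -- respectively, by strength where F occurs.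
    T_Δbot := fromBot_ext _ _
    T_nablaTop := F.toTop_ext _ _
    T_mix := fromBot_ext _ _
    T_med := c.T_medMap
    P_Δbot := F.fromBot_ext _ _
    P_nablaTop := toTop_ext _ _
    P_mix := toTop_ext _ _
    P_med := c.P_medMap
    νRP_Δbot := F.fromBot_ext _ _
    νRT_nablaTop := F.toTop_ext _ _
    νRT_med := c.νRT_medMap
    νRP_med := c.νRP_medMap
    mPar_νRT := c.mPar_νRT
    νRP_nTen := c.νRP_nTen }

end Uniqueness

section Inclusion

/-! ## The inclusion 2-functor -/

/-- The inclusion on cells, with the canonical medial structures. -/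
abbrev canonicalInclusionStruct : PrelaxFunctorStruct CLDC.{v, u} SMLDC.{v, u} :=
  inclusionStruct (fun X => canonicalMedial X.carrier) (fun F => canonicalMedialFunctor F)
    (fun {_ _ F G} α => (canonicalMedialFunctorData_isCanonical F).isMedialTransformation
      (canonicalMedialFunctorData_isCanonical G) α)

/-- The underlying linear functors coincide definitionally. Their two medial structures, canonical
and identity, are both canonical and hence equal. -/
lemma canonicalInclusionStruct_map_id (X : CLDC.{v, u}) :
    canonicalInclusionStruct.map (𝟙 X) = 𝟙 (canonicalInclusionStruct.obj X) :=
  letI := canonicalMedial X.carrier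
  MedialLinearFunctor.ext_of_isCanonical (X := X.carrier) (Y := X.carrier) rfl
    (canonicalMedialFunctorData_isCanonical _) IsCanonicalMedialFunctor.id

/-- The same uniqueness argument, with the composite of canonical structures in place of the
identity structure. -/
lemma canonicalInclusionStruct_map_comp {X Y Z : CLDC.{v, u}} (F : X ⟶ Y) (G : Y ⟶ Z) :
    canonicalInclusionStruct.map (F ≫ G) =
      canonicalInclusionStruct.map F ≫ canonicalInclusionStruct.map G :=
  letI := canonicalMedial X.carrier
  letI := canonicalMedial Y.carrier
  letI := canonicalMedial Z.carrier
  MedialLinearFunctor.ext_of_isCanonical (X := X.carrier) (Y := Z.carrier) rfl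
    (canonicalMedialFunctorData_isCanonical _)
    ((canonicalMedialFunctorData_isCanonical F).comp (canonicalMedialFunctorData_isCanonical G))

/-- The inclusion 2-functor from cartesian to symmetric medial linearly distributive categories. -/
def canonicalInclusion : StrictPseudofunctor CLDC.{v, u} SMLDC.{v, u} :=
  StrictPseudofunctor.mk''
    { toPrelaxFunctorStruct := canonicalInclusionStruct
      map₂_id := fun _ => rfl
      map₂_comp := fun _ _ => rfl
      map_id := canonicalInclusionStruct_map_id
      map_comp := canonicalInclusionStruct_map_comp
      -- The equalities of 1-cells above are not definitional, so whiskerings are compared up to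
      -- `eqToHom`; the underlying natural transformations are literally the same.
      map₂_whisker_left := fun _ _ _ _ => SMLDC.eq_conj _ _ _ _ HEq.rfl HEq.rfl
      map₂_whisker_right := fun _ _ => SMLDC.eq_conj _ _ _ _ HEq.rfl HEq.rfl }

end Inclusion

end LinDist

theorem mainTheorem5 :
    ∃ (med : ∀ X : LinDist.CLDC.{v, u}, LinDist.MedialStructure X.carrier)
      (medF : ∀ {X Y : LinDist.CLDC.{v, u}} (F : X ⟶ Y),
        @LinDist.MedialFunctorStructure X.carrier _ Y.carrier _ _ _ (med X) (med Y) F)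
      (medT : ∀ {X Y : LinDist.CLDC.{v, u}} {F G : X ⟶ Y} (α : F ⟶ G),
        LinDist.IsMedialTransformation (medF F).toMedialFunctorData
          (medF G).toMedialFunctorData α),
      (∀ X, LinDist.IsCanonicalMedialStructure (med X)) ∧
      (∀ {X Y : LinDist.CLDC.{v, u}} (F : X ⟶ Y),
        LinDist.IsCanonicalMedialFunctor (medF F).toMedialFunctorData) ∧
      ∃ I : StrictPseudofunctor LinDist.CLDC.{v, u} LinDist.SMLDC.{v, u},
        I.toPrelaxFunctorStruct = LinDist.inclusionStruct med medF medT :=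
  ⟨fun X => LinDist.canonicalMedial X.carrier, fun F => LinDist.canonicalMedialFunctor F,
    fun {_ _ F G} α => (LinDist.canonicalMedialFunctorData_isCanonical F).isMedialTransformation
      (LinDist.canonicalMedialFunctorData_isCanonical G) α,
    fun X => LinDist.canonicalMedial_isCanonical X.carrier,
    fun F => LinDist.canonicalMedialFunctorData_isCanonical F,
    -- The 2-functor was built on `canonicalInclusionStruct`, so its action on cells is the
    -- prescribed one by definition.
    LinDist.canonicalInclusion, rfl⟩
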